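/- **Setting.** Let $n\in\{2,3\}$, $Y=(0,1]^n$, and let $D$ be an open set with $\overline D\subset(0,1)^n$ and boundary of class $C^{1,\gamma}$ for some $\gamma\in(0,1]$. Fix $\alpha\in(-\pi,\pi]^n$, $\alpha\neq0$. Let $L^2_\#$ be the space of $\alpha$-quasi-periodic functions in $L^2_{loc}(\mathbb R^n)$ with the $L^2(Y)$ inner product, and $H^1_\#$ the space of $\alpha$-quasi-periodic functions in $H^1_{loc}(\mathbb R^n)$, a Hilbert space under $\langle u,v\rangle=\int_Y\nabla u\cdot\nabla\bar v\,dx$. Let $(-\Delta_\alpha)^{-1}:L^2_\#\to H^1_\#$ be given by $\langle(-\Delta_\alpha)^{-1}f,v\rangle=\int_Y f\bar v\,dx$ for all $v\in H^1_\#$, and let $-\Delta_D^{-1}:L^2(D)\to L^2(D)$ be the inverse of the negative Dirichlet Laplacian on $D$. Let $W_1\subset H^1_\#$ be the closure of the functions vanishing in a neighbourhood of $\overline D$, $W_2\subset H^1_\#$ the functions of $H^1_0(D)$ extended by zero in $Y$, and $W_3=(W_1\oplus W_2)^\perp$. Let $T:W_3\to W_3$ be given by $\langle Tu,v\rangle=\frac12\int_{Y\setminus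 D}\nabla u\cdot\nabla\bar v\,dx-\frac12\int_D\nabla u\cdot\nabla\bar v\,dx$; its distinct eigenvalues are $\mu_i\in[-\frac12,\frac12]$, and $P_\mu$ is the orthogonal projection of $H^1_\#$ onto the eigenspace of $T$ for $\mu$. Let $P_1=Q_1+P_{1/2}$, with $Q_1$ the orthogonal projection onto $W_1$, and let $P_2$ be the orthogonal projection onto $W_2$. Put $$A^\alpha(z)=\Big(zP_1+P_2+z\sum_{-\frac12<\mu_i<\frac12}\big[(\tfrac12+\mu_i)+z(\tfrac12-\mu_i)\big]^{-1}P_{\mu_i}\Big)(-\Delta_\alpha)^{-1}$$ (a strongly convergent sum), regarded as an operator on $L^2_\#$, and $R(\zeta,z)=(A^\alpha(z)-\zeta)^{-1}$. Write $A^\alpha(z)=A^\alpha(0)+\sum_{k\ge1}z^kA^\alpha_k$ near $z=0$. **Hypotheses.** The lowest eigenvalue $\mu^-=\min_i\mu_i$ of $T$ exists and satisfies $-\frac12<\mu^-<0$. Put $z^*=\dfrac{\mu^-+1/2}{\mu^--1/2}$. Let $\beta_0$ be an eigenvalue of $-\Delta_D^{-1}$ and let $\Gamma$ be a positively oriented closed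 piecewise $C^1$ contour, avoiding $\sigma(-\Delta_D^{-1})$, winding $0$ times or once around each point off it, which encloses $\beta_0$ and no other point of $\sigma(-\Delta_D^{-1})$. Put $$d=\inf_{\zeta\in\Gamma}\operatorname{dist}\big(\zeta,\sigma(-\Delta_D^{-1})\big),\qquad r^*=\frac{|\alpha|^2d\,|z^*|}{\frac1{1/2-\mu^-}+|\alpha|^2d},\qquad P(z)=-\frac1{2\pi i}\oint_\Gamma R(\zeta,z)\,d\zeta .$$ **Theorem.** 1. If $|z|<r^*$, then $\Gamma$ lies in the resolvent sets of $A^\alpha(0)$ and of $A^\alpha(z)$. So $\Gamma$ separates $\sigma(A^\alpha(z))$ into the part $\Sigma'(z)$ inside and the part $\Sigma''(z)$ outside $\Gamma$. Moreover $P(z)$ is the spectral projection for $\Sigma'(z)$: $P(z)^2=P(z)$, $P(z)$ commutes with $A^\alpha(z)$, and $A^\alpha(z)$ has spectrum $\Sigma'(z)$ on the invariant subspace $M'(z)=P(z)L^2_\#$ and spectrum $\Sigma''(z)$ on $\ker P(z)$. 2. $P(z)$ is holomorphic (in operator norm) for $|z|<r^*$. 3. For $|z|<r^*$ the space $M'(z)$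 is finite-dimensional and isomorphic to $M'(0)$. 4. Let $m=\dim M'(0)$ and let $\hat\beta(z)=\frac1m\operatorname{tr}\big(A^\alpha(z)P(z)\big)$ be the mean of the eigenvalue group. Uniformly for $|z|<r^*$, $$\hat\beta(z)=\beta_0+\sum_{k=1}^\infty z^k\beta_k,\qquad \beta_k=\frac1{2\pi i\,m}\operatorname{tr}\sum_{k_1+\dots+k_p=k,\ k_j\ge1}\frac{(-1)^p}p\oint_\Gamma A^\alpha_{k_1}R(\zeta,0)\cdots A^\alpha_{k_p}R(\zeta,0)\,d\zeta .$$ -/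

import Mathlib

open MeasureTheory Set Filter Topology
open scoped ComplexConjugate ContDiff ENNReal

noncomputable section

namespace HighContrast

/-- The space `ℝⁿ` with its Euclidean norm. -/
abbrev Pt (n : ℕ) : Type := EuclideanSpace ℝ (Fin n)

/-- The unit period cell `Y = (0,1]ⁿ`. -/
def cell (n : ℕ) : Set (Pt n) := {x | ∀ j, x j ∈ Ioc (0 : ℝ) 1}

lemma measurableSet_cell (n : ℕ) : MeasurableSet (cell n) := by
  have : cell n = ⋂ j, (fun x : Pt n => x j) ⁻¹' Ioc (0 : ℝ) 1 := by
    ext x; simp [cell]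
  rw [this]
  exact MeasurableSet.iInter fun j => measurableSet_Ioc.preimage (by fun_prop)

/-- Lebesgue measure on `Y`. -/
abbrev cellMeasure (n : ℕ) : Measure (Pt n) := volume.restrict (cell n)

lemma cell_subset_closedBall (n : ℕ) : cell n ⊆ Metric.closedBall 0 (Real.sqrt n) := by
  intro x hx
  rw [mem_closedBall_zero_iff, EuclideanSpace.norm_eq]
  refine Real.sqrt_le_sqrt ?_
  calc ∑ i, ‖x i‖ ^ 2 ≤ ∑ _i : Fin n, (1 : ℝ) := by
        refine Finset.sum_le_sum fun i _ => ?_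
        have := hx i
        rw [Real.norm_eq_abs, sq_abs]
        nlinarith [this.1, this.2]
    _ = n := by simp

instance (n : ℕ) : IsFiniteMeasure (cellMeasure n) := by
  constructor
  rw [Measure.restrict_apply_univ]
  exact (measure_mono (cell_subset_closedBall n)).trans_lt measure_closedBall_lt_top

/-- `L²_#(α,Y)`: an `α`-quasi-periodic `L²_loc` function is the same thing as its restriction to `Y`,
and the norm is that of `L²(Y)`, so the space is realised as `L²(Y)`. -/
abbrev L2 (n : ℕ) : Type := Lp ℂ 2 (cellMeasure n)

/-- Vector fields `(g_1, …, g_n)` in `L²(Y)ⁿ`, with the Hilbert norm `(∑_j ‖g_j‖²)^{1/2}`. -/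
abbrev VecL2 (n : ℕ) : Type := PiLp 2 (fun _ : Fin n => L2 n)

/-- The quasi-periodic plane wave `x ↦ exp(i (2πk + α)·x)`. -/
def wave {n : ℕ} (α : Pt n) (k : Fin n → ℤ) (x : Pt n) : ℂ :=
  Complex.exp (Complex.I * ((∑ j, (2 * Real.pi * (k j : ℝ) + α j) * x j : ℝ) : ℂ))

lemma norm_wave {n : ℕ} (α : Pt n) (k : Fin n → ℤ) (x : Pt n) : ‖wave α k x‖ = 1 := by
  rw [wave, mul_comm]; exact Complex.norm_exp_ofReal_mul_I _

lemma contDiff_wave {n : ℕ} (α : Pt n) (k : Fin n → ℤ) : ContDiff ℝ ∞ (wave α k) := by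
  unfold wave
  have h : ContDiff ℝ ∞ (fun x : Pt n => (∑ j, (2 * Real.pi * (k j : ℝ) + α j) * x j : ℝ)) := by
    fun_prop
  exact (contDiff_const.mul (Complex.ofRealCLM.contDiff.comp h)).cexp

lemma fderiv_wave {n : ℕ} (α : Pt n) (k : Fin n → ℤ) (x : Pt n) (j : Fin n) :
    fderiv ℝ (wave α k) x (EuclideanSpace.single j 1)
      = Complex.I * ((2 * Real.pi * (k j : ℝ) + α j : ℝ) : ℂ) * wave α k x := by
  have h1 : HasFDerivAt (fun x : Pt n => (∑ j, (2 * Real.pi * (k j : ℝ) + α j) * x j : ℝ))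
      (∑ j, (2 * Real.pi * (k j : ℝ) + α j) • (EuclideanSpace.proj j : Pt n →L[ℝ] ℝ)) x := by
    refine HasFDerivAt.fun_sum fun i _ => ?_
    exact ((EuclideanSpace.proj i : Pt n →L[ℝ] ℝ).hasFDerivAt).const_mul _
  have h2 := ((Complex.ofRealCLM.hasFDerivAt.comp x h1).const_mul Complex.I).cexp
  have h3 : fderiv ℝ (wave α k) x = _ := h2.fderiv
  rw [h3]
  simp [wave, PiLp.single_apply, mul_comm]

lemma integral_cell {n : ℕ} {F : Type*} [NormedAddCommGroup F] [NormedSpace ℝ F] (f : Pt n → F) :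
    ∫ x, f x ∂(cellMeasure n) =
      ∫ x : Fin n → ℝ in {x | ∀ i, x i ∈ Ioc (0:ℝ) (0 + 1)}, f (WithLp.toLp 2 x) := by
  have := (PiLp.volume_preserving_toLp (Fin n)).setIntegral_preimage_emb
    (MeasurableEquiv.toLp 2 (Fin n → ℝ)).measurableEmbedding f (cell n)
  rw [← this]
  simp [cell]

lemma hasSum_wave {n : ℕ} (α : Pt n) (f : L2 n) :
    HasSum (fun k : Fin n → ℤ => ‖∫ x, f x * conj (wave α k x) ∂(cellMeasure n)‖ ^ 2)
      (‖f‖ ^ 2) := by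
  let : MeasureSpace UnitAddCircle := ⟨AddCircle.haarAddCircle⟩
  let : IsProbabilityMeasure (volume : Measure UnitAddCircle) :=
    inferInstanceAs (IsProbabilityMeasure AddCircle.haarAddCircle)
  set B : Set (Fin n → ℝ) := {x | ∀ i, x i ∈ Ioc (0:ℝ) (0 + 1)} with hB
  have hBm : MeasurableSet B := MeasurableSet.univ_pi' (fun i => measurableSet_Ioc)
  -- remove the phase and transplant to the torus
  let g : Pt n → ℂ := fun x => f x * conj (wave α 0 x)
  have hg : MemLp g 2 (cellMeasure n) := by
    refine (Lp.memLp f).mono ?_ (Eventually.of_forall fun x => ?_)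
    · exact (Lp.memLp f).1.mul
        (Complex.continuous_conj.comp (contDiff_wave α 0).continuous).aestronglyMeasurable
    · simp [g, norm_wave]
  let G : UnitAddTorus (Fin n) → ℂ := fun t =>
    g (WithLp.toLp 2 (UnitAddTorus.measurableEquivPiIoc (0 : Fin n → ℝ) t).1)
  have hG : MemLp G 2 volume := by
    have h1 : MeasurePreserving (fun x : Fin n → ℝ => (WithLp.toLp 2 x : Pt n))
        (volume.restrict B) (cellMeasure n) := by
      have := (PiLp.volume_preserving_toLp (Fin n)).restrict_preimage (measurableSet_cell n)
      have hpre : (WithLp.toLp 2 : (Fin n → ℝ) → Pt n) ⁻¹' cell n = B := by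
        ext x; simp [hB, cell]
      rwa [hpre] at this
    have h2 : MeasurePreserving (Subtype.val : B → (Fin n → ℝ))
        (Measure.comap Subtype.val volume) (volume.restrict B) :=
      measurePreserving_subtype_coe hBm
    have h3 := UnitAddTorus.measurePreserving_equivPiIoc (0 : Fin n → ℝ)
    exact hg.comp_measurePreserving (h1.comp (h2.comp h3))
  have hval : ∀ x ∈ B, G (fun i => (x i : UnitAddCircle)) = g (WithLp.toLp 2 x) := by
    intro x hx
    have := (UnitAddTorus.measurableEquivPiIoc (0 : Fin n → ℝ)).apply_symm_apply ⟨x, hx⟩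
    rw [UnitAddTorus.coe_symm_measurableEquivPiIoc_apply] at this
    simp only [G]
    rw [this]
  have key := UnitAddTorus.hasSum_sq_mFourierCoeff (hG.toLp G)
  have hcoef : ∀ k, UnitAddTorus.mFourierCoeff (hG.toLp G) k
      = ∫ x, f x * conj (wave α k x) ∂(cellMeasure n) := by
    intro k
    have : UnitAddTorus.mFourierCoeff (hG.toLp G) k = UnitAddTorus.mFourierCoeff G k :=
      integral_congr_ae (by filter_upwards [hG.coeFn_toLp] with t ht; rw [ht])
    rw [this, UnitAddTorus.mFourierCoeff_eq_integral _ _ (0 : Fin n → ℝ), integral_cell]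
    refine setIntegral_congr_fun hBm fun x hx => ?_
    simp only
    rw [hval x hx, smul_eq_mul]
    simp only [g]
    have : conj (wave α k (WithLp.toLp 2 x)) = conj (wave α 0 (WithLp.toLp 2 x)) *
        UnitAddTorus.mFourier (-k) (fun i => (x i : UnitAddCircle)) := by
      rw [UnitAddTorus.mFourier_neg, ← map_mul]
      congr 1
      simp only [wave, UnitAddTorus.mFourier, ContinuousMap.coe_mk, fourier_coe_apply]
      rw [← Complex.exp_sum, ← Complex.exp_add]
      congr 1
      push_cast
      rw [Finset.mul_sum, Finset.mul_sum, ← Finset.sum_add_distrib]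
      refine Finset.sum_congr rfl fun i _ => ?_
      simp
      ring
    rw [this]; ring
  have hint : ∫ t, ‖(hG.toLp G) t‖ ^ 2 = ‖f‖ ^ 2 := by
    have e1 : ∫ t, ‖(hG.toLp G) t‖ ^ 2 = ∫ t, ‖G t‖ ^ 2 :=
      integral_congr_ae (by filter_upwards [hG.coeFn_toLp] with t ht; rw [ht])
    rw [e1, UnitAddTorus.integral_preimage _ (0 : Fin n → ℝ)]
    have e2 : ‖f‖ ^ 2 = ∫ x, ‖f x‖ ^ 2 ∂(cellMeasure n) := by
      have := L2.inner_def (𝕜 := ℂ) f f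
      rw [inner_self_eq_norm_sq_to_K] at this
      have h2 : ∀ x, inner ℂ (f x) (f x) = ((‖f x‖ ^ 2 : ℝ) : ℂ) := fun x => by
        rw [inner_self_eq_norm_sq_to_K]; norm_cast
      simp_rw [h2] at this
      rw [integral_complex_ofReal] at this
      refine Complex.ofReal_injective ?_
      rw [← this]
      push_cast
      rfl
    rw [e2, integral_cell]
    refine setIntegral_congr_fun hBm fun x hx => ?_
    simp only
    rw [hval x hx]
    simp [g, norm_wave]
  rw [hint] at key
  simpa only [hcoef] using key


/-- A nonzero quasi-momentum in the Brillouin zone: `α ∈ (-π,π]ⁿ`, `α ≠ 0`. -/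
structure BlochVector (n : ℕ) where
  vec : Pt n
  mem_Ioc : ∀ j, vec j ∈ Ioc (-Real.pi) Real.pi
  ne_zero : vec ≠ 0

/-- Smooth `α`-quasi-periodic functions: `φ(x+p) = e^{iα·p} φ(x)` for `p ∈ ℤⁿ`. -/
structure IsTestFunction {n : ℕ} (α : Pt n) (φ : Pt n → ℂ) : Prop where
  smooth : ContDiff ℝ ∞ φ
  quasiPeriodic : ∀ (x : Pt n) (p : Fin n → ℤ),
    φ (x + WithLp.toLp 2 (fun j => (p j : ℝ)))
      = Complex.exp (Complex.I * ((∑ j, α j * (p j : ℝ) : ℝ) : ℂ)) * φ x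

lemma isTestFunction_wave {n : ℕ} (α : Pt n) (k : Fin n → ℤ) : IsTestFunction α (wave α k) := by
  refine ⟨contDiff_wave α k, fun x p => ?_⟩
  have h : Complex.exp (2 * Real.pi * Complex.I * ((∑ j, k j * p j : ℤ) : ℂ)) = 1 := by
    rw [mul_comm]; exact Complex.exp_int_mul_two_pi_mul_I _
  rw [← one_mul (Complex.exp (Complex.I * _)), ← h]
  simp only [wave]
  rw [← Complex.exp_add, ← Complex.exp_add]
  congr 1
  push_cast
  simp only [Finset.mul_sum, ← Finset.sum_add_distrib]
  refine Finset.sum_congr rfl fun j _ => ?_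
  simp
  ring

lemma memLp_cell {n : ℕ} {ψ : Pt n → ℂ} (h : Continuous ψ) : MemLp ψ 2 (cellMeasure n) := by
  obtain ⟨C, hC⟩ := (isCompact_closedBall (0 : Pt n) (Real.sqrt n)).exists_bound_of_continuousOn
    h.continuousOn
  refine MemLp.of_bound h.aestronglyMeasurable C ?_
  refine (ae_restrict_iff' (measurableSet_cell n)).2 (Eventually.of_forall fun x hx => hC x ?_)
  exact cell_subset_closedBall n hx

lemma exists_pairing {n : ℕ} {ψ : Pt n → ℂ} (h : Continuous ψ) :
    ∃ w : L2 n, ∀ u : L2 n, ∫ x, u x * conj (ψ x) ∂(cellMeasure n) = inner ℂ w u := by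
  refine ⟨(memLp_cell h).toLp ψ, fun u => ?_⟩
  rw [L2.inner_def]
  refine integral_congr_ae ?_
  filter_upwards [(memLp_cell h).coeFn_toLp] with x hx
  rw [hx, RCLike.inner_apply]

/-- `g` is the weak gradient of (the `α`-quasi-periodic extension of) `u`:
`∫_Y u conj(∂_j φ) = -∫_Y g_j conj(φ)` for all smooth `α`-quasi-periodic `φ` and all `j`.
The boundary terms on `∂Y` cancel since `u conj(φ)` is periodic; so this says that the extension
lies in `H¹_loc(ℝⁿ)` with gradient the extension of `g`. -/
def IsWeakGradient {n : ℕ} (α : Pt n) (u : L2 n) (g : VecL2 n) : Prop :=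
  ∀ φ : Pt n → ℂ, IsTestFunction α φ → ∀ j : Fin n,
    ∫ x, u x * conj (fderiv ℝ φ x (EuclideanSpace.single j 1)) ∂(cellMeasure n)
      = - ∫ x, g j x * conj (φ x) ∂(cellMeasure n)

lemma IsTestFunction.exists_pairing {n : ℕ} {α : Pt n} {φ : Pt n → ℂ} (h : IsTestFunction α φ)
    (j : Fin n) : ∃ a b : L2 n, ∀ (u : L2 n) (g : VecL2 n),
      (∫ x, u x * conj (fderiv ℝ φ x (EuclideanSpace.single j 1)) ∂(cellMeasure n)
        = - ∫ x, g j x * conj (φ x) ∂(cellMeasure n)) ↔ inner ℂ a u + inner ℂ b (g j) = 0 := by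
  have hd : Continuous fun x => fderiv ℝ φ x (EuclideanSpace.single j 1) :=
    (h.smooth.continuous_fderiv (by simp)).clm_apply continuous_const
  obtain ⟨a, ha⟩ := HighContrast.exists_pairing hd
  obtain ⟨b, hb⟩ := HighContrast.exists_pairing h.smooth.continuous
  refine ⟨a, b, fun u g => ?_⟩
  rw [ha, hb, eq_neg_iff_add_eq_zero]

/-- The pairs `(u, ∇u)` with `u` in `H¹_#(α,Y)`. -/
def h1Graph {n : ℕ} (α : Pt n) : Submodule ℂ (L2 n × VecL2 n) where
  carrier := {p | IsWeakGradient α p.1 p.2}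
  add_mem' {p q} hp hq φ hφ j := by
    obtain ⟨a, b, h⟩ := hφ.exists_pairing j
    have h1 := (h _ _).1 (hp φ hφ j)
    have h2 := (h _ _).1 (hq φ hφ j)
    refine (h _ _).2 ?_
    simp only [Prod.fst_add, Prod.snd_add, PiLp.add_apply, inner_add_right]
    linear_combination h1 + h2
  zero_mem' φ hφ j := by
    obtain ⟨a, b, h⟩ := hφ.exists_pairing j
    exact (h _ _).2 (by simp)
  smul_mem' c p hp φ hφ j := by
    obtain ⟨a, b, h⟩ := hφ.exists_pairing j
    have h1 := (h _ _).1 (hp φ hφ j)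
    refine (h _ _).2 ?_
    simp only [Prod.smul_fst, Prod.smul_snd, PiLp.smul_apply, inner_smul_right]
    linear_combination c * h1

lemma isClosed_h1Graph {n : ℕ} (α : Pt n) : IsClosed (h1Graph α : Set (L2 n × VecL2 n)) := by
  have : (h1Graph α : Set (L2 n × VecL2 n)) = ⋂ (φ : Pt n → ℂ) (_ : IsTestFunction α φ)
      (j : Fin n), {p | ∫ x, p.1 x * conj (fderiv ℝ φ x (EuclideanSpace.single j 1)) ∂(cellMeasure n)
        = - ∫ x, p.2 j x * conj (φ x) ∂(cellMeasure n)} := by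
    ext p; simp [h1Graph, IsWeakGradient]
  rw [this]
  refine isClosed_iInter fun φ => isClosed_iInter fun hφ => isClosed_iInter fun j => ?_
  obtain ⟨a, b, h⟩ := hφ.exists_pairing j
  simp only [h]
  exact isClosed_eq (by fun_prop) continuous_const

/-- Poincaré inequality in `H¹_#(α,Y)`, `α ≠ 0`; it makes `∫_Y ∇u·∇v̄` a complete inner product. -/
lemma poincare {n : ℕ} (α : BlochVector n) (p : L2 n × VecL2 n) (hp : p ∈ h1Graph α.vec) :
    ‖p.1‖ ≤ ‖α.vec‖⁻¹ * ‖p.2‖ := by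
  have hα : 0 < ‖α.vec‖ := norm_pos_iff.2 α.ne_zero
  set c : L2 n → (Fin n → ℤ) → ℂ := fun f k =>
    ∫ x, f x * conj (wave α.vec k x) ∂(cellMeasure n) with hc
  have hcoef : ∀ k j, ‖c (p.2 j) k‖ ^ 2
      = (2 * Real.pi * (k j : ℝ) + α.vec j) ^ 2 * ‖c p.1 k‖ ^ 2 := by
    intro k j
    have h := hp _ (isTestFunction_wave α.vec k) j
    have h2 : c (p.2 j) k
        = Complex.I * ((2 * Real.pi * (k j : ℝ) + α.vec j : ℝ) : ℂ) * c p.1 k := by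
      simp only [hc]
      rw [← neg_eq_iff_eq_neg.2 h, ← integral_const_mul, ← integral_neg]
      refine integral_congr_ae (Eventually.of_forall fun x => ?_)
      simp only [fderiv_wave, map_mul, Complex.conj_I, Complex.conj_ofReal]
      ring
    rw [h2, norm_mul, norm_mul, Complex.norm_I, Complex.norm_real, one_mul, mul_pow,
      Real.norm_eq_abs, sq_abs]
  have hsum : HasSum (fun k => ∑ j, ‖c (p.2 j) k‖ ^ 2) (‖p.2‖ ^ 2) := by
    rw [PiLp.norm_sq_eq_of_L2]
    exact hasSum_sum fun j _ => hasSum_wave α.vec (p.2 j)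
  have hle : ‖α.vec‖ ^ 2 * ‖p.1‖ ^ 2 ≤ ‖p.2‖ ^ 2 := by
    refine hasSum_le (fun k => ?_) ((hasSum_wave α.vec p.1).mul_left (‖α.vec‖ ^ 2)) hsum
    simp only [hcoef, ← Finset.sum_mul]
    refine mul_le_mul_of_nonneg_right ?_ (by positivity)
    rw [EuclideanSpace.real_norm_sq_eq]
    refine Finset.sum_le_sum fun j _ => ?_
    have h1 := (α.mem_Ioc j).1
    have h2 := (α.mem_Ioc j).2
    have hpi := Real.pi_pos
    rcases lt_trichotomy (k j) 0 with h | h | h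
    · have : (k j : ℝ) ≤ -1 := by exact_mod_cast Int.le_sub_one_of_lt h
      nlinarith [mul_nonneg hpi.le (by linarith : (0:ℝ) ≤ -1 - k j)]
    · simp [h]
    · have : (1 : ℝ) ≤ k j := by exact_mod_cast h
      nlinarith [mul_nonneg hpi.le (by linarith : (0:ℝ) ≤ k j - 1)]
  rw [inv_mul_eq_div, le_div_iff₀ hα, mul_comm]
  refine le_of_sq_le_sq ?_ (norm_nonneg _)
  rw [mul_pow]; exact hle


/-- A closed space of pairs `(u, ∇u)` on which a Poincaré inequality holds. It carries the energy
inner product. -/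
structure EnergyGraph (n : ℕ) where
  graph : Submodule ℂ (L2 n × VecL2 n)
  isClosed : IsClosed (graph : Set (L2 n × VecL2 n))
  poincare : ∃ C : ℝ, ∀ p ∈ graph, ‖p.1‖ ≤ C * ‖p.2‖

namespace EnergyGraph

variable {n : ℕ} (G : EnergyGraph n)

/-- The functions `u` of an energy graph (each with its gradient), as a Hilbert space under the
energy inner product `∫_Y ∇u·∇v̄`. -/
def Space : Type := G.graph

instance : AddCommGroup G.Space := inferInstanceAs (AddCommGroup G.graph)

instance : Module ℂ G.Space := inferInstanceAs (Module ℂ G.graph)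

/-- The function `u`, as an element of `L²(Y)`. -/
def fnₗ : G.Space →ₗ[ℂ] L2 n := (LinearMap.fst ℂ (L2 n) (VecL2 n)).comp G.graph.subtype

/-- The gradient `∇u`. -/
def gradₗ : G.Space →ₗ[ℂ] VecL2 n := (LinearMap.snd ℂ (L2 n) (VecL2 n)).comp G.graph.subtype

lemma mem_graph (u : G.Space) : (G.fnₗ u, G.gradₗ u) ∈ G.graph := u.2

lemma ext_of_eq {u v : G.Space} (h1 : G.fnₗ u = G.fnₗ v) (h2 : G.gradₗ u = G.gradₗ v) : u = v :=
  Subtype.ext (Prod.ext h1 h2)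

/-- The energy inner product `∫_Y ∇u·∇v̄` (Mathlib inner products are conjugate linear in the first
argument, so `inner ℂ v u` is `∫_Y ∇u·∇v̄`). -/
instance innerCore : InnerProductSpace.Core ℂ G.Space where
  inner u v := inner ℂ (G.gradₗ u) (G.gradₗ v)
  conj_inner_symm _ _ := inner_conj_symm _ _
  re_inner_nonneg _ := inner_self_nonneg
  add_left _ _ _ := by rw [map_add, inner_add_left]
  smul_left _ _ _ := by rw [map_smul, inner_smul_left]
  definite u hu := by
    have hg : G.gradₗ u = 0 := inner_self_eq_zero.1 hu
    obtain ⟨C, hC⟩ := G.poincare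
    have hf := hC _ (G.mem_graph u)
    rw [hg, norm_zero, mul_zero, norm_le_zero_iff] at hf
    exact G.ext_of_eq (by rw [map_zero]; exact hf) (by rw [hg, map_zero])

instance : NormedAddCommGroup G.Space := G.innerCore.toNormedAddCommGroup

instance : InnerProductSpace ℂ G.Space := InnerProductSpace.ofCore G.innerCore.toCore

lemma inner_def (u v : G.Space) : inner ℂ u v = inner ℂ (G.gradₗ u) (G.gradₗ v) := rfl

lemma norm_gradₗ (u : G.Space) : ‖G.gradₗ u‖ = ‖u‖ := by
  have h : ((‖G.gradₗ u‖ : ℂ)) ^ 2 = (‖u‖ : ℂ) ^ 2 := by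
    have h1 := inner_self_eq_norm_sq_to_K (𝕜 := ℂ) (G.gradₗ u)
    have h2 := inner_self_eq_norm_sq_to_K (𝕜 := ℂ) u
    exact h1.symm.trans h2
  have h' : ‖G.gradₗ u‖ ^ 2 = ‖u‖ ^ 2 := by exact_mod_cast h
  exact (sq_eq_sq₀ (norm_nonneg _) (norm_nonneg _)).1 h'

/-- The gradient as an isometry. -/
def grad : G.Space →ₗᵢ[ℂ] VecL2 n := ⟨G.gradₗ, G.norm_gradₗ⟩

lemma exists_norm_fnₗ_le : ∃ C : ℝ, ∀ u, ‖G.fnₗ u‖ ≤ C * ‖u‖ := by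
  obtain ⟨C, hC⟩ := G.poincare
  exact ⟨C, fun u => by rw [← G.norm_gradₗ u]; exact hC _ (G.mem_graph u)⟩

/-- The embedding into `L²(Y)`. -/
def toL2 : G.Space →L[ℂ] L2 n := G.fnₗ.mkContinuousOfExistsBound G.exists_norm_fnₗ_le

instance : CompleteSpace G.Space := by
  refine Metric.complete_of_cauchySeq_tendsto fun u hu => ?_
  obtain ⟨f, hf⟩ := cauchySeq_tendsto_of_complete (G.toL2.uniformContinuous.comp_cauchySeq hu)
  obtain ⟨g, hg⟩ := cauchySeq_tendsto_of_complete 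
    (G.grad.isometry.uniformContinuous.comp_cauchySeq hu)
  have hmem : (f, g) ∈ G.graph :=
    G.isClosed.mem_of_tendsto (hf.prodMk_nhds hg) (Eventually.of_forall fun k => G.mem_graph (u k))
  refine ⟨(⟨(f, g), hmem⟩ : G.graph), ?_⟩
  exact (G.grad.isometry.isUniformInducing.isInducing.tendsto_nhds_iff).2 hg

end EnergyGraph

/-- `H¹_#(α,Y)` with the energy inner product. -/
def quasiPeriodicH1 {n : ℕ} (α : BlochVector n) : EnergyGraph n where
  graph := h1Graph α.vec
  isClosed := isClosed_h1Graph α.vec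
  poincare := ⟨_, poincare α⟩

/-- The Hilbert space `H¹_#(α,Y)` with inner product `∫_Y ∇u·∇v̄`. -/
abbrev H1 {n : ℕ} (α : BlochVector n) : Type := (quasiPeriodicH1 α).Space

/-- The union `D` of the inclusions in dimension 2 or 3: an open set whose closure lies in the interior
of `Y` and whose boundary is `C^{1,γ}` for some `γ ∈ (0,1]`: near each boundary point, `D` is the
set `{ψ < 0}` for a `C¹` function `ψ` with `γ`-Hölder derivative that does not vanish at the point.
(Such a `D` has finitely many components and their closures are disjoint.) -/
structure InclusionDomain (n : ℕ) where
  carrier : Set (Pt n)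
  dim_eq : n = 2 ∨ n = 3
  isOpen : IsOpen carrier
  closure_subset : closure carrier ⊆ {x | ∀ j, x j ∈ Ioo (0 : ℝ) 1}
  boundary : ∃ γ : NNReal, 0 < γ ∧ γ ≤ 1 ∧ ∀ x ∈ frontier carrier,
    ∃ (U : Set (Pt n)) (ψ : Pt n → ℝ) (C : NNReal), IsOpen U ∧ x ∈ U ∧
      ContDiffOn ℝ 1 ψ U ∧ HolderOnWith C γ (fderiv ℝ ψ) U ∧ fderiv ℝ ψ x ≠ 0 ∧
      carrier ∩ U = {y ∈ U | ψ y < 0}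

/-- `φ ∈ C_c^∞(D)`. -/
structure IsBumpIn {n : ℕ} (D : Set (Pt n)) (φ : Pt n → ℂ) : Prop where
  smooth : ContDiff ℝ ∞ φ
  compact : HasCompactSupport φ
  support : tsupport φ ⊆ D

/-- The pairs `(u, ∇u)` with `u ∈ H¹_0(D)` extended by zero to `Y`: the `H¹` closure of `C_c^∞(D)`. -/
def h10Graph {n : ℕ} (D : Set (Pt n)) : Submodule ℂ (L2 n × VecL2 n) :=
  (Submodule.span ℂ {p : L2 n × VecL2 n | ∃ φ : Pt n → ℂ, IsBumpIn D φ ∧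
    p.1 =ᵐ[cellMeasure n] φ ∧ ∀ j, p.2 j =ᵐ[cellMeasure n]
      fun x => fderiv ℝ φ x (EuclideanSpace.single j 1)}).topologicalClosure

lemma h10Graph_le {n : ℕ} {D : Set (Pt n)} (hD : D ⊆ cell n) (α : Pt n) :
    h10Graph D ≤ h1Graph α := by
  refine Submodule.topologicalClosure_minimal _ (Submodule.span_le.2 ?_) (isClosed_h1Graph α)
  rintro p ⟨φ, hφ, h1, h2⟩ ψ hψ j
  set e : Pt n := EuclideanSpace.single j 1
  have hz : ∀ x ∉ cell n, φ x = 0 := fun x hx =>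
    image_eq_zero_of_notMem_tsupport fun h => hx (hD (hφ.support h))
  have hz' : ∀ x ∉ cell n, fderiv ℝ φ x e = 0 := fun x hx => by
    rw [image_eq_zero_of_notMem_tsupport fun h =>
      hx (hD (hφ.support (tsupport_fderiv_subset ℝ h))), zero_apply]
  have hcφ : Continuous fun x => fderiv ℝ φ x e :=
    (hφ.smooth.continuous_fderiv (by simp)).clm_apply continuous_const
  have hcψ : Continuous fun x => fderiv ℝ ψ x e :=
    (hψ.smooth.continuous_fderiv (by simp)).clm_apply continuous_const
  have hsφ : HasCompactSupport fun x => fderiv ℝ φ x e := hφ.compact.fderiv_apply ℝ e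
  have hconj : ∀ x, fderiv ℝ (fun y => conj (ψ y)) x e = conj (fderiv ℝ ψ x e) := fun x => by
    have h := (Complex.conjCLE.toContinuousLinearMap.hasFDerivAt.comp x
      ((hψ.smooth.differentiable (by simp)) x).hasFDerivAt).fderiv
    have h' : fderiv ℝ (fun y => conj (ψ y)) x = _ := h
    rw [h']; simp
  have ibp := integral_mul_fderiv_eq_neg_fderiv_mul_of_integrable (μ := (volume : Measure (Pt n)))
    (f := φ) (g := fun y => conj (ψ y)) (v := e)
    ((hcφ.mul (Complex.continuous_conj.comp hψ.smooth.continuous)).integrable_of_hasCompactSupport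
      hsφ.mul_right)
    (by
      simp only [hconj]
      exact (hφ.smooth.continuous.mul
        (Complex.continuous_conj.comp hcψ)).integrable_of_hasCompactSupport hφ.compact.mul_right)
    ((hφ.smooth.continuous.mul
        (Complex.continuous_conj.comp hψ.smooth.continuous)).integrable_of_hasCompactSupport
          hφ.compact.mul_right)
    (fun x _ => hφ.smooth.differentiable (by simp) x)
    (fun x _ => (Complex.conjCLE.toContinuousLinearMap.differentiableAt.comp x
      (hψ.smooth.differentiable (by simp) x)))
  simp only [hconj] at ibp
  calc ∫ x, p.1 x * conj (fderiv ℝ ψ x e) ∂(cellMeasure n)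
      = ∫ x, φ x * conj (fderiv ℝ ψ x e) ∂(cellMeasure n) :=
        integral_congr_ae (by filter_upwards [h1] with x hx; rw [hx])
    _ = ∫ x, φ x * conj (fderiv ℝ ψ x e) :=
        setIntegral_eq_integral_of_forall_compl_eq_zero fun x hx => by rw [hz x hx, zero_mul]
    _ = - ∫ x, fderiv ℝ φ x e * conj (ψ x) := ibp
    _ = - ∫ x, fderiv ℝ φ x e * conj (ψ x) ∂(cellMeasure n) := by
        rw [setIntegral_eq_integral_of_forall_compl_eq_zero
          fun x hx => by rw [hz' x hx, zero_mul]]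
    _ = - ∫ x, p.2 j x * conj (ψ x) ∂(cellMeasure n) := by
        congr 1
        exact integral_congr_ae (by filter_upwards [h2 j] with x hx; rw [hx])

/-- An admissible quasi-momentum, used only to see that the Poincaré inequality holds in `H¹_0(D)`. -/
def BlochVector.ones (n : ℕ) (hn : n = 2 ∨ n = 3) : BlochVector n where
  vec := WithLp.toLp 2 fun _ => 1
  mem_Ioc j := ⟨by simpa using by linarith [Real.pi_pos], by simpa using by linarith [Real.pi_gt_three]⟩
  ne_zero h := by
    have := congrArg (fun v : Pt n => v ⟨0, by omega⟩) h
    simp at this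

namespace InclusionDomain

variable {n : ℕ} (D : InclusionDomain n)

lemma subset_cell : D.carrier ⊆ cell n := fun _ hx j =>
  Ioo_subset_Ioc_self (D.closure_subset (subset_closure hx) j)

/-- `H¹_0(D)` with the inner product `∫_D ∇u·∇v̄`. -/
def h10 : EnergyGraph n where
  graph := h10Graph D.carrier
  isClosed := Submodule.isClosed_topologicalClosure _
  poincare := ⟨_, fun p hp => poincare (BlochVector.ones n D.dim_eq) p
    (h10Graph_le D.subset_cell _ hp)⟩

/-- The Hilbert space `H¹_0(D)` with the inner product `∫_D ∇u·∇v̄`. -/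
abbrev H10 : Type := D.h10.Space

/-- `L²(D)`. -/
abbrev L2D : Type := Lp ℂ 2 ((cellMeasure n).restrict D.carrier)

/-- The embedding `H¹_0(D) → L²(D)`. -/
def h10ToL2D : D.H10 →L[ℂ] D.L2D :=
  LpToLpRestrictCLM (Pt n) ℂ ℂ (cellMeasure n) 2 D.carrier ∘L D.h10.toL2

/-- `-Δ_D⁻¹ : L²(D) → L²(D)`: for `f ∈ L²(D)` it gives the `w ∈ H¹_0(D)` with
`∫_D ∇w·∇v̄ = ∫_D f v̄` for all `v ∈ H¹_0(D)`. The map `f ↦ w` is the adjoint of the embedding. -/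
def dirichletInverse : D.L2D →L[ℂ] D.L2D := D.h10ToL2D ∘L ContinuousLinearMap.adjoint D.h10ToL2D

end InclusionDomain

section Operators

variable {n : ℕ} (α : BlochVector n) (D : InclusionDomain n)

/-- The embedding `H¹_#(α,Y) → L²_#(α,Y)`. -/
def H1.toL2 : H1 α →L[ℂ] L2 n := (quasiPeriodicH1 α).toL2

/-- The gradient on `H¹_#(α,Y)`. -/
def H1.grad : H1 α →ₗᵢ[ℂ] VecL2 n := (quasiPeriodicH1 α).grad

/-- `(-Δ_α)⁻¹ : L²_#(α,Y) → H¹_#(α,Y)`: the `w` with `∫_Y ∇w·∇v̄ = ∫_Y f v̄` for all `v` in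
`H¹_#(α,Y)`, which is the adjoint of the embedding. -/
def invLaplacian : L2 n →L[ℂ] H1 α := ContinuousLinearMap.adjoint (H1.toL2 α)

/-- `W₁`: closure in `H¹_#(α,Y)` of the functions vanishing in a neighbourhood of the closure of `D`. -/
def W1 : Submodule ℂ (H1 α) :=
  (Submodule.span ℂ {u : H1 α | ∃ V : Set (Pt n), IsOpen V ∧ closure D.carrier ⊆ V ∧
    ∀ᵐ x ∂(cellMeasure n), x ∈ V → H1.toL2 α u x = 0}).topologicalClosure

/-- `W₂`: the functions of `H¹_0(D)` extended by zero. -/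
def W2 : Submodule ℂ (H1 α) :=
  (h10Graph D.carrier).comap
    ((H1.toL2 α : H1 α →ₗ[ℂ] L2 n).prod (H1.grad α).toLinearMap)

instance : CompleteSpace (W1 α D) :=
  (Submodule.isClosed_topologicalClosure _).completeSpace_coe

instance : CompleteSpace (W2 α D) := by
  have h : Continuous fun u : H1 α => (H1.toL2 α u, H1.grad α u) :=
    (H1.toL2 α).continuous.prodMk (H1.grad α).continuous
  exact ((Submodule.isClosed_topologicalClosure _).preimage h).completeSpace_coe

/-- `W₃ = (W₁ ⊕ W₂)^⊥`. -/
def W3 : Submodule ℂ (H1 α) := (W1 α D ⊔ W2 α D)ᗮ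

instance : CompleteSpace (W3 α D) :=
  (Submodule.isClosed_orthogonal _).completeSpace_coe

/-- `u ↦ ∂_j u` restricted to `Y ∩ s`. -/
def partialOn (s : Set (Pt n)) (j : Fin n) :
    H1 α →L[ℂ] Lp ℂ 2 ((cellMeasure n).restrict s) :=
  LpToLpRestrictCLM (Pt n) ℂ ℂ (cellMeasure n) 2 s ∘L
    PiLp.proj 2 (fun _ : Fin n => L2 n) j ∘L (H1.grad α).toContinuousLinearMap

/-- The operator of the form `(u,v) ↦ ∫_{Y ∩ s} ∇u·∇v̄` on `H¹_#(α,Y)`. -/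
def energyOn (s : Set (Pt n)) : H1 α →L[ℂ] H1 α :=
  ∑ j, ContinuousLinearMap.adjoint (partialOn α s j) ∘L partialOn α s j

/-- `T : W₃ → W₃`, `⟨Tu,v⟩ = ½ ∫_{Y∖D} ∇u·∇v̄ - ½ ∫_D ∇u·∇v̄`. -/
def resonanceOp : W3 α D →L[ℂ] W3 α D :=
  (W3 α D).orthogonalProjectionOnto ∘L
    ((1 / 2 : ℂ) • energyOn α D.carrierᶜ - (1 / 2 : ℂ) • energyOn α D.carrier) ∘L
    (W3 α D).subtypeL

/-- The quasi-periodic resonance eigenvalues `μ_i`: the eigenvalues of `T`, which are real. -/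
def resonances : Set ℝ :=
  {μ | Module.End.HasEigenvalue (resonanceOp α D : W3 α D →ₗ[ℂ] W3 α D) (μ : ℂ)}

/-- `P_μ`: orthogonal projection of `H¹_#(α,Y)` onto the eigenspace of `T` in `W₃` for `μ`. -/
def resonanceProj (μ : ℝ) : H1 α →L[ℂ] H1 α :=
  (W3 α D).subtypeL ∘L
    (resonanceOp α D - (μ : ℂ) • ContinuousLinearMap.id ℂ (W3 α D)).ker.starProjection ∘L
    (W3 α D).orthogonalProjectionOnto

/-- `P₁ = Q₁ + P_{1/2}`, with `Q₁` the orthogonal projection onto `W₁`. -/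
def P1 : H1 α →L[ℂ] H1 α := (W1 α D).starProjection + resonanceProj α D (1 / 2)

/-- `P₂`: the orthogonal projection onto `W₂`. -/
def P2 : H1 α →L[ℂ] H1 α := (W2 α D).starProjection

/-- `∑_{-1/2 < μ_i < 1/2} [(1/2 + μ_i) + z (1/2 - μ_i)]⁻¹ P_{μ_i}`, the sum over the distinct
eigenvalues, converging strongly (`→Lₚₜ` is the space of bounded operators with the topology of
pointwise convergence). -/
def resonanceSum (z : ℂ) : H1 α →Lₚₜ[ℂ] H1 α :=
  ∑' μ : {μ : ℝ // μ ∈ resonances α D ∧ -1 / 2 < μ ∧ μ < 1 / 2},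
    (((1 / 2 + (μ : ℝ) : ℝ) : ℂ) + z * ((1 / 2 - (μ : ℝ) : ℝ) : ℂ))⁻¹ •
      ContinuousLinearMap.toPointwiseConvergenceCLM ℂ (RingHom.id ℂ) (H1 α) (H1 α) (resonanceProj α D μ)


/-- `z P₁ + P₂ + z ∑_{-1/2 < μ_i < 1/2} [(1/2 + μ_i) + z (1/2 - μ_i)]⁻¹ P_{μ_i}`; for `k = 1/z` this is
the inverse of the operator of the form `k ∫_{Y∖D} ∇u·∇v̄ + ∫_D ∇u·∇v̄`. -/
def solutionMultiplier (z : ℂ) : H1 α →L[ℂ] H1 α :=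
  z • P1 α D + P2 α D + z • (UniformConvergenceCLM.ofFun (RingHom.id ℂ) (H1 α)
    {s : Set (H1 α) | Finite s}).symm (resonanceSum α D z)

/-- `A^α(z) = (z P₁ + P₂ + z ∑ [(1/2 + μ_i) + z (1/2 - μ_i)]⁻¹ P_{μ_i}) (-Δ_α)⁻¹` on `L²_#(α,Y)`. -/
def blochOp (z : ℂ) : L2 n →L[ℂ] L2 n :=
  H1.toL2 α ∘L solutionMultiplier α D z ∘L invLaplacian α

/-- `R(ζ,z) = (A^α(z) - ζ)⁻¹`. -/
def blochResolvent (ζ z : ℂ) : L2 n →L[ℂ] L2 n :=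
  Ring.inverse (blochOp α D z - ζ • ContinuousLinearMap.id ℂ (L2 n))

end Operators

/-- `∮ f(ζ) dζ` along the parametrised path `γ : [0,1] → ℂ`. -/
def contourIntegral {F : Type*} [NormedAddCommGroup F] [NormedSpace ℂ F] (γ : ℝ → ℂ)
    (f : ℂ → F) : F :=
  ∫ t in (0 : ℝ)..1, deriv γ t • f (γ t)

/-- The winding number of `γ` about `w`. -/
def windingNumber (γ : ℝ → ℂ) (w : ℂ) : ℂ :=
  (2 * Real.pi * Complex.I : ℂ)⁻¹ * contourIntegral γ (fun ζ => (ζ - w)⁻¹)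

/-- A positively oriented closed contour: a closed piecewise `C¹` path (`C¹` with bounded derivative
off finitely many parameters) that winds 0 times or once about each point off it. Every positively
oriented piecewise `C¹` Jordan curve is one. -/
structure Contour where
  toFun : ℝ → ℂ
  continuousOn : ContinuousOn toFun (Icc 0 1)
  closed : toFun 0 = toFun 1
  piecewise_C1 : ∃ (S : Finset ℝ) (C : ℝ), ∀ t ∈ Icc (0 : ℝ) 1, t ∉ S →
    ContDiffAt ℝ 1 toFun t ∧ ‖deriv toFun t‖ ≤ C
  winding : ∀ w ∉ toFun '' Icc 0 1, windingNumber toFun w = 0 ∨ windingNumber toFun w = 1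

namespace Contour

variable (Γ : Contour)

/-- The curve as a set of points. -/
def trace : Set ℂ := Γ.toFun '' Icc 0 1

/-- `∮_Γ f(ζ) dζ`. -/
def integral {F : Type*} [NormedAddCommGroup F] [NormedSpace ℂ F] (f : ℂ → F) : F :=
  contourIntegral Γ.toFun f

/-- The points enclosed by `Γ`. -/
def inside : Set ℂ := {w | w ∉ Γ.trace ∧ windingNumber Γ.toFun w = 1}

/-- The points exterior to `Γ`. -/
def outside : Set ℂ := {w | w ∉ Γ.trace ∧ windingNumber Γ.toFun w = 0}

/-- `inf_{ζ ∈ Γ} dist(ζ, σ)`. -/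
def gap (σ : Set ℂ) : ℝ := sInf ((fun ζ => Metric.infDist ζ σ) '' Γ.trace)

end Contour

/-- `P` is the spectral projection of `A` for the part `S` of its spectrum: a projection commuting with
`A` such that `A` has spectrum `S` on the invariant subspace `P H` and `σ(A) ∖ S` on `ker P`. -/
structure IsSpectralProjection {H : Type*} [NormedAddCommGroup H] [NormedSpace ℂ H]
    (A P : H →L[ℂ] H) (S : Set ℂ) : Prop where
  idem : P * P = P
  comm : A * P = P * A
  range : ∃ h : ∀ x ∈ P.range, (A : H →ₗ[ℂ] H) x ∈ P.range,
    spectrum ℂ ((A : H →ₗ[ℂ] H).restrict h) = S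
  ker : ∃ h : ∀ x ∈ P.ker, (A : H →ₗ[ℂ] H) x ∈ P.ker,
    spectrum ℂ ((A : H →ₗ[ℂ] H).restrict h) = spectrum ℂ A \ S

/-- The trace of a finite-rank operator: the trace of its restriction to its range. -/
def finiteRankTrace {H : Type*} [AddCommGroup H] [Module ℂ H] (B : H →ₗ[ℂ] H) : ℂ :=
  LinearMap.trace ℂ B.range (B.restrict (p := B.range) (q := B.range)
    fun x _ => LinearMap.mem_range_self B x)

section Perturbation

variable {n : ℕ} (α : BlochVector n) (D : InclusionDomain n) (Γ : Contour)

/-- `P(z) = -(1/2πi) ∮_Γ R(ζ,z) dζ`. -/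
def rieszProj (z : ℂ) : L2 n →L[ℂ] L2 n :=
  (-1 / (2 * Real.pi * Complex.I) : ℂ) • Γ.integral (fun ζ => blochResolvent α D ζ z)

/-- `m = dim P(0) L²_#(α,Y)`. -/
def groupDim : ℕ := Module.finrank ℂ (rieszProj α D Γ 0).range

/-- The mean of the eigenvalue group, `(1/m) tr(A^α(z) P(z))`. -/
def meanEigenvalue (z : ℂ) : ℂ :=
  (1 / (groupDim α D Γ : ℂ)) *
    finiteRankTrace (blochOp α D z * rieszProj α D Γ z : L2 n →L[ℂ] L2 n).toLinearMap

/-- `A_k^α`, the Taylor coefficients of `A^α(z)` at `z = 0`. -/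
def opCoeff (k : ℕ) : L2 n →L[ℂ] L2 n :=
  ((k.factorial : ℂ))⁻¹ • iteratedDeriv k (blochOp α D) 0

/-- `β_k = (1/2πim) tr ∑_{k_1+…+k_p=k} ((-1)^p/p) ∮_Γ A_{k_1} R(ζ,0) ⋯ A_{k_p} R(ζ,0) dζ`, the sum over
the compositions of `k`. -/
def meanCoeff (k : ℕ) : ℂ :=
  (1 / (2 * (groupDim α D Γ : ℂ) * Real.pi * Complex.I)) *
    finiteRankTrace (∑ c : Composition k, ((-1 : ℂ) ^ c.length / (c.length : ℂ)) •
      Γ.integral (fun ζ =>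
        (c.blocks.map fun i => opCoeff α D i * blochResolvent α D ζ 0).prod) :
      L2 n →L[ℂ] L2 n).toLinearMap

end Perturbation

end HighContrast

end

open HighContrast

/-! Let `J` be the embedding of `H¹_#` in `L²_#`. Then `(-Δ_α)⁻¹ = J*` up to the target space and
`A(z) = J (z C(z) + P₂) J*` with `C(z) = P₁ + ∑ [(1/2 + μ) + z (1/2 - μ)]⁻¹ P_μ`. The projections in
`C(z)` are mutually orthogonal, so `‖C(z)‖` is governed by the largest coefficient and is at most `s
/ (Z - |z|)`, where `s = 1 / (1/2 - μ⁻)` and `Z = |z*|` (`norm_P1_add_resonanceSumCLM_le`). The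
Poincaré inequality gives `‖J‖ ≤ |α|⁻¹`, hence `‖A(z) - A(0)‖ ≤ |z| s |α|⁻² / (Z - |z|)`. The
operator `A(0)` is `-Δ_D⁻¹` extended by zero (`blochOp_zero`). It is self-adjoint with spectrum
inside `σ(-Δ_D⁻¹)`, so its resolvent is at most `1/d` on `Γ`. The Neumann series for the resolvent
of `A(z)` converges when the product of the two bounds is below 1, and this is `|z| < r*`.

The spectral statements rest on one identity for the Cauchy transform `Q` of the resolvent: `(z - A)
Q(z)` is the winding number at `z` minus `P` (`Contour.sub_mul_rieszTransform`). With Liouville's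
theorem it makes `P` idempotent, and `±Q` inverts `z - A` on the kernel or the range of `P`. Since
`0` lies outside `Γ`, it also gives `P = A Q(0)`, so `P` is compact and of finite rank. The rank of
an analytic family of projections is locally constant.

For the mean eigenvalue, put `δ = A(z) - A(0)` and deform along `A(0) + s δ`, `0 ≤ s ≤ 1`. By
Feynman–Hellmann the `s`-derivative of the trace is `tr (δ P_s)` (`hasDerivAt_trace_mul`). The
Neumann series of `δ` times the resolvent has terms with factor `s^(p-1)`, and integration in `s`
turns this into `1/p`. The trace is not norm continuous on operators of finite rank, so its Taylor
coefficients are extracted through analytic factorizations over a fixed finite-dimensional space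
(`IsFiniteRankGerm.coeff`).

Uniform convergence on all of `|z| < r*` needs holomorphy on a strictly larger disc. Since `C(z)`
vanishes on `W₂` and maps into its complement, `|α|⁻¹` may be replaced by `‖Π J*‖`, with `Π` the
projection onto `W₂ᗮ`. This norm is strictly smaller (`norm_starProjection_comp_lt`): an extremal
function would be a trigonometric polynomial vanishing on the open set `D`. -/

namespace HighContrast

/-! ### Contour integrals, Cauchy transforms and winding numbers. -/

namespace Contour

variable (Γ : Contour)

lemma isCompact_trace : IsCompact Γ.trace := isCompact_Icc.image_of_continuousOn Γ.continuousOn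

lemma trace_nonempty : Γ.trace.Nonempty := ⟨Γ.toFun 0, 0, by simp, rfl⟩

/-- The finitely many exceptional parameters form a null set, so the values of `deriv` there are
irrelevant to every integral. -/
lemma exists_speed : ∃ C : ℝ, 0 ≤ C ∧
    ∀ᵐ t ∂(volume.restrict (Ioc (0 : ℝ) 1)), ‖deriv Γ.toFun t‖ ≤ C := by
  obtain ⟨S, C, h⟩ := Γ.piecewise_C1
  refine ⟨max C 0, le_max_right _ _, ?_⟩
  have h1 : ∀ᵐ t ∂(volume.restrict (Ioc (0 : ℝ) 1)), t ∉ (S : Set ℝ) :=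
    ae_restrict_of_ae (measure_eq_zero_iff_ae_notMem.1 (S.finite_toSet.measure_zero _))
  filter_upwards [h1, ae_restrict_mem measurableSet_Ioc] with t ht ht'
  exact (h t (Ioc_subset_Icc_self ht') (by simpa using ht)).2.trans (le_max_left _ _)

/-- An essential bound for the speed of the parametrisation. -/
noncomputable def speed : ℝ := Γ.exists_speed.choose

lemma speed_nonneg : 0 ≤ Γ.speed := Γ.exists_speed.choose_spec.1

lemma norm_deriv_le : ∀ᵐ t ∂(volume.restrict (Ioc (0 : ℝ) 1)), ‖deriv Γ.toFun t‖ ≤ Γ.speed :=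
  Γ.exists_speed.choose_spec.2

lemma ae_mem_trace : ∀ᵐ t ∂(volume.restrict (Ioc (0 : ℝ) 1)), Γ.toFun t ∈ Γ.trace := by
  filter_upwards [ae_restrict_mem measurableSet_Ioc] with t ht
  exact mem_image_of_mem _ (Ioc_subset_Icc_self ht)

variable {F : Type*} [NormedAddCommGroup F] [NormedSpace ℂ F]

lemma integral_eq (f : ℂ → F) :
    Γ.integral f = ∫ t in Ioc (0 : ℝ) 1, deriv Γ.toFun t • f (Γ.toFun t) :=
  intervalIntegral.integral_of_le zero_le_one

variable {Γ}

lemma aestronglyMeasurable {f : ℂ → F} (hf : ContinuousOn f Γ.trace) :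
    AEStronglyMeasurable (fun t => deriv Γ.toFun t • f (Γ.toFun t))
      (volume.restrict (Ioc (0 : ℝ) 1)) := by
  refine ((measurable_deriv Γ.toFun).aestronglyMeasurable).smul ?_
  refine AEStronglyMeasurable.mono_set Ioc_subset_Icc_self ?_
  exact (hf.comp Γ.continuousOn fun t ht => mem_image_of_mem _ ht).aestronglyMeasurable
    measurableSet_Icc

lemma ae_norm_le {f : ℂ → F} {M : ℝ} (hM : ∀ ζ ∈ Γ.trace, ‖f ζ‖ ≤ M) :
    ∀ᵐ t ∂(volume.restrict (Ioc (0 : ℝ) 1)),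
      ‖deriv Γ.toFun t • f (Γ.toFun t)‖ ≤ Γ.speed * M := by
  filter_upwards [Γ.norm_deriv_le, Γ.ae_mem_trace] with t h1 h2
  rw [norm_smul]
  exact mul_le_mul h1 (hM _ h2) (norm_nonneg _) Γ.speed_nonneg

lemma integrable {f : ℂ → F} (hf : ContinuousOn f Γ.trace) :
    Integrable (fun t => deriv Γ.toFun t • f (Γ.toFun t)) (volume.restrict (Ioc (0 : ℝ) 1)) := by
  obtain ⟨M, hM⟩ := Γ.isCompact_trace.exists_bound_of_continuousOn hf
  exact Integrable.of_bound (aestronglyMeasurable hf) _ (ae_norm_le hM)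

lemma integral_congr {f g : ℂ → F} (h : ∀ ζ ∈ Γ.trace, f ζ = g ζ) :
    Γ.integral f = Γ.integral g := by
  rw [integral_eq, integral_eq]
  refine integral_congr_ae ?_
  filter_upwards [Γ.ae_mem_trace] with t ht
  rw [h _ ht]

lemma integral_sub {f g : ℂ → F} (hf : ContinuousOn f Γ.trace) (hg : ContinuousOn g Γ.trace) :
    Γ.integral (fun ζ => f ζ - g ζ) = Γ.integral f - Γ.integral g := by
  simp only [integral_eq, smul_sub]
  exact MeasureTheory.integral_sub (integrable hf) (integrable hg)

lemma integral_smul (c : ℂ) (f : ℂ → F) :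
    Γ.integral (fun ζ => c • f ζ) = c • Γ.integral f := by
  simp only [integral_eq]
  rw [← MeasureTheory.integral_smul]
  simp only [smul_comm c]

lemma integral_finset_sum {ι : Type*} (s : Finset ι) {f : ι → ℂ → F}
    (hf : ∀ i ∈ s, ContinuousOn (f i) Γ.trace) :
    Γ.integral (fun ζ => ∑ i ∈ s, f i ζ) = ∑ i ∈ s, Γ.integral (f i) := by
  simp only [integral_eq, Finset.smul_sum]
  exact MeasureTheory.integral_finsetSum _ fun i hi => integrable (hf i hi)

lemma integral_clm [CompleteSpace F] {G : Type*} [NormedAddCommGroup G] [NormedSpace ℂ G]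
    [CompleteSpace G] (L : F →L[ℂ] G) {f : ℂ → F} (hf : ContinuousOn f Γ.trace) :
    Γ.integral (fun ζ => L (f ζ)) = L (Γ.integral f) := by
  simp only [integral_eq, ← map_smul]
  exact L.integral_comp_comm (integrable hf)

lemma norm_integral_le {f : ℂ → F} {M : ℝ} (hM : ∀ ζ ∈ Γ.trace, ‖f ζ‖ ≤ M) :
    ‖Γ.integral f‖ ≤ Γ.speed * M := by
  rw [integral_eq]
  simpa using norm_integral_le_of_norm_le_const (ae_norm_le hM)

lemma hasSum_integral {f : ℕ → ℂ → F} {g : ℂ → F} {b : ℕ → ℝ}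
    (hf : ∀ k, ContinuousOn (f k) Γ.trace) (hb : ∀ k, ∀ ζ ∈ Γ.trace, ‖f k ζ‖ ≤ b k)
    (hs : Summable b) (h : ∀ ζ ∈ Γ.trace, HasSum (fun k => f k ζ) (g ζ)) :
    HasSum (fun k => Γ.integral (f k)) (Γ.integral g) := by
  simp only [integral_eq]
  refine hasSum_integral_of_dominated_convergence (fun k _ => Γ.speed * b k)
    (fun k => aestronglyMeasurable (hf k)) (fun k => ae_norm_le (hb k))
    (Eventually.of_forall fun _ => hs.mul_left _) (integrable_const _) ?_
  filter_upwards [Γ.ae_mem_trace] with t ht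
  exact (h _ ht).const_smul _

lemma hasDerivAt_integral {f f' : ℂ → ℂ → F} {z₀ : ℂ} {s : Set ℂ} (hs : s ∈ 𝓝 z₀) {M : ℝ}
    (hf : ∀ z ∈ s, ContinuousOn (fun ζ => f ζ z) Γ.trace)
    (hf' : ContinuousOn (fun ζ => f' ζ z₀) Γ.trace)
    (hM : ∀ ζ ∈ Γ.trace, ∀ z ∈ s, ‖f' ζ z‖ ≤ M)
    (hd : ∀ ζ ∈ Γ.trace, ∀ z ∈ s, HasDerivAt (f ζ) (f' ζ z) z) :
    HasDerivAt (fun z => Γ.integral fun ζ => f ζ z) (Γ.integral fun ζ => f' ζ z₀) z₀ := by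
  simp only [integral_eq]
  refine (hasDerivAt_integral_of_dominated_loc_of_deriv_le
    (F := fun z t => deriv Γ.toFun t • f (Γ.toFun t) z)
    (F' := fun z t => deriv Γ.toFun t • f' (Γ.toFun t) z) (bound := fun _ => Γ.speed * M) hs
    ?_ (integrable (hf z₀ (mem_of_mem_nhds hs))) (aestronglyMeasurable hf') ?_
    (integrable_const _) ?_).2
  · filter_upwards [hs] with z hz using aestronglyMeasurable (hf z hz)
  · filter_upwards [Γ.norm_deriv_le, Γ.ae_mem_trace] with t h1 h2 z hz
    rw [norm_smul]
    exact mul_le_mul h1 (hM _ h2 z hz) (norm_nonneg _) Γ.speed_nonneg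
  · filter_upwards [Γ.ae_mem_trace] with t ht z hz
    exact (hd _ ht z hz).const_smul _

/-- The Cauchy transform of a continuous function on the contour is holomorphic off the contour. -/
lemma differentiableAt_cauchyTransform {f : ℂ → F} (hf : ContinuousOn f Γ.trace) {z₀ : ℂ}
    (hz : z₀ ∉ Γ.trace) :
    DifferentiableAt ℂ (fun z => Γ.integral fun ζ => (ζ - z)⁻¹ • f ζ) z₀ := by
  obtain ⟨ε, hε, hb⟩ := Metric.isOpen_iff.1 Γ.isCompact_trace.isClosed.isOpen_compl z₀ hz
  have hdist : ∀ ζ ∈ Γ.trace, ∀ z ∈ Metric.ball z₀ (ε / 2), ε / 2 ≤ ‖ζ - z‖ := by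
    intro ζ hζ z hz
    by_contra! hlt
    have h1 : ζ ∈ Metric.ball z₀ ε := by
      rw [Metric.mem_ball] at hz ⊢
      have h2 : dist ζ z < ε / 2 := by rwa [dist_eq_norm]
      linarith [dist_triangle ζ z z₀]
    exact hb h1 hζ
  have hne : ∀ ζ ∈ Γ.trace, ∀ z ∈ Metric.ball z₀ (ε / 2), ζ - z ≠ 0 := fun ζ hζ z hz h => by
    have := hdist ζ hζ z hz
    rw [h, norm_zero] at this
    linarith
  obtain ⟨M, hM⟩ := Γ.isCompact_trace.exists_bound_of_continuousOn hf
  have hc : ∀ z ∈ Metric.ball z₀ (ε / 2), ContinuousOn (fun ζ => (ζ - z)⁻¹) Γ.trace :=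
    fun z hz => (continuousOn_id.sub continuousOn_const).inv₀ fun ζ hζ => hne ζ hζ z hz
  have h0 : z₀ ∈ Metric.ball z₀ (ε / 2) := Metric.mem_ball_self (by positivity)
  refine (hasDerivAt_integral (f := fun ζ z => (ζ - z)⁻¹ • f ζ)
    (f' := fun ζ z => ((ζ - z)⁻¹ ^ 2) • f ζ) (M := ((ε / 2)⁻¹ ^ 2) * M)
    (Metric.ball_mem_nhds z₀ (by positivity : 0 < ε / 2)) (fun z hz => (hc z hz).smul hf)
    (((hc z₀ h0).pow 2).smul hf) ?_ ?_).differentiableAt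
  · intro ζ hζ z hz
    rw [norm_smul, norm_pow, norm_inv]
    refine mul_le_mul ?_ (hM ζ hζ) (norm_nonneg _) (by positivity)
    have := hdist ζ hζ z hz
    gcongr
  · intro ζ hζ z hz
    have h1 : HasDerivAt (fun z => ζ - z) (-1) z := by
      simpa using (hasDerivAt_id z).const_sub ζ
    have h2 := (h1.inv (hne ζ hζ z hz)).smul_const (f ζ)
    have h3 : (ζ - z)⁻¹ ^ 2 = - -1 / (ζ - z) ^ 2 := by rw [neg_neg, one_div, inv_pow]
    simp only [h3]
    exact h2

/-- As the Cauchy transform of the constant `1`, the winding number inherits continuity off the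
curve from the holomorphy of Cauchy transforms. -/
lemma windingNumber_eq (w : ℂ) :
    windingNumber Γ.toFun w
      = (2 * Real.pi * Complex.I : ℂ)⁻¹ * Γ.integral (fun ζ => (ζ - w)⁻¹ • (1 : ℂ)) := by
  simp [windingNumber, Contour.integral]

lemma continuousAt_windingNumber {w : ℂ} (hw : w ∉ Γ.trace) :
    ContinuousAt (windingNumber Γ.toFun) w := by
  have h : windingNumber Γ.toFun = fun w => (2 * Real.pi * Complex.I : ℂ)⁻¹ *
      Γ.integral (fun ζ => (ζ - w)⁻¹ • (1 : ℂ)) := funext windingNumber_eq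
  rw [h]
  exact ((differentiableAt_cauchyTransform (f := fun _ => (1 : ℂ)) continuousOn_const
    hw).const_mul _).continuousAt

lemma mem_inside_or_outside {w : ℂ} (hw : w ∉ Γ.trace) : w ∈ Γ.inside ∨ w ∈ Γ.outside :=
  (Γ.winding w hw).symm.imp (fun h => ⟨hw, h⟩) fun h => ⟨hw, h⟩

lemma disjoint_inside_outside : Disjoint Γ.inside Γ.outside :=
  Set.disjoint_left.2 fun w h1 h2 => by simpa [h2.2] using h1.2

/-- A continuous function with values in `{0, 1}` is locally constant. -/
lemma eventually_inside {w : ℂ} (hw : w ∈ Γ.inside) : ∀ᶠ z in 𝓝 w, z ∈ Γ.inside := by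
  have h1 : ∀ᶠ z in 𝓝 w, windingNumber Γ.toFun z ≠ 0 :=
    (continuousAt_windingNumber hw.1).eventually_ne (by rw [hw.2]; exact one_ne_zero)
  filter_upwards [h1, Γ.isCompact_trace.isClosed.isOpen_compl.mem_nhds hw.1] with z h2 h3
  exact (mem_inside_or_outside h3).resolve_right fun h => h2 h.2

lemma eventually_outside {w : ℂ} (hw : w ∈ Γ.outside) : ∀ᶠ z in 𝓝 w, z ∈ Γ.outside := by
  have h1 : ∀ᶠ z in 𝓝 w, windingNumber Γ.toFun z ≠ 1 :=
    (continuousAt_windingNumber hw.1).eventually_ne (by rw [hw.2]; exact zero_ne_one)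
  filter_upwards [h1, Γ.isCompact_trace.isClosed.isOpen_compl.mem_nhds hw.1] with z h2 h3
  exact (mem_inside_or_outside h3).resolve_left fun h => h2 h.2

end Contour
-- The Riesz integral in a Banach algebra.
namespace Contour

section Riesz

variable (Γ : Contour) {𝔄 : Type*} [NormedRing 𝔄] [NormedAlgebra ℂ 𝔄] {a : 𝔄}

lemma sub_mul_resolvent {ζ : ℂ} (h : ζ ∈ resolventSet ℂ a) :
    (algebraMap ℂ 𝔄 ζ - a) * resolvent a ζ = 1 := Ring.mul_inverse_cancel _ h

lemma resolvent_mul_sub {ζ : ℂ} (h : ζ ∈ resolventSet ℂ a) :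
    resolvent a ζ * (algebraMap ℂ 𝔄 ζ - a) = 1 := Ring.inverse_mul_cancel _ h

lemma commute_resolvent {b : 𝔄} (hb : Commute b a) (ζ : ℂ) : Commute b (resolvent a ζ) := by
  have h := (Algebra.commute_algebraMap_right ζ b).sub_right hb
  by_cases hu : ζ ∈ resolventSet ℂ a
  · rw [spectrum.resolvent_eq hu]
    exact Commute.units_inv_right (u := hu.unit) h
  · rw [resolvent, Ring.inverse_non_unit _ hu]
    exact Commute.zero_right b

variable [CompleteSpace 𝔄] (a)

/-- The Riesz integral `(2πi)⁻¹ ∮_Γ (ζ - a)⁻¹ dζ`. -/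
noncomputable def riesz : 𝔄 := (2 * Real.pi * Complex.I : ℂ)⁻¹ • Γ.integral (resolvent a)

/-- The Cauchy transform `(2πi)⁻¹ ∮_Γ (ζ - z)⁻¹ (ζ - a)⁻¹ dζ` of the resolvent. -/
noncomputable def rieszTransform (z : ℂ) : 𝔄 :=
  (2 * Real.pi * Complex.I : ℂ)⁻¹ • Γ.integral (fun ζ => (ζ - z)⁻¹ • resolvent a ζ)

variable {Γ a}

lemma continuousOn_resolvent (h : ∀ ζ ∈ Γ.trace, ζ ∈ resolventSet ℂ a) :
    ContinuousOn (resolvent a) Γ.trace := fun ζ hζ =>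
  (spectrum.hasDerivAt_resolvent_const_left (h ζ hζ)).continuousAt.continuousWithinAt

lemma continuousOn_inv_sub {z : ℂ} (hz : z ∉ Γ.trace) :
    ContinuousOn (fun ζ : ℂ => (ζ - z)⁻¹) Γ.trace :=
  ContinuousOn.inv₀ (by fun_prop) fun _ hζ h => hz (sub_eq_zero.1 h ▸ hζ)

lemma commute_integral {b : 𝔄} {f : ℂ → 𝔄} (hf : ContinuousOn f Γ.trace)
    (hb : ∀ ζ, Commute b (f ζ)) : Commute b (Γ.integral f) := by
  have h1 := integral_clm (ContinuousLinearMap.mul ℂ 𝔄 b) hf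
  have h2 := integral_clm ((ContinuousLinearMap.mul ℂ 𝔄).flip b) hf
  simp only [ContinuousLinearMap.mul_apply', ContinuousLinearMap.flip_apply] at h1 h2
  refine h1.symm.trans (Eq.trans ?_ h2)
  exact integral_congr fun ζ _ => hb ζ

lemma commute_riesz (h : ∀ ζ ∈ Γ.trace, ζ ∈ resolventSet ℂ a) {b : 𝔄} (hb : Commute b a) :
    Commute b (Γ.riesz a) :=
  (commute_integral (continuousOn_resolvent h) (commute_resolvent hb)).smul_right _

lemma commute_rieszTransform (h : ∀ ζ ∈ Γ.trace, ζ ∈ resolventSet ℂ a) {z : ℂ} (hz : z ∉ Γ.trace)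
    {b : 𝔄} (hb : Commute b a) : Commute b (Γ.rieszTransform a z) :=
  (commute_integral ((continuousOn_inv_sub hz).smul (continuousOn_resolvent h))
    fun ζ => (commute_resolvent hb ζ).smul_right _).smul_right _

/-- The resolvent identity `(z - a) (ζ - z)⁻¹ (ζ - a)⁻¹ = (ζ - z)⁻¹ - (ζ - a)⁻¹`, integrated over
the contour. It replaces any deformation of contours: inside the curve the transform inverts `z - a`
where `P = 0`, outside its negative does so where `P = 1`. -/
lemma sub_mul_rieszTransform (h : ∀ ζ ∈ Γ.trace, ζ ∈ resolventSet ℂ a) {z : ℂ}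
    (hz : z ∉ Γ.trace) :
    (algebraMap ℂ 𝔄 z - a) * Γ.rieszTransform a z
      = windingNumber Γ.toFun z • (1 : 𝔄) - Γ.riesz a := by
  have hc := continuousOn_resolvent h
  have hi := continuousOn_inv_sub hz
  have hic : ContinuousOn (fun ζ => (ζ - z)⁻¹ • (1 : 𝔄)) Γ.trace := hi.smul continuousOn_const
  have hir : ContinuousOn (fun ζ => (ζ - z)⁻¹ • resolvent a ζ) Γ.trace := hi.smul hc
  have h1 := integral_clm (ContinuousLinearMap.mul ℂ 𝔄 (algebraMap ℂ 𝔄 z - a)) hir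
  have h2 : ∀ ζ ∈ Γ.trace, ContinuousLinearMap.mul ℂ 𝔄 (algebraMap ℂ 𝔄 z - a)
      ((ζ - z)⁻¹ • resolvent a ζ) = (ζ - z)⁻¹ • (1 : 𝔄) - resolvent a ζ := by
    intro ζ hζ
    have hne : ζ - z ≠ 0 := fun h => hz (by rw [sub_eq_zero] at h; exact h ▸ hζ)
    have h3 : algebraMap ℂ 𝔄 z - a = (algebraMap ℂ 𝔄 ζ - a) - (ζ - z) • 1 := by
      rw [Algebra.algebraMap_eq_smul_one, Algebra.algebraMap_eq_smul_one, sub_smul]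
      abel
    rw [ContinuousLinearMap.mul_apply', mul_smul_comm, h3, sub_mul, sub_mul_resolvent (h ζ hζ),
      smul_sub, smul_mul_assoc, one_mul, smul_smul, inv_mul_cancel₀ hne, one_smul]
  have h4 : Γ.integral (fun ζ => (ζ - z)⁻¹ • (1 : 𝔄))
      = Γ.integral (fun ζ => (ζ - z)⁻¹ • (1 : ℂ)) • (1 : 𝔄) := by
    have := integral_clm (Γ := Γ) ((ContinuousLinearMap.id ℂ ℂ).smulRight (1 : 𝔄)) hi
    simpa using this
  rw [rieszTransform, riesz, windingNumber_eq, mul_smul_comm, mul_smul, ← smul_sub, ← h4,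
    ← integral_sub hic hc]
  congr 1
  exact h1.symm.trans (integral_congr h2)

lemma differentiableAt_rieszTransform (h : ∀ ζ ∈ Γ.trace, ζ ∈ resolventSet ℂ a) {z : ℂ}
    (hz : z ∉ Γ.trace) : DifferentiableAt ℂ (Γ.rieszTransform a) z := by
  unfold rieszTransform
  exact (differentiableAt_cauchyTransform (continuousOn_resolvent h) hz).fun_const_smul _

/-- The Riesz integral is idempotent: `(z - a)⁻¹ P (1 - P)` continues to an entire function that
vanishes at infinity. -/
theorem riesz_mul_self (h : ∀ ζ ∈ Γ.trace, ζ ∈ resolventSet ℂ a) :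
    Γ.riesz a * Γ.riesz a = Γ.riesz a := by
  classical
  set P := Γ.riesz a
  set Q := Γ.rieszTransform a
  have hout : ∀ z ∈ Γ.outside, z ∈ resolventSet ℂ a →
      resolvent a z * (P * (1 - P)) = -(Q z * (1 - P)) := by
    intro z hz hr
    have h1 := sub_mul_rieszTransform h hz.1
    rw [hz.2, zero_smul, zero_sub] at h1
    rw [← mul_assoc, ← neg_mul]
    congr 1
    rw [← neg_eq_iff_eq_neg] at h1
    rw [show P = _ from h1.symm, mul_neg, ← mul_assoc, resolvent_mul_sub hr, one_mul]
  have hin : ∀ z ∈ Γ.inside, z ∈ resolventSet ℂ a →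
      resolvent a z * (P * (1 - P)) = Q z * P := by
    intro z hz hr
    have h1 := sub_mul_rieszTransform h hz.1
    rw [hz.2, one_smul] at h1
    have h2 : P * (1 - P) = (1 - P) * P := by rw [mul_sub, sub_mul, mul_one, one_mul]
    rw [h2, ← mul_assoc]
    congr 1
    rw [← h1, ← mul_assoc, resolvent_mul_sub hr, one_mul]
  -- The curve lies in the resolvent set, and off the curve the Cauchy transform is holomorphic even
  -- at spectral points. The two descriptions agree where both apply, so `f` is entire.
  let f : ℂ → 𝔄 := fun z =>
    if z ∈ resolventSet ℂ a then resolvent a z * (P * (1 - P))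
    else if z ∈ Γ.outside then -(Q z * (1 - P)) else Q z * P
  have hfr : ∀ z ∈ resolventSet ℂ a, f z = resolvent a z * (P * (1 - P)) := fun z hz => if_pos hz
  have hfo : ∀ z ∈ Γ.outside, f z = -(Q z * (1 - P)) := by
    intro z hz
    by_cases hr : z ∈ resolventSet ℂ a
    · rw [hfr z hr, hout z hz hr]
    · simp only [f, if_neg hr, if_pos hz]
  have hfi : ∀ z ∈ Γ.inside, f z = Q z * P := by
    intro z hz
    by_cases hr : z ∈ resolventSet ℂ a
    · rw [hfr z hr, hin z hz hr]
    · simp only [f, if_neg hr, if_neg (disjoint_inside_outside.notMem_of_mem_left hz)]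
  have hdiff : Differentiable ℂ f := by
    intro z
    by_cases hz : z ∈ Γ.trace
    · have h1 : f =ᶠ[𝓝 z] fun z => resolvent a z * (P * (1 - P)) := by
        filter_upwards [(spectrum.isOpen_resolventSet (𝕜 := ℂ) a).mem_nhds (h z hz)] with y hy
          using hfr y hy
      exact ((spectrum.hasDerivAt_resolvent_const_left
        (h z hz)).differentiableAt.mul_const _).congr_of_eventuallyEq h1
    · have hQ := differentiableAt_rieszTransform h hz
      rcases mem_inside_or_outside hz with hi | ho
      · refine (hQ.mul_const P).congr_of_eventuallyEq ?_
        filter_upwards [eventually_inside hi] with y hy using hfi y hy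
      · refine (hQ.mul_const (1 - P)).neg.congr_of_eventuallyEq ?_
        filter_upwards [eventually_outside ho] with y hy using hfo y hy
  have hlim : Tendsto f (cocompact ℂ) (𝓝 0) := by
    have h1 : Tendsto (fun z => resolvent a z * (P * (1 - P))) (cocompact ℂ) (𝓝 0) := by
      have := (spectrum.resolvent_tendsto_cobounded a (𝕜 := ℂ)).mul_const (P * (1 - P))
      simpa [Metric.cobounded_eq_cocompact] using this
    refine h1.congr' ?_
    filter_upwards [(spectrum.isCompact (𝕜 := ℂ) a).compl_mem_cocompact] with z hz
    exact (hfr z (by simpa [spectrum] using hz)).symm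
  -- Any point of the resolvent set will do: multiplying `f z = 0` by `z - a` leaves `P (1 - P) =
  -- 0`.
  obtain ⟨z, hz⟩ := Γ.trace_nonempty
  have h0 : f z = 0 := hdiff.apply_eq_of_tendsto_cocompact z hlim
  rw [hfr z (h z hz)] at h0
  have h1 : P * (1 - P) = 0 := by
    have h2 := congrArg (fun x => (algebraMap ℂ 𝔄 z - a) * x) h0
    simpa only [← mul_assoc, sub_mul_resolvent (h z hz), one_mul, mul_zero] using h2
  rw [mul_sub, mul_one, sub_eq_zero] at h1
  exact h1.symm

end Riesz

end Contour
-- Spectra on the range and the kernel of the Riesz projection.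
section SpectralProjection

variable {H : Type*} [NormedAddCommGroup H] [NormedSpace ℂ H]

lemma isUnit_algebraMap_sub_iff_bijective {V : Type*} [AddCommGroup V] [Module ℂ V]
    (f : V →ₗ[ℂ] V) (w : ℂ) :
    w ∉ spectrum ℂ f ↔ Function.Bijective fun x => w • x - f x := by
  rw [spectrum.notMem_iff, Module.End.isUnit_iff]
  rfl

/-- The restriction is a plain linear map, so only bijectivity matters. Since `B` commutes with `A`,
a right inverse of `w - A` on `V` is also a left inverse. -/
lemma notMem_spectrum_restrict {V : Submodule ℂ H} {A B : H →L[ℂ] H}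
    (hA : ∀ x ∈ V, (A : H →ₗ[ℂ] H) x ∈ V) (hB : ∀ x ∈ V, B x ∈ V) {w : ℂ}
    (h : ∀ x ∈ V, w • B x - A (B x) = x) (hc : A * B = B * A) :
    w ∉ spectrum ℂ ((A : H →ₗ[ℂ] H).restrict hA) := by
  have hc' : ∀ x, A (B x) = B (A x) := fun x => DFunLike.congr_fun hc x
  rw [isUnit_algebraMap_sub_iff_bijective]
  constructor
  · intro x y hxy
    have h0 : w • (x : H) - A x = w • (y : H) - A y := congrArg Subtype.val hxy
    have key : ∀ x ∈ V, B (w • x - A x) = x := fun x hx => by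
      rw [map_sub, map_smul, ← hc', h x hx]
    exact Subtype.ext (by rw [← key x x.2, h0, key y y.2])
  · intro y
    exact ⟨⟨B y, hB y y.2⟩, Subtype.ext (h y y.2)⟩

variable [CompleteSpace H]

lemma mem_resolventSet_iff_bijective (A : H →L[ℂ] H) (w : ℂ) :
    w ∈ resolventSet ℂ A ↔ Function.Bijective fun x => w • x - A x := by
  rw [spectrum.mem_resolventSet_iff, ContinuousLinearMap.isUnit_iff_bijective]
  rfl

/-- The space is the direct sum of the range and the kernel of `P`, and `A` is diagonal in this
splitting; bijectivity on both summands gives bijectivity on the whole. -/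
lemma mem_resolventSet_of_restrict {A P : H →L[ℂ] H} (hP : P * P = P) (hc : A * P = P * A)
    {hr : ∀ x ∈ P.range, (A : H →ₗ[ℂ] H) x ∈ P.range}
    {hk : ∀ x ∈ P.ker, (A : H →ₗ[ℂ] H) x ∈ P.ker} {w : ℂ}
    (h1 : w ∉ spectrum ℂ ((A : H →ₗ[ℂ] H).restrict hr))
    (h2 : w ∉ spectrum ℂ ((A : H →ₗ[ℂ] H).restrict hk)) : w ∈ resolventSet ℂ A := by
  have hP' : ∀ x, P (P x) = P x := fun x => DFunLike.congr_fun hP x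
  have hc' : ∀ x, A (P x) = P (A x) := fun x => DFunLike.congr_fun hc x
  have hmk : ∀ x, x - P x ∈ P.ker := fun x => by
    simp [hP']
  have hmr : ∀ x, P x ∈ P.range := fun x => ⟨x, rfl⟩
  rw [isUnit_algebraMap_sub_iff_bijective] at h1 h2
  rw [mem_resolventSet_iff_bijective]
  constructor
  · refine (injective_iff_map_eq_zero (algebraMap ℂ (H →L[ℂ] H) w - A)).2 fun x hx => ?_
    have hx' : w • x - A x = 0 := hx
    have e1 : w • P x - A (P x) = 0 := by rw [hc', ← map_smul, ← map_sub, hx', map_zero]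
    have e2 : w • (x - P x) - A (x - P x) = 0 := by
      rw [smul_sub, map_sub, sub_sub_sub_comm, hx', e1, sub_zero]
    have z1 : (⟨P x, hmr x⟩ : P.range) = 0 := h1.1 (Subtype.ext (by simpa using e1))
    have z2 : (⟨x - P x, hmk x⟩ : P.ker) = 0 := h2.1 (Subtype.ext (by simpa using e2))
    have z1' : P x = 0 := congrArg Subtype.val z1
    have z2' : x - P x = 0 := congrArg Subtype.val z2
    rw [← z2', z1', sub_zero]
  · intro y
    obtain ⟨u, hu⟩ := h1.2 ⟨P y, hmr y⟩
    obtain ⟨v, hv⟩ := h2.2 ⟨y - P y, hmk y⟩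
    have hu' : w • (u : H) - A u = P y := congrArg Subtype.val hu
    have hv' : w • (v : H) - A v = y - P y := congrArg Subtype.val hv
    refine ⟨u + v, ?_⟩
    simp only
    rw [smul_add, map_add, add_sub_add_comm, hu', hv', add_sub_cancel]

/-- The resolvent commutes with `P` and so inverts `w - A` on both summands when `w` is regular. At
the remaining points the Cauchy transform inverts it on the range for `w` outside and on the kernel
for `w` inside, which distributes the spectrum between the summands. -/
theorem Contour.isSpectralProjection {Γ : Contour} {A : H →L[ℂ] H}
    (h : ∀ ζ ∈ Γ.trace, ζ ∈ resolventSet ℂ A) :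
    IsSpectralProjection A (Γ.riesz A) (spectrum ℂ A ∩ Γ.inside) := by
  have hP := Contour.riesz_mul_self h
  have hAP : A * Γ.riesz A = Γ.riesz A * A := Contour.commute_riesz h (Commute.refl A)
  set P := Γ.riesz A
  have hmem : ∀ B : H →L[ℂ] H, B * P = P * B →
      (∀ x ∈ P.range, B x ∈ P.range) ∧ (∀ x ∈ P.ker, B x ∈ P.ker) := by
    intro B hB
    have hB' : ∀ x, B (P x) = P (B x) := fun x => DFunLike.congr_fun hB x
    refine ⟨?_, ?_⟩
    · rintro x ⟨y, rfl⟩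
      exact ⟨B y, (hB' y).symm⟩
    · intro x hx
      have hx' : P x = 0 := hx
      change P (B x) = 0
      rw [← hB', hx', map_zero]
  have hr := (hmem A hAP).1
  have hk := (hmem A hAP).2
  have hPr : ∀ x ∈ P.range, P x = x := by
    rintro x ⟨y, rfl⟩
    exact DFunLike.congr_fun hP y
  have hres : ∀ w ∈ resolventSet ℂ A, w ∉ spectrum ℂ ((A : H →ₗ[ℂ] H).restrict hr) ∧
      w ∉ spectrum ℂ ((A : H →ₗ[ℂ] H).restrict hk) := by
    intro w hw
    have hcA : Commute A (resolvent A w) := Contour.commute_resolvent (Commute.refl A) w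
    have hcP : resolvent A w * P = P * resolvent A w :=
      Contour.commute_riesz h hcA.symm
    have h1 : ∀ x, w • resolvent A w x - A (resolvent A w x) = x := fun x =>
      DFunLike.congr_fun (Contour.sub_mul_resolvent hw) x
    exact ⟨notMem_spectrum_restrict hr (hmem _ hcP).1 (fun x _ => h1 x) hcA,
      notMem_spectrum_restrict hk (hmem _ hcP).2 (fun x _ => h1 x) hcA⟩
  have hQ : ∀ w ∉ Γ.trace, A * Γ.rieszTransform A w = Γ.rieszTransform A w * A ∧
      Γ.rieszTransform A w * P = P * Γ.rieszTransform A w ∧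
      ∀ x, w • Γ.rieszTransform A w x - A (Γ.rieszTransform A w x)
        = windingNumber Γ.toFun w • x - P x := by
    intro w hw
    have hcA : Commute A (Γ.rieszTransform A w) :=
      Contour.commute_rieszTransform h hw (Commute.refl A)
    exact ⟨hcA, Contour.commute_riesz h hcA.symm, fun x =>
      DFunLike.congr_fun (Contour.sub_mul_rieszTransform h hw) x⟩
  have hout : ∀ w ∈ Γ.outside, w ∉ spectrum ℂ ((A : H →ₗ[ℂ] H).restrict hr) := by
    intro w hw
    obtain ⟨hcA, hcP, hx⟩ := hQ w hw.1
    -- Winding number zero gives `(w - A) Q(w) = -P`, and `P` is the identity on its range.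
    refine notMem_spectrum_restrict (B := -Γ.rieszTransform A w) hr (fun x hx => ?_)
      (fun x hx' => ?_) (by rw [mul_neg, neg_mul, hcA])
    · rw [neg_apply]
      exact neg_mem ((hmem _ hcP).1 x hx)
    · have := hx x
      rw [hw.2, zero_smul, zero_sub, hPr x hx'] at this
      rw [neg_apply, map_neg, smul_neg, ← neg_sub', this, neg_neg]
  have hin : ∀ w ∈ Γ.inside, w ∉ spectrum ℂ ((A : H →ₗ[ℂ] H).restrict hk) := by
    intro w hw
    obtain ⟨hcA, hcP, hx⟩ := hQ w hw.1
    refine notMem_spectrum_restrict hk (hmem _ hcP).2 (fun x hx' => ?_) hcA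
    have h0 : P x = 0 := hx'
    have := hx x
    rwa [hw.2, one_smul, h0, sub_zero] at this
  have htr : ∀ w ∈ spectrum ℂ A, w ∉ Γ.trace := fun w hw hw' => hw (h w hw')
  refine ⟨hP, hAP, ⟨hr, Set.Subset.antisymm ?_ ?_⟩, ⟨hk, Set.Subset.antisymm ?_ ?_⟩⟩
  · intro w hw
    have hs : w ∈ spectrum ℂ A := fun hw' => (hres w hw').1 hw
    exact ⟨hs, (Contour.mem_inside_or_outside (htr w hs)).resolve_right fun ho => hout w ho hw⟩
  · rintro w ⟨hs, hi⟩
    by_contra hw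
    exact hs (mem_resolventSet_of_restrict hP hAP hw (hin w hi))
  · intro w hw
    exact ⟨fun hw' => (hres w hw').2 hw, fun hi => hin w hi.2 hw⟩
  · rintro w ⟨hs, hi⟩
    by_contra hw
    rcases Contour.mem_inside_or_outside (htr w hs) with h1 | h1
    · exact hi ⟨hs, h1⟩
    · exact hs (mem_resolventSet_of_restrict hP hAP (hout w h1) hw)

end SpectralProjection
-- The trace of operators of finite rank.
section FiniteRankTrace

section Algebraic

variable {H M : Type*} [AddCommGroup H] [Module ℂ H] [AddCommGroup M] [Module ℂ M]
  [FiniteDimensional ℂ M]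

lemma finiteDimensional_range_comp (a : M →ₗ[ℂ] H) (b : H →ₗ[ℂ] M) :
    FiniteDimensional ℂ (a ∘ₗ b).range :=
  Submodule.finiteDimensional_of_le (LinearMap.range_comp_le_range b a)

/-- If `B = a ∘ b` factors through a finite-dimensional space, its trace is that of `b ∘ a`. -/
lemma finiteRankTrace_comp (a : M →ₗ[ℂ] H) (b : H →ₗ[ℂ] M) :
    finiteRankTrace (a ∘ₗ b) = LinearMap.trace ℂ M (b ∘ₗ a) := by
  have := finiteDimensional_range_comp a b
  -- Cutting both factors down to ranges makes both spaces finite-dimensional, so cyclicity of the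
  -- trace applies whatever the dimension of `H`.
  let bV : (a ∘ₗ b).range →ₗ[ℂ] b.range := b.rangeRestrict ∘ₗ (a ∘ₗ b).range.subtype
  let aN : b.range →ₗ[ℂ] (a ∘ₗ b).range := (a ∘ₗ b.range.subtype).codRestrict _ (by
    rintro ⟨_, y, rfl⟩
    exact ⟨y, rfl⟩)
  have h1 : finiteRankTrace (a ∘ₗ b) = LinearMap.trace ℂ _ (aN ∘ₗ bV) := rfl
  rw [h1, LinearMap.trace_comp_comm']
  rw [← LinearMap.trace_restrict_eq_of_forall_mem b.range (b ∘ₗ a) (fun x => ⟨a x, rfl⟩)]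
  rfl

/-- Different operators have different ranges. Computing the trace on any common finite-dimensional
space that contains them is what makes it additive. -/
lemma finiteRankTrace_eq_of_le {B : H →ₗ[ℂ] H} {W : Submodule ℂ H} [FiniteDimensional ℂ W]
    (h : ∀ x, B x ∈ W) :
    finiteRankTrace B = LinearMap.trace ℂ W (B.codRestrict W h ∘ₗ W.subtype) :=
  finiteRankTrace_comp W.subtype (B.codRestrict W h)

/-- The linear maps of finite rank. -/
def finiteRank (H : Type*) [AddCommGroup H] [Module ℂ H] : Submodule ℂ (H →ₗ[ℂ] H) where
  carrier := {B | FiniteDimensional ℂ B.range}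
  add_mem' {B C} hB hC := by
    have hB' : FiniteDimensional ℂ B.range := hB
    have hC' : FiniteDimensional ℂ C.range := hC
    exact Submodule.finiteDimensional_of_le (LinearMap.range_add_le B C)
  zero_mem' := by
    change FiniteDimensional ℂ (0 : H →ₗ[ℂ] H).range
    rw [LinearMap.range_zero]
    infer_instance
  smul_mem' c B hB := by
    have hB' : FiniteDimensional ℂ B.range := hB
    refine Submodule.finiteDimensional_of_le (S₂ := B.range) ?_
    rintro _ ⟨x, rfl⟩
    exact ⟨c • x, by simp⟩

lemma mem_finiteRank {B : H →ₗ[ℂ] H} : B ∈ finiteRank H ↔ FiniteDimensional ℂ B.range := Iff.rfl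

lemma finiteRankTrace_add {B C : H →ₗ[ℂ] H} (hB : B ∈ finiteRank H) (hC : C ∈ finiteRank H) :
    finiteRankTrace (B + C) = finiteRankTrace B + finiteRankTrace C := by
  have hB' : FiniteDimensional ℂ B.range := hB
  have hC' : FiniteDimensional ℂ C.range := hC
  have h1 : ∀ x, B x ∈ B.range ⊔ C.range := fun x => Submodule.mem_sup_left ⟨x, rfl⟩
  have h2 : ∀ x, C x ∈ B.range ⊔ C.range := fun x => Submodule.mem_sup_right ⟨x, rfl⟩
  rw [finiteRankTrace_eq_of_le h1, finiteRankTrace_eq_of_le h2,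
    finiteRankTrace_eq_of_le (B := B + C) (fun x => add_mem (h1 x) (h2 x)), ← map_add]
  rfl

lemma finiteRankTrace_smul (c : ℂ) {B : H →ₗ[ℂ] H} (hB : B ∈ finiteRank H) :
    finiteRankTrace (c • B) = c * finiteRankTrace B := by
  have hB' : FiniteDimensional ℂ B.range := hB
  have h1 : ∀ x, B x ∈ B.range := fun x => ⟨x, rfl⟩
  rw [finiteRankTrace_eq_of_le h1,
    finiteRankTrace_eq_of_le (B := c • B) (fun x => Submodule.smul_mem _ c (h1 x)), ← smul_eq_mul,
    ← map_smul]
  rfl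

/-- The trace as a linear functional on the linear maps of finite rank. -/
noncomputable def finiteRankTraceₗ (H : Type*) [AddCommGroup H] [Module ℂ H] :
    finiteRank H →ₗ[ℂ] ℂ where
  toFun B := finiteRankTrace (B : H →ₗ[ℂ] H)
  map_add' B C := finiteRankTrace_add B.2 C.2
  map_smul' c B := finiteRankTrace_smul c B.2

end Algebraic

/-- In an orthonormal basis of the range each diagonal entry is at most `‖B‖`. The factor of the
rank is unavoidable, so this is useful only for families of bounded rank. -/
lemma norm_finiteRankTrace_le {H : Type*} [NormedAddCommGroup H] [InnerProductSpace ℂ H]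
    {B : H →L[ℂ] H} (hB : B.toLinearMap ∈ finiteRank H) :
    ‖finiteRankTrace B.toLinearMap‖ ≤ Module.finrank ℂ B.range * ‖B‖ := by
  have hB' : FiniteDimensional ℂ B.range := hB
  have h1 : ∀ x, B.toLinearMap x ∈ B.range := fun x => ⟨x, rfl⟩
  rw [finiteRankTrace_eq_of_le h1, LinearMap.trace_eq_sum_inner _ (stdOrthonormalBasis ℂ B.range)]
  refine (norm_sum_le _ _).trans ?_
  have h2 : ∀ i, ‖inner ℂ (stdOrthonormalBasis ℂ B.range i)
      ((B.toLinearMap.codRestrict _ h1 ∘ₗ B.range.subtype) (stdOrthonormalBasis ℂ B.range i))‖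
        ≤ ‖B‖ := by
    intro i
    have hu := (stdOrthonormalBasis ℂ B.range).orthonormal.1 i
    refine (norm_inner_le_norm _ _).trans ?_
    rw [hu, one_mul]
    refine (B.le_opNorm _).trans ?_
    have : ‖((stdOrthonormalBasis ℂ B.range i : B.range) : H)‖ = 1 := hu
    simp [this]
  refine (Finset.sum_le_sum fun i _ => h2 i).trans ?_
  simp

end FiniteRankTrace

/-! ### Taylor coefficients of the trace of an analytic family of finite rank. -/

section Germs

variable {E F G : Type*} [NormedAddCommGroup E] [NormedSpace ℂ E] [NormedAddCommGroup F]
  [NormedSpace ℂ F] [NormedAddCommGroup G] [NormedSpace ℂ G]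

lemma analyticAt_clm_comp {a : ℂ → F →L[ℂ] G} {b : ℂ → E →L[ℂ] F} {z : ℂ}
    (ha : AnalyticAt ℂ a z) (hb : AnalyticAt ℂ b z) :
    AnalyticAt ℂ (fun z => a z ∘L b z) z :=
  ((ContinuousLinearMap.compL ℂ E F G).analyticAt_bilinear (a z, b z)).comp₂ ha hb

lemma analyticAt_dslope {f : ℂ → E} (hf : AnalyticAt ℂ f 0) : AnalyticAt ℂ (dslope f 0) 0 := by
  obtain ⟨p, hp⟩ := hf
  exact ⟨_, hp.has_fpower_series_dslope_fslope⟩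

lemma eventuallyEq_dslope {f g : ℂ → E} (h : f =ᶠ[𝓝 0] g) : dslope f 0 =ᶠ[𝓝 0] dslope g 0 := by
  have h0 := h.eq_of_nhds
  have hd := h.deriv_eq
  filter_upwards [h] with z hz
  by_cases hz0 : z = 0
  · rw [hz0, dslope_same, dslope_same, hd]
  · rw [dslope_of_ne _ hz0, dslope_of_ne _ hz0, slope, slope, hz, h0]

lemma eventuallyEq_iterate_dslope {f g : ℂ → E} (h : f =ᶠ[𝓝 0] g) (k : ℕ) :
    (Function.swap dslope 0)^[k] f =ᶠ[𝓝 0] (Function.swap dslope 0)^[k] g := by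
  induction k generalizing f g with
  | zero => exact h
  | succ k ih => exact ih (eventuallyEq_dslope h)

/-- Each `dslope` at `0` shifts the Taylor coefficients by one. Claims about coefficients thereby
become inductions on the number of difference quotients. -/
lemma iterate_dslope_eq_coeff {f : ℂ → E} {p : FormalMultilinearSeries ℂ ℂ E}
    (h : HasFPowerSeriesAt f p 0) (k : ℕ) :
    (Function.swap dslope 0)^[k] f 0 = p.coeff k := by
  have h1 := (h.has_fpower_series_iterate_dslope_fslope k).coeff_zero 1
  have h2 := FormalMultilinearSeries.coeff_iterate_fslope (p := p) k 0
  rw [zero_add] at h2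
  rw [← h1, ← h2]
  rfl

/-- The germ at `0` of an operator-valued function that factors analytically through a
finite-dimensional space. -/
def IsFiniteRankGerm {E : Type} [NormedAddCommGroup E] [NormedSpace ℂ E] (f : ℂ → E →L[ℂ] E) :
    Prop :=
  ∃ (M : Type) (_ : NormedAddCommGroup M) (_ : NormedSpace ℂ M) (_ : FiniteDimensional ℂ M)
    (a : ℂ → M →L[ℂ] E) (b : ℂ → E →L[ℂ] M), AnalyticAt ℂ a 0 ∧ AnalyticAt ℂ b 0 ∧
      f =ᶠ[𝓝 0] fun z => a z ∘L b z

variable {H : Type} [NormedAddCommGroup H] [NormedSpace ℂ H]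

namespace IsFiniteRankGerm

variable {f : ℂ → H →L[ℂ] H} 

lemma eventually_mem (h : IsFiniteRankGerm f) :
    ∀ᶠ z in 𝓝 0, (f z).toLinearMap ∈ finiteRank H := by
  obtain ⟨M, _, _, _, a, b, -, -, he⟩ := h
  filter_upwards [he] with z hz
  rw [hz]
  exact finiteDimensional_range_comp (a z).toLinearMap (b z).toLinearMap

lemma analyticAt (h : IsFiniteRankGerm f) : AnalyticAt ℂ f 0 := by
  obtain ⟨M, _, _, _, a, b, ha, hb, he⟩ := h
  exact (analyticAt_clm_comp ha hb).congr he.symm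

/-- The trace on the operators of a finite-dimensional space, as a continuous functional. -/
noncomputable def _root_.HighContrast.traceCLM (M : Type*) [NormedAddCommGroup M] [NormedSpace ℂ M]
    [FiniteDimensional ℂ M] : (M →L[ℂ] M) →L[ℂ] ℂ :=
  LinearMap.toContinuousLinearMap
    ((LinearMap.trace ℂ M) ∘ₗ (ContinuousLinearMap.coeLM ℂ : (M →L[ℂ] M) →ₗ[ℂ] (M →ₗ[ℂ] M)))

lemma _root_.HighContrast.finiteRankTrace_clm_comp {M : Type*} [NormedAddCommGroup M]
    [NormedSpace ℂ M] [FiniteDimensional ℂ M] (a : M →L[ℂ] H) (b : H →L[ℂ] M) :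
    finiteRankTrace (a ∘L b).toLinearMap = traceCLM M (b ∘L a) :=
  finiteRankTrace_comp a.toLinearMap b.toLinearMap

lemma analyticAt_trace (h : IsFiniteRankGerm f) :
    AnalyticAt ℂ (fun z => finiteRankTrace (f z).toLinearMap) 0 := by
  obtain ⟨M, _, _, _, a, b, ha, hb, he⟩ := h
  refine AnalyticAt.congr (f := fun z => traceCLM M (b z ∘L a z)) ?_ ?_
  · exact ((traceCLM M).analyticAt _).comp (analyticAt_clm_comp hb ha)
  · filter_upwards [he] with z hz
    rw [hz, finiteRankTrace_clm_comp]

/-- The Leibniz rule for difference quotients, `(ab)(z) - (ab)(0) = (a(z) - a(0)) b(z) + a(0) (b(z)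
- b(0))`, has two terms, each through `M`; together they factor through `M × M`. -/
lemma dslope_germ (h : IsFiniteRankGerm f) : IsFiniteRankGerm (dslope f 0) := by
  have hf := h.analyticAt
  obtain ⟨M, _, _, _, a, b, ha, hb, he⟩ := h
  have ha' := analyticAt_dslope ha
  have hb' := analyticAt_dslope hb
  refine ⟨M × M, inferInstance, inferInstance, inferInstance,
    fun z => dslope a 0 z ∘L ContinuousLinearMap.fst ℂ M M +
      a 0 ∘L ContinuousLinearMap.snd ℂ M M,
    fun z => ContinuousLinearMap.inl ℂ M M ∘L b z + ContinuousLinearMap.inr ℂ M M ∘L dslope b 0 z,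
    (analyticAt_clm_comp ha' analyticAt_const).add analyticAt_const,
    (analyticAt_clm_comp analyticAt_const hb).add (analyticAt_clm_comp analyticAt_const hb'), ?_⟩
  have hc : AnalyticAt ℂ (fun z => dslope a 0 z ∘L b z + a 0 ∘L dslope b 0 z) 0 :=
    (analyticAt_clm_comp ha' hb).add (analyticAt_clm_comp analyticAt_const hb')
  have h1 : dslope f 0 =ᶠ[𝓝 0] fun z => dslope a 0 z ∘L b z + a 0 ∘L dslope b 0 z := by
    refine ((analyticAt_dslope hf).continuousAt.eventuallyEq_nhds_iff_eventuallyEq_nhdsNE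
      hc.continuousAt).1 ?_
    have h0 := he.eq_of_nhds
    filter_upwards [he.filter_mono nhdsWithin_le_nhds, self_mem_nhdsWithin] with z hz hz0
    rw [dslope_of_ne _ hz0, dslope_of_ne _ hz0, dslope_of_ne _ hz0, slope, slope, slope, hz, h0]
    ext x
    simp only [vsub_eq_sub, sub_zero, smul_apply, sub_apply,
      ContinuousLinearMap.comp_apply, add_apply, map_smul, map_sub, smul_sub]
    abel
  filter_upwards [h1] with z hz
  rw [hz]
  ext x
  simp

/-- Away from `0` this is linearity of the trace. Both sides are analytic at `0`, hence continuous
there, which settles the remaining point. -/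
lemma trace_dslope (h : IsFiniteRankGerm f) :
    (fun z => finiteRankTrace (dslope f 0 z).toLinearMap)
      =ᶠ[𝓝 0] dslope (fun z => finiteRankTrace (f z).toLinearMap) 0 := by
  refine (h.dslope_germ.analyticAt_trace.continuousAt.eventuallyEq_nhds_iff_eventuallyEq_nhdsNE
      (analyticAt_dslope h.analyticAt_trace).continuousAt).1 ?_
  have h0 := h.eventually_mem.self_of_nhds
  filter_upwards [h.eventually_mem.filter_mono nhdsWithin_le_nhds, self_mem_nhdsWithin]
    with z hz hz0
  rw [dslope_of_ne _ hz0, dslope_of_ne _ hz0, slope, slope]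
  have h1 : ((z - 0)⁻¹ • (f z -ᵥ f 0)).toLinearMap
      = (z - 0)⁻¹ • ((f z).toLinearMap + (-1 : ℂ) • (f 0).toLinearMap) := by
    ext x
    simp [sub_eq_add_neg]
  rw [h1, finiteRankTrace_smul _ (add_mem hz (Submodule.smul_mem _ _ h0)),
    finiteRankTrace_add hz (Submodule.smul_mem _ _ h0), finiteRankTrace_smul _ h0]
  simp [sub_eq_add_neg]

lemma iterate_dslope (h : IsFiniteRankGerm f) (k : ℕ) :
    ((Function.swap dslope 0)^[k] f 0).toLinearMap ∈ finiteRank H ∧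
    finiteRankTrace ((Function.swap dslope 0)^[k] f 0).toLinearMap =
      (Function.swap dslope 0)^[k] (fun z => finiteRankTrace (f z).toLinearMap) 0 := by
  induction k generalizing f with
  | zero => exact ⟨h.eventually_mem.self_of_nhds, rfl⟩
  | succ k ih =>
    obtain ⟨h1, h2⟩ := ih h.dslope_germ
    refine ⟨h1, h2.trans ?_⟩
    exact (eventuallyEq_iterate_dslope h.trace_dslope k).eq_of_nhds

/-- The Taylor coefficients of a germ of finite rank have finite rank, and the trace may be taken
coefficientwise. -/
theorem coeff {p : FormalMultilinearSeries ℂ ℂ (H →L[ℂ] H)} {q : FormalMultilinearSeries ℂ ℂ ℂ}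
    (h : IsFiniteRankGerm f) (hp : HasFPowerSeriesAt f p 0)
    (hq : HasFPowerSeriesAt (fun z => finiteRankTrace (f z).toLinearMap) q 0) (k : ℕ) :
    (p.coeff k).toLinearMap ∈ finiteRank H ∧
      finiteRankTrace (p.coeff k).toLinearMap = q.coeff k := by
  rw [← iterate_dslope_eq_coeff hp, ← iterate_dslope_eq_coeff hq]
  exact h.iterate_dslope k

lemma mul_left {x : ℂ → H →L[ℂ] H} (hx : AnalyticAt ℂ x 0) (h : IsFiniteRankGerm f) :
    IsFiniteRankGerm (fun z => x z * f z) := by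
  obtain ⟨M, i1, i2, i3, a, b, ha, hb, he⟩ := h
  refine ⟨M, i1, i2, i3, fun z => x z ∘L a z, b, analyticAt_clm_comp hx ha, hb, ?_⟩
  filter_upwards [he] with z hz
  rw [hz]
  rfl

end IsFiniteRankGerm

end Germs
-- Analytic families of projections and the Feynman–Hellmann formula.
section AnalyticProjections

variable {H : Type} [NormedAddCommGroup H] [NormedSpace ℂ H]

lemma finrank_range_eq {M : Type*} [NormedAddCommGroup M] [NormedSpace ℂ M]
    [FiniteDimensional ℂ M] {a : M →L[ℂ] H} {b : H →L[ℂ] M}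
    (h : b ∘L a = ContinuousLinearMap.id ℂ M) :
    Module.finrank ℂ (a ∘L b).range = Module.finrank ℂ M := by
  have hinv : ∀ x, b (a x) = x := fun x => DFunLike.congr_fun h x
  have h1 : (a ∘L b).range = a.range := by
    refine le_antisymm (LinearMap.range_comp_le_range _ _) ?_
    rintro _ ⟨x, rfl⟩
    exact ⟨a x, congrArg a (hinv x)⟩
  rw [h1]
  exact LinearMap.finrank_range_of_inj (f := a.toLinearMap)
    fun x y hxy => by rw [← hinv x, ← hinv y]; exact congrArg b hxy

variable [CompleteSpace H]

/-- An analytic family of projections of finite rank is, near each point, of the form `a ∘ b` with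
`b ∘ a = 1` on a fixed finite-dimensional space. -/
lemma exists_factorization {P : ℂ → H →L[ℂ] H} {z₀ : ℂ} (hP : AnalyticAt ℂ P z₀)
    (hidem : ∀ᶠ z in 𝓝 z₀, P z * P z = P z) :
    ∃ (a : ℂ → (P z₀).range →L[ℂ] H) (b : ℂ → H →L[ℂ] (P z₀).range),
      AnalyticAt ℂ a z₀ ∧ AnalyticAt ℂ b z₀ ∧
      (∀ᶠ z in 𝓝 z₀, P z = a z ∘L b z ∧ b z ∘L a z = ContinuousLinearMap.id ℂ _) := by
  set P₀ := P z₀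
  have h0 : P₀ * P₀ = P₀ := hidem.self_of_nhds
  -- Kato's transformation: `P(z) U(z) = U(z) P₀`, and `U(z₀) = 1`, so `U` is invertible near `z₀`
  -- and conjugates `P₀` to `P(z)`.
  let U : ℂ → H →L[ℂ] H := fun z => P z * P₀ + (1 - P z) * (1 - P₀)
  have hU0 : U z₀ = 1 := by
    change P₀ * P₀ + (1 - P₀) * (1 - P₀) = 1
    rw [mul_sub, sub_mul, sub_mul, h0]
    simp
  have hU : AnalyticAt ℂ U z₀ :=
    (hP.mul analyticAt_const).add ((analyticAt_const.sub hP).mul analyticAt_const)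
  have hV : AnalyticAt ℂ (fun z => Ring.inverse (U z)) z₀ := by
    have h1 : AnalyticAt ℂ Ring.inverse (U z₀) := by
      rw [hU0]
      exact analyticAt_inverse (1 : (H →L[ℂ] H)ˣ)
    exact h1.comp hU
  have hunit : ∀ᶠ z in 𝓝 z₀, IsUnit (U z) := by
    refine hU.continuousAt.eventually (Units.isOpen.mem_nhds ?_)
    simp only [hU0, Set.mem_ofPred_eq, isUnit_one]
  let ι : P₀.range →L[ℂ] H := P₀.range.subtypeL
  let π : H →L[ℂ] P₀.range := P₀.codRestrict P₀.range fun x => ⟨x, rfl⟩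
  have hιπ : ι ∘L π = P₀ := by ext x; rfl
  have hπι : π ∘L ι = ContinuousLinearMap.id ℂ _ := by
    ext ⟨_, y, rfl⟩
    exact DFunLike.congr_fun h0 y
  refine ⟨fun z => U z ∘L ι, fun z => π ∘L Ring.inverse (U z),
    analyticAt_clm_comp hU analyticAt_const, analyticAt_clm_comp analyticAt_const hV, ?_⟩
  filter_upwards [hidem, hunit] with z hz hu
  have hc : P z * U z = U z * P₀ := by
    have e1 : P z * (1 - P z) = 0 := by rw [mul_sub, mul_one, hz, sub_self]
    have e2 : (1 - P₀) * P₀ = 0 := by rw [sub_mul, one_mul, h0, sub_self]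
    simp only [U]
    rw [mul_add, add_mul, ← mul_assoc, ← mul_assoc, hz, e1, zero_mul, mul_assoc, h0, mul_assoc, e2,
      mul_zero]
  constructor
  · have h2 : P z = U z * P₀ * Ring.inverse (U z) := by
      rw [← hc, mul_assoc, Ring.mul_inverse_cancel _ hu, mul_one]
    exact h2.trans (congrArg (fun X => U z * X * Ring.inverse (U z)) hιπ.symm)
  · have h3 : (π ∘L Ring.inverse (U z)) ∘L (U z ∘L ι) =
        π ∘L (Ring.inverse (U z) * U z) ∘L ι := rfl
    rw [h3, Ring.inverse_mul_cancel _ hu]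
    exact hπι

/-- The rank of an analytic family of projections of finite rank is locally constant. -/
lemma eventually_finrank_eq {P : ℂ → H →L[ℂ] H} {z₀ : ℂ} (hP : AnalyticAt ℂ P z₀)
    (hidem : ∀ᶠ z in 𝓝 z₀, P z * P z = P z) (hfin : FiniteDimensional ℂ (P z₀).range) :
    ∀ᶠ z in 𝓝 z₀, Module.finrank ℂ (P z).range = Module.finrank ℂ (P z₀).range := by
  obtain ⟨a, b, -, -, h⟩ := exists_factorization hP hidem
  filter_upwards [h] with z hz
  rw [hz.1, finrank_range_eq hz.2]

lemma isFiniteRankGerm_of_idem {P : ℂ → H →L[ℂ] H} (hP : AnalyticAt ℂ P 0)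
    (hidem : ∀ᶠ z in 𝓝 0, P z * P z = P z) (hfin : FiniteDimensional ℂ (P 0).range) :
    IsFiniteRankGerm P := by
  obtain ⟨a, b, ha, hb, h⟩ := exists_factorization hP hidem
  exact ⟨(P 0).range, inferInstance, inferInstance, hfin, a, b, ha, hb, h.mono fun _ hz => hz.1⟩

/-- Feynman–Hellmann: the derivative of `tr (A P)` is `tr (A' P)` for analytic families of projections
`P` of finite rank commuting with `A`. -/
theorem hasDerivAt_trace_mul {A P : ℂ → H →L[ℂ] H} {A' : H →L[ℂ] H} {z₀ : ℂ}
    (hA : HasDerivAt A A' z₀) (hP : AnalyticAt ℂ P z₀)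
    (hidem : ∀ᶠ z in 𝓝 z₀, P z * P z = P z) (hcomm : ∀ᶠ z in 𝓝 z₀, A z * P z = P z * A z)
    (hfin : FiniteDimensional ℂ (P z₀).range) :
    HasDerivAt (fun z => finiteRankTrace (A z * P z).toLinearMap)
      (finiteRankTrace (A' * P z₀).toLinearMap) z₀ := by
  obtain ⟨a, b, ha, hb, h⟩ := exists_factorization hP hidem
  have ha' := ha.differentiableAt.hasDerivAt
  have hb' := hb.differentiableAt.hasDerivAt
  set a' := deriv a z₀
  set b' := deriv b z₀
  set τ := traceCLM (P z₀).range
  obtain ⟨hab, hba⟩ := h.self_of_nhds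
  have h1 : (fun z => finiteRankTrace (A z * P z).toLinearMap)
      =ᶠ[𝓝 z₀] fun z => τ (b z ∘L A z ∘L a z) := by
    filter_upwards [h] with z hz
    rw [← finiteRankTrace_clm_comp (A z ∘L a z) (b z), ContinuousLinearMap.comp_assoc, ← hz.1]
    rfl
  have h2 : finiteRankTrace (A' * P z₀).toLinearMap = τ (b z₀ ∘L A' ∘L a z₀) := by
    rw [← finiteRankTrace_clm_comp (A' ∘L a z₀) (b z₀), ContinuousLinearMap.comp_assoc, ← hab]
    rfl
  -- The derivative of `b a = 1`.
  have h3 : b' ∘L a z₀ + b z₀ ∘L a' = 0 := by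
    have e1 := hb'.clm_comp ha'
    have e2 : (fun z => b z ∘L a z) =ᶠ[𝓝 z₀] fun _ => ContinuousLinearMap.id ℂ _ :=
      h.mono fun _ hz => hz.2
    exact (e1.congr_of_eventuallyEq e2.symm).unique (hasDerivAt_const _ _)
  -- `L` is the matrix of `A` on the range of the projection
  set L := b z₀ ∘L A z₀ ∘L a z₀ with hL
  have hPA : A z₀ ∘L (a z₀ ∘L b z₀) = (a z₀ ∘L b z₀) ∘L A z₀ := by
    have := hcomm.self_of_nhds
    rw [hab] at this
    exact this
  have hAa : A z₀ ∘L a z₀ = a z₀ ∘L L := by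
    calc A z₀ ∘L a z₀ = (A z₀ ∘L (a z₀ ∘L b z₀)) ∘L a z₀ := by
          rw [ContinuousLinearMap.comp_assoc, ContinuousLinearMap.comp_assoc, hba,
            ContinuousLinearMap.comp_id]
      _ = a z₀ ∘L L := by rw [hPA, hL]; rfl
  have hbA : b z₀ ∘L A z₀ = L ∘L b z₀ := by
    calc b z₀ ∘L A z₀ = (b z₀ ∘L a z₀) ∘L (b z₀ ∘L A z₀) := by
          rw [hba, ContinuousLinearMap.id_comp]
      _ = b z₀ ∘L ((a z₀ ∘L b z₀) ∘L A z₀) := rfl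
      _ = L ∘L b z₀ := by rw [← hPA, hL]; rfl
  have hcyc : ∀ X Y : (P z₀).range →L[ℂ] (P z₀).range, τ (X ∘L Y) = τ (Y ∘L X) := fun X Y =>
    LinearMap.trace_mul_comm ℂ X.toLinearMap Y.toLinearMap
  have h4 := (τ.hasFDerivAt.comp_hasDerivAt z₀ (hb'.clm_comp (hA.clm_comp ha'))).congr_of_eventuallyEq h1
  refine h4.congr_deriv ?_
  -- Since `A` commutes with `P`, it passes through `a` and `b` as `L`. After cyclic permutation the
  -- terms with `a'` and `b'` combine to the trace of `(b' a + b a') L = 0`, and only `b A' a`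
  -- survives.
  have h5 : b' ∘L (A z₀ ∘L a z₀) + b z₀ ∘L (A' ∘L a z₀ + A z₀ ∘L a')
      = (b' ∘L a z₀) ∘L L + b z₀ ∘L A' ∘L a z₀ + L ∘L (b z₀ ∘L a') := by
    rw [ContinuousLinearMap.comp_add, ← ContinuousLinearMap.comp_assoc (b z₀) (A z₀), hbA, hAa,
      add_assoc]
    rfl
  rw [h2, h5, map_add, map_add, hcyc L, add_right_comm, ← map_add, ← ContinuousLinearMap.add_comp,
    h3, ContinuousLinearMap.zero_comp, map_zero, zero_add]

/-- Writing `P = a b` moves the trace of `X P` to the trace of `b X a` on a fixed finite-dimensional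
space, where it is a continuous functional. -/
lemma analyticAt_trace_mul {X P : ℂ → H →L[ℂ] H} {z₀ : ℂ} (hX : AnalyticAt ℂ X z₀)
    (hP : AnalyticAt ℂ P z₀) (hidem : ∀ᶠ z in 𝓝 z₀, P z * P z = P z)
    (hfin : FiniteDimensional ℂ (P z₀).range) :
    AnalyticAt ℂ (fun z => finiteRankTrace (X z * P z).toLinearMap) z₀ := by
  obtain ⟨a, b, ha, hb, h⟩ := exists_factorization hP hidem
  have h1 : (fun z => finiteRankTrace (X z * P z).toLinearMap)
      =ᶠ[𝓝 z₀] fun z => traceCLM (P z₀).range (b z ∘L X z ∘L a z) := by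
    filter_upwards [h] with z hz
    rw [← finiteRankTrace_clm_comp (X z ∘L a z) (b z), ContinuousLinearMap.comp_assoc, ← hz.1]
    rfl
  exact (((traceCLM (P z₀).range).analyticAt _).comp
    (analyticAt_clm_comp hb (analyticAt_clm_comp hX ha))).congr h1.symm

end AnalyticProjections
-- Power series at the origin and Cauchy estimates.
section Taylor

variable {E : Type*} [NormedAddCommGroup E] [NormedSpace ℂ E]

/-- `f(z) = ∑ zⁿ cₙ` near `z = 0`. -/
def HasTaylor (f : ℂ → E) (c : ℕ → E) : Prop := ∀ᶠ z in 𝓝 (0 : ℂ), HasSum (fun n => z ^ n • c n) (f z)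

/-- The power series with given coefficients. -/
noncomputable def seriesOf (c : ℕ → E) : FormalMultilinearSeries ℂ ℂ E :=
  fun n => ContinuousMultilinearMap.mkPiRing ℂ (Fin n) (c n)

@[simp] lemma seriesOf_coeff (c : ℕ → E) (n : ℕ) : (seriesOf c).coeff n = c n := by
  simp [seriesOf, FormalMultilinearSeries.coeff]

lemma hasTaylor_iff_hasFPowerSeriesAt {f : ℂ → E} {c : ℕ → E} :
    HasTaylor f c ↔ HasFPowerSeriesAt f (seriesOf c) 0 := by
  rw [hasFPowerSeriesAt_iff]
  simp [HasTaylor]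

lemma HasFPowerSeriesAt.hasTaylor {f : ℂ → E} {p : FormalMultilinearSeries ℂ ℂ E}
    (h : HasFPowerSeriesAt f p 0) : HasTaylor f p.coeff := by
  rw [hasFPowerSeriesAt_iff] at h
  simpa [HasTaylor] using h

namespace HasTaylor

variable {f g : ℂ → E} {c d : ℕ → E}

lemma analyticAt (h : HasTaylor f c) : AnalyticAt ℂ f 0 :=
  ⟨_, hasTaylor_iff_hasFPowerSeriesAt.1 h⟩

lemma congr (h : HasTaylor f c) (hfg : f =ᶠ[𝓝 0] g) : HasTaylor g c := by
  filter_upwards [h, hfg] with z h1 h2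
  rwa [← h2]

variable [CompleteSpace E] {ε : ℝ}

lemma hasFPowerSeriesOnBall (h : HasTaylor f c) (hd : DifferentiableOn ℂ f (Metric.ball 0 ε))
    {r : NNReal} (hr0 : 0 < r) (hr : r < ε) :
    HasFPowerSeriesOnBall f (seriesOf c) 0 r ∧ seriesOf c = cauchyPowerSeries f 0 r := by
  have h1 : HasFPowerSeriesOnBall f (cauchyPowerSeries f 0 r) 0 r :=
    (hd.mono (Metric.closedBall_subset_ball hr)).hasFPowerSeriesOnBall hr0
  have h2 := (hasTaylor_iff_hasFPowerSeriesAt.1 h).eq_formalMultilinearSeries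
    h1.hasFPowerSeriesAt
  exact ⟨h2 ▸ h1, h2⟩

lemma hasSum (h : HasTaylor f c) (hd : DifferentiableOn ℂ f (Metric.ball 0 ε)) {z : ℂ}
    (hz : z ∈ Metric.ball (0 : ℂ) ε) : HasSum (fun n => z ^ n • c n) (f z) := by
  rw [mem_ball_zero_iff] at hz
  obtain ⟨r, h1, h2⟩ := exists_between hz
  have hr0 : 0 < r := (norm_nonneg z).trans_lt h1
  lift r to NNReal using hr0.le
  have h3 := (h.hasFPowerSeriesOnBall hd (by exact_mod_cast hr0) h2).1
  have h4 := h3.hasSum (y := z) (by simpa [← NNReal.coe_lt_coe] using h1)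
  simpa [seriesOf] using h4

/-- Cauchy's estimate. A bound `M` uniform in a further parameter yields the geometric majorants for
termwise integration over `ζ` and over `s`. -/
lemma norm_coeff_le (h : HasTaylor f c) (hd : DifferentiableOn ℂ f (Metric.ball 0 ε)) {M : ℝ}
    (hM : ∀ z ∈ Metric.ball (0 : ℂ) ε, ‖f z‖ ≤ M) {r : ℝ} (hr0 : 0 < r) (hr : r < ε) (n : ℕ) :
    ‖c n‖ ≤ M * r⁻¹ ^ n := by
  lift r to NNReal using hr0.le
  have h1 := (h.hasFPowerSeriesOnBall hd (by exact_mod_cast hr0) hr).2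
  have h2 : ‖c n‖ = ‖cauchyPowerSeries f 0 r n‖ := by
    rw [← h1, ← seriesOf_coeff c n, FormalMultilinearSeries.norm_apply_eq_norm_coef]
  rw [h2]
  refine (norm_cauchyPowerSeries_le f 0 r n).trans ?_
  rw [abs_of_nonneg (NNReal.coe_nonneg r)]
  refine mul_le_mul_of_nonneg_right ?_ (by positivity)
  have h3 : ∫ θ : ℝ in 0..2 * Real.pi, ‖f (circleMap 0 r θ)‖ ≤ M * |2 * Real.pi - 0| := by
    refine (le_abs_self _).trans ?_
    rw [← Real.norm_eq_abs]
    refine intervalIntegral.norm_integral_le_of_norm_le_const fun θ _ => ?_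
    rw [norm_norm]
    refine hM _ ?_
    rw [mem_ball_zero_iff]
    simpa [abs_of_nonneg (NNReal.coe_nonneg r)] using hr
  have hpi := Real.pi_pos
  rw [sub_zero, abs_of_pos (by positivity)] at h3
  calc (2 * Real.pi)⁻¹ * ∫ θ : ℝ in 0..2 * Real.pi, ‖f (circleMap 0 r θ)‖
      ≤ (2 * Real.pi)⁻¹ * (M * (2 * Real.pi)) := by gcongr
    _ = M := by field_simp

/-- The gap `r < ε` gives uniformity up to the boundary of the smaller ball. -/
lemma tendstoUniformlyOn (h : HasTaylor f c) (hd : DifferentiableOn ℂ f (Metric.ball 0 ε))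
    {r : ℝ} (hr : r < ε) :
    TendstoUniformlyOn (fun (N : ℕ) (z : ℂ) => ∑ k ∈ Finset.range N, z ^ k • c k) f atTop
      (Metric.ball 0 r) := by
  rcases le_or_gt r 0 with hr0 | hr0
  · rw [Metric.ball_eq_empty.2 hr0]
    exact tendstoUniformlyOn_empty
  obtain ⟨R, h1, h2⟩ := exists_between hr
  lift r to NNReal using hr0.le
  lift R to NNReal using (hr0.trans h1).le
  have h3 := (h.hasFPowerSeriesOnBall hd (by exact_mod_cast hr0.trans h1) h2).1
  have h4 := h3.tendstoUniformlyOn (r' := r) (by exact_mod_cast h1)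
  simpa [FormalMultilinearSeries.partialSum, seriesOf] using h4

end HasTaylor

end Taylor

/-! ### Resolvents and Riesz projections of perturbed operators. -/

section ResolventPerturbation

variable {𝔄 : Type*} [NormedRing 𝔄] [NormedAlgebra ℂ 𝔄] [CompleteSpace 𝔄]

/-- The factorization `ζ - (a + B) = (1 - B r) (ζ - a)`, with `r` the resolvent of `a`, reduces
inversion to a Neumann series. -/
lemma resolvent_add {a B : 𝔄} {ζ : ℂ} (h : ζ ∈ resolventSet ℂ a) (hB : ‖B * resolvent a ζ‖ < 1) :
    ζ ∈ resolventSet ℂ (a + B) ∧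
      resolvent (a + B) ζ = resolvent a ζ * Ring.inverse (1 - B * resolvent a ζ) := by
  have h1 : algebraMap ℂ 𝔄 ζ - (a + B) = (1 - B * resolvent a ζ) * (algebraMap ℂ 𝔄 ζ - a) := by
    rw [sub_mul, mul_assoc, Contour.resolvent_mul_sub h, one_mul, mul_one, sub_sub]
  have hu : IsUnit (1 - B * resolvent a ζ) := (Units.oneSub _ hB).isUnit
  refine ⟨?_, ?_⟩
  · rw [spectrum.mem_resolventSet_iff, h1]
    exact hu.mul h
  · obtain ⟨u, hu'⟩ := hu
    obtain ⟨v, hv⟩ : IsUnit (algebraMap ℂ 𝔄 ζ - a) := h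
    rw [resolvent, h1, resolvent, ← hv]
    rw [resolvent, ← hv] at hu'
    rw [← hu', ← Units.val_mul, Ring.inverse_unit, Ring.inverse_unit, Ring.inverse_unit, mul_inv_rev,
      Units.val_mul]

lemma norm_resolvent_add_le {a B : 𝔄} {ζ : ℂ} {K q : ℝ} (h : ζ ∈ resolventSet ℂ a)
    (hK : ‖resolvent a ζ‖ ≤ K) (hB : ‖B‖ * K ≤ q) (hq : q < 1) :
    ζ ∈ resolventSet ℂ (a + B) ∧ ‖resolvent (a + B) ζ‖ ≤ K / (1 - q) := by
  have h0 : ‖B * resolvent a ζ‖ ≤ q :=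
    (norm_mul_le _ _).trans ((mul_le_mul_of_nonneg_left hK (norm_nonneg _)).trans hB)
  obtain ⟨h1, h2⟩ := resolvent_add h (h0.trans_lt hq)
  refine ⟨h1, ?_⟩
  have hu : IsUnit (1 - B * resolvent a ζ) := (Units.oneSub _ (h0.trans_lt hq)).isUnit
  -- Taking norms bounds the perturbed resolvent by `K` plus `q` times itself.
  have h3 : resolvent (a + B) ζ = resolvent a ζ + resolvent (a + B) ζ * (B * resolvent a ζ) := by
    rw [← sub_eq_iff_eq_add, ← mul_one_sub, h2, mul_assoc, Ring.inverse_mul_cancel _ hu, mul_one]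
  have h4 : ‖resolvent (a + B) ζ‖ ≤ K + ‖resolvent (a + B) ζ‖ * q := by
    calc ‖resolvent (a + B) ζ‖
        = ‖resolvent a ζ + resolvent (a + B) ζ * (B * resolvent a ζ)‖ := by rw [← h3]
      _ ≤ ‖resolvent a ζ‖ + ‖resolvent (a + B) ζ‖ * ‖B * resolvent a ζ‖ :=
        (norm_add_le _ _).trans (add_le_add_right (norm_mul_le _ _) _)
      _ ≤ K + ‖resolvent (a + B) ζ‖ * q := by gcongr
  rw [le_div_iff₀ (by linarith)]
  linarith

lemma hasDerivAt_resolvent_comp {A : ℂ → 𝔄} {A' : 𝔄} {z ζ : ℂ} (hA : HasDerivAt A A' z)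
    (h : ζ ∈ resolventSet ℂ (A z)) :
    HasDerivAt (fun z => resolvent (A z) ζ) (resolvent (A z) ζ * A' * resolvent (A z) ζ) z := by
  have hu : IsUnit (algebraMap ℂ 𝔄 ζ - A z) := h
  obtain ⟨u, hu⟩ := hu
  have h1 := hasFDerivAt_ringInverse (𝕜 := ℂ) u
  rw [hu] at h1
  have h2 := h1.comp_hasDerivAt z (hA.const_sub (algebraMap ℂ 𝔄 ζ))
  have h3 : resolvent (A z) ζ = ↑u⁻¹ := by rw [resolvent, ← hu, Ring.inverse_unit]
  rw [h3]
  refine h2.congr_deriv ?_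
  simp

variable {Γ : Contour} 

namespace Contour

omit [CompleteSpace 𝔄] in
lemma norm_riesz_le {a : 𝔄} {K : ℝ} (h : ∀ ζ ∈ Γ.trace, ‖resolvent a ζ‖ ≤ K) :
    ‖Γ.riesz a‖ ≤ (2 * Real.pi)⁻¹ * (Γ.speed * K) := by
  rw [riesz, norm_smul]
  have h1 : ‖(2 * Real.pi * Complex.I : ℂ)⁻¹‖ = (2 * Real.pi)⁻¹ := by
    simp [abs_of_pos Real.pi_pos]
  rw [h1]
  exact mul_le_mul_of_nonneg_left (norm_integral_le h) (by positivity)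

lemma exists_norm_resolvent_le {a : 𝔄} (h : ∀ ζ ∈ Γ.trace, ζ ∈ resolventSet ℂ a) :
    ∃ K, 0 < K ∧ ∀ ζ ∈ Γ.trace, ‖resolvent a ζ‖ ≤ K := by
  obtain ⟨K, hK⟩ := Γ.isCompact_trace.exists_bound_of_continuousOn (continuousOn_resolvent h)
  exact ⟨max K 1, by positivity, fun ζ hζ => (hK ζ hζ).trans (le_max_left _ _)⟩

/-- The Riesz integral of an analytic family is analytic where the contour avoids the spectrum. -/
lemma analyticAt_riesz {A : ℂ → 𝔄} {z₀ : ℂ} (hA : AnalyticAt ℂ A z₀)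
    (h : ∀ ζ ∈ Γ.trace, ζ ∈ resolventSet ℂ (A z₀)) :
    AnalyticAt ℂ (fun z => Γ.riesz (A z)) z₀ := by
  obtain ⟨K, hK0, hK⟩ := exists_norm_resolvent_le h
  obtain ⟨M, hM⟩ : ∃ M, ∀ᶠ z in 𝓝 z₀, ‖deriv A z‖ ≤ M :=
    ⟨‖deriv A z₀‖ + 1, (hA.deriv.continuousAt.norm.eventually_lt_const
      (lt_add_one _)).mono fun _ => le_of_lt⟩
  have hsmall : ∀ᶠ z in 𝓝 z₀, ‖A z - A z₀‖ * K ≤ 1 / 2 := by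
    have h1 : Tendsto (fun z => ‖A z - A z₀‖ * K) (𝓝 z₀) (𝓝 0) := by
      have h2 : ContinuousAt (fun z => ‖A z - A z₀‖ * K) z₀ :=
        (hA.continuousAt.sub continuousAt_const).norm.mul continuousAt_const
      simpa using h2.tendsto
    exact (h1.eventually_lt_const (by norm_num)).mono fun _ => le_of_lt
  have hgood : ∀ᶠ z in 𝓝 z₀, DifferentiableAt ℂ A z ∧ ‖deriv A z‖ ≤ M ∧
      ‖A z - A z₀‖ * K ≤ 1 / 2 :=
    (hA.eventually_analyticAt.mono fun _ h => h.differentiableAt).and (hM.and hsmall)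
  have hres : ∀ z, ‖A z - A z₀‖ * K ≤ 1 / 2 → ∀ ζ ∈ Γ.trace, ζ ∈ resolventSet ℂ (A z) ∧
      ‖resolvent (A z) ζ‖ ≤ K / (1 - 1 / 2) := by
    intro z hz ζ hζ
    have := norm_resolvent_add_le (h ζ hζ) (hK ζ hζ) hz (by norm_num)
    rwa [add_sub_cancel] at this
  rw [Complex.analyticAt_iff_eventually_differentiableAt]
  filter_upwards [hgood.eventually_nhds] with z₁ hz₁
  have hm := hz₁.self_of_nhds
  have hc : ∀ z, ‖A z - A z₀‖ * K ≤ 1 / 2 → ContinuousOn (resolvent (A z)) Γ.trace :=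
    fun z hz => continuousOn_resolvent fun ζ hζ => (hres z hz ζ hζ).1
  have h2 := hasDerivAt_integral (Γ := Γ) (f := fun ζ z => resolvent (A z) ζ)
    (f' := fun ζ z => resolvent (A z) ζ * deriv A z * resolvent (A z) ζ)
    (M := K / (1 - 1 / 2) * M * (K / (1 - 1 / 2))) hz₁ (fun z hz => hc z hz.2.2)
    (((hc _ hm.2.2).mul continuousOn_const).mul (hc _ hm.2.2)) ?_ ?_
  · exact (h2.differentiableAt.const_smul (2 * Real.pi * Complex.I : ℂ)⁻¹)
  · intro ζ hζ z hz
    have h3 := (hres z hz.2.2 ζ hζ).2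
    refine (norm_mul_le _ _).trans (mul_le_mul ((norm_mul_le _ _).trans ?_) h3 (norm_nonneg _) ?_)
    · exact mul_le_mul h3 hz.2.1 (norm_nonneg _) ((norm_nonneg _).trans h3)
    · exact mul_nonneg ((norm_nonneg _).trans h3) ((norm_nonneg _).trans hz.2.1)
  · intro ζ hζ z hz
    exact hasDerivAt_resolvent_comp hz.1.hasDerivAt (hres z hz.2.2 ζ hζ).1

end Contour

/-- A compact operator has a Riesz projection of finite rank when the contour does not enclose `0`. -/
lemma Contour.finiteDimensional_range_riesz {H : Type*} [NormedAddCommGroup H] [NormedSpace ℂ H]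
    [CompleteSpace H] {A : H →L[ℂ] H} (hA : IsCompactOperator A)
    (h : ∀ ζ ∈ Γ.trace, ζ ∈ resolventSet ℂ A) (h0 : (0 : ℂ) ∈ Γ.outside) :
    FiniteDimensional ℂ (Γ.riesz A).range := by
  -- With winding number zero at `0` this reads `A Q(0) = P`, so `P` is compact. A compact operator
  -- that is the identity on its closed range has finite rank.
  have h1 := sub_mul_rieszTransform h h0.1
  rw [h0.2, map_zero, zero_smul, zero_sub, zero_sub, neg_mul, neg_inj] at h1
  have hP := riesz_mul_self h
  set P := Γ.riesz A
  have hcpt : IsCompactOperator P := by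
    rw [← h1]
    exact hA.comp_clm (Γ.rieszTransform A 0)
  have hPr : ∀ x ∈ P.range, P x = x := by
    rintro x ⟨y, rfl⟩
    exact DFunLike.congr_fun hP y
  have hker : (P.range : Set H) = {x | P x - x = 0} := by
    ext x
    exact ⟨fun hx => by simp [hPr x hx], fun hx => ⟨x, sub_eq_zero.1 hx⟩⟩
  have hcl : IsClosed (P.range : Set H) := by
    rw [hker]
    exact isClosed_eq (by fun_prop) continuous_const
  have h2 : IsCompactOperator (P.toLinearMap.restrict (p := P.range) (q := P.range)
      fun x _ => ⟨x, rfl⟩) :=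
    hcpt.restrict (f := P.toLinearMap) _ hcl
  refine FiniteDimensional.of_isCompactOperator_id (𝕜 := ℂ) ?_
  have h3 : (id : P.range → P.range) = P.toLinearMap.restrict (p := P.range) (q := P.range)
      (fun x _ => ⟨x, rfl⟩) := funext fun x => Subtype.ext (hPr x x.2).symm
  rw [h3]
  exact h2

end ResolventPerturbation
-- A functional that kills `S` but not `D p` would give a nonzero polynomial in `s` with infinitely
-- many roots. With `S` the operators of finite rank, this separates the contributions of
-- compositions of different lengths.
lemma mem_of_forall_sum_pow_smul_mem {V : Type*} [AddCommGroup V] [Module ℂ V]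
    {S : Submodule ℂ V} {D : ℕ → V} {n : ℕ}
    (h : ∀ s ∈ Ioc (0 : ℝ) 1, ∑ p ∈ Finset.range n, (s : ℂ) ^ p • D p ∈ S) {p : ℕ}
    (hp : p < n) : D p ∈ S := by
  by_contra hD
  obtain ⟨f, hf, hS⟩ := Submodule.exists_le_ker_of_notMem hD
  let Q : Polynomial ℂ := ∑ i ∈ Finset.range n, Polynomial.monomial i (f (D i))
  have hQ : Q = 0 := by
    refine Polynomial.eq_zero_of_infinite_isRoot Q ?_
    refine Set.Infinite.mono (s := (fun s : ℝ => (s : ℂ)) '' Ioc 0 1) ?_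
      ((Ioc_infinite zero_lt_one).image Complex.ofReal_injective.injOn)
    rintro _ ⟨s, hs, rfl⟩
    have h1 := hS (h s hs)
    rw [LinearMap.mem_ker, map_sum] at h1
    simp only [map_smul, smul_eq_mul] at h1
    change Polynomial.eval (s : ℂ) Q = 0
    rw [Polynomial.eval_finsetSum]
    simpa [mul_comm] using h1
  have h2 : Q.coeff p = f (D p) := by
    simp [Q, Polynomial.coeff_monomial, hp]
  rw [hQ, Polynomial.coeff_zero] at h2
  exact hf h2.symm

/-! ### The Neumann series as a sum over compositions. -/

section Geometric

variable {𝔄 : Type*} [NormedRing 𝔄] [NormedAlgebra ℂ 𝔄] [CompleteSpace 𝔄]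

omit [CompleteSpace 𝔄] in
lemma list_prod_map_smul {ι : Type*} (l : List ι) (s : ℂ) (x : ι → 𝔄) :
    (l.map fun i => s • x i).prod = s ^ l.length • (l.map x).prod := by
  induction l with
  | nil => simp
  | cons a l ih => simp [ih, smul_smul, pow_succ, mul_comm]

/-- The Taylor coefficients of `(1 - x(z))⁻¹` for `x(0) = 0`. -/
lemma HasTaylor.inverse_one_sub {x : ℂ → 𝔄} {c : ℕ → 𝔄} (hx : HasTaylor x c) (h0 : x 0 = 0) :
    HasTaylor (fun z => Ring.inverse (1 - x z))
      fun k => ∑ l : Composition k, (l.blocks.map c).prod := by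
  have h1 := (hasFPowerSeriesOnBall_inverse_one_sub ℂ 𝔄).hasFPowerSeriesAt
  rw [← h0] at h1
  -- Composition of power series is indexed by compositions of `k`, and each coefficient of the
  -- geometric series is plain multiplication of the blocks.
  have h2 := h1.comp (hasTaylor_iff_hasFPowerSeriesAt.1 hx)
  have h3 := HasFPowerSeriesAt.hasTaylor h2
  suffices h4 : ((formalMultilinearSeries_geometric ℂ 𝔄).comp (seriesOf c)).coeff =
      fun k => ∑ l : Composition k, (l.blocks.map c).prod from h4 ▸ h3
  funext k
  change (∑ l : Composition k, (formalMultilinearSeries_geometric ℂ 𝔄).compAlongComposition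
    (seriesOf c) l) 1 = _
  rw [_root_.sum_apply]
  refine Finset.sum_congr rfl fun l _ => ?_
  rw [FormalMultilinearSeries.compAlongComposition_apply, formalMultilinearSeries_geometric,
    ContinuousMultilinearMap.mkPiAlgebraFin_apply]
  rw [← Composition.ofFn_blocksFun, List.map_ofFn]
  congr 2
  funext i
  simp only [Function.comp_apply, FormalMultilinearSeries.applyComposition, seriesOf,
    ContinuousMultilinearMap.mkPiRing_apply]
  simp

variable {Γ : Contour} {a : 𝔄} {δ : ℂ → 𝔄} {c : ℕ → 𝔄} {s : ℂ}

/-- With `r` the resolvent of `a`, the function is `∑ s^(p-1) (δ r)^p` over `p ≥ 1`, and expanding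
`δ` splits the `p`-th power over the compositions with `p` blocks. The exponent `p - 1`, due to the
extra factor `δ`, becomes the weight `1/p` after integration in `s`. -/
lemma hasTaylor_mul_resolvent {ζ : ℂ} (hζ : ζ ∈ resolventSet ℂ a) (hδ : HasTaylor δ c)
    (h0 : δ 0 = 0) (hs : s ≠ 0) :
    HasTaylor (fun z => δ z * resolvent (a + s • δ z) ζ) fun k => if k = 0 then 0 else
      ∑ l : Composition k, s ^ (l.length - 1) •
        (l.blocks.map fun i => c i * resolvent a ζ).prod := by
  set r := resolvent a ζ
  have hy : HasTaylor (fun z => s • (δ z * r)) fun k => s • (c k * r) := by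
    filter_upwards [hδ] with z hz
    have := (hz.mul_right r).const_smul s
    simpa only [smul_mul_assoc, smul_comm s] using this
  have hg := hy.inverse_one_sub (by simp [h0])
  have hsmall : ∀ᶠ z in 𝓝 (0 : ℂ), ‖s • (δ z * r)‖ < 1 := by
    refine hy.analyticAt.continuousAt.norm.eventually_lt_const ?_
    simp [h0]
  filter_upwards [hg, hsmall] with z hz hlt
  have hone : HasSum (fun k : ℕ => z ^ k • (if k = 0 then (1 : 𝔄) else 0)) 1 := by
    have := hasSum_single (f := fun k : ℕ => z ^ k • (if k = 0 then (1 : 𝔄) else 0)) 0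
      (fun k hk => by simp [hk])
    simpa using this
  have h1 := (hz.sub hone).const_smul s⁻¹
  have h2 : δ z * resolvent (a + s • δ z) ζ = s⁻¹ • (Ring.inverse (1 - s • (δ z * r)) - 1) := by
    have hlt' : ‖s • δ z * r‖ < 1 := by rwa [smul_mul_assoc]
    have hu : IsUnit (1 - s • (δ z * r)) := (Units.oneSub _ hlt).isUnit
    have h3 := Ring.mul_inverse_cancel _ hu
    rw [sub_mul, one_mul, sub_eq_iff_eq_add] at h3
    rw [(resolvent_add hζ hlt').2, eq_inv_smul_iff₀ hs, ← mul_assoc, ← smul_mul_assoc,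
      smul_mul_assoc s (δ z) r]
    exact (sub_eq_iff_eq_add'.2 h3).symm
  rw [h2]
  convert h1 using 2 with k
  rw [← smul_sub, smul_comm s⁻¹]
  congr 1
  -- At `k = 0` the empty composition contributes exactly the `1` being subtracted. For `k > 0`
  -- every composition has a block, so `l.length - 1` is a true difference.
  rcases Nat.eq_zero_or_pos k with rfl | hk
  · have : Subsingleton (Composition 0) :=
      Fintype.card_le_one_iff_subsingleton.1 (by rw [composition_card]; rfl)
    rw [if_pos rfl, if_pos rfl, Fintype.sum_subsingleton _ (Composition.ones 0)]
    simp
  · rw [if_neg hk.ne', if_neg hk.ne', sub_zero, Finset.smul_sum]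
    refine Finset.sum_congr rfl fun l _ => ?_
    rw [list_prod_map_smul, smul_smul]
    congr 1
    have hl : l.blocks.length = (l.length - 1) + 1 :=
      (Nat.sub_add_cancel (l.length_pos_of_pos hk)).symm
    rw [hl, pow_succ', inv_mul_cancel_left₀ hs]

/-- The Taylor expansion of `δ(z) P(a + s δ(z))`, with `P` the Riesz integral. -/
lemma hasTaylor_mul_riesz {ε K : ℝ} (ha : ∀ ζ ∈ Γ.trace, ζ ∈ resolventSet ℂ a)
    (hδ : HasTaylor δ c) (h0 : δ 0 = 0) (hs : s ≠ 0) (hs2 : ‖s‖ ≤ 2) (hε : 0 < ε)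
    (hd : DifferentiableOn ℂ δ (Metric.ball 0 ε)) (hK0 : 0 < K)
    (hK : ∀ ζ ∈ Γ.trace, ‖resolvent a ζ‖ ≤ K)
    (hsmall : ∀ z ∈ Metric.ball (0 : ℂ) ε, ‖δ z‖ * K ≤ 1 / 4) :
    HasTaylor (fun z => δ z * Γ.riesz (a + s • δ z)) fun k => if k = 0 then 0 else
      (2 * Real.pi * Complex.I : ℂ)⁻¹ • ∑ l : Composition k, s ^ (l.length - 1) •
        Γ.integral fun ζ => (l.blocks.map fun i => c i * resolvent a ζ).prod := by
  have hcr := Contour.continuousOn_resolvent ha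
  have hword : ∀ l : List ℕ,
      ContinuousOn (fun ζ => (l.map fun i => c i * resolvent a ζ).prod) Γ.trace := fun l =>
    continuousOn_list_prod l fun i _ => continuousOn_const.mul hcr
  set e : ℕ → ℂ → 𝔄 := fun k ζ => if k = 0 then 0 else
      ∑ l : Composition k, s ^ (l.length - 1) •
        (l.blocks.map fun i => c i * resolvent a ζ).prod with he
  have hec : ∀ k, ContinuousOn (e k) Γ.trace := by
    intro k
    simp only [he]
    by_cases hk : k = 0
    · simp only [if_pos hk]
      exact continuousOn_const
    · simp only [if_neg hk]
      exact continuousOn_finsetSum _ fun l _ => (hword l.blocks).const_smul _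
  -- `‖s‖ ≤ 2` and `‖δ‖ K ≤ 1/4` give Neumann ratio `1/2`, hence the resolvent bound `2K`.
  have hres : ∀ z ∈ Metric.ball (0 : ℂ) ε, ∀ ζ ∈ Γ.trace,
      ζ ∈ resolventSet ℂ (a + s • δ z) ∧ ‖resolvent (a + s • δ z) ζ‖ ≤ K / (1 - 1 / 2) := by
    intro z hz ζ hζ
    refine norm_resolvent_add_le (ha ζ hζ) (hK ζ hζ) ?_ (by norm_num)
    rw [norm_smul, mul_assoc]
    have := hsmall z hz
    have h3 : 0 ≤ ‖δ z‖ * K := by positivity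
    nlinarith
  have hFt : ∀ ζ ∈ Γ.trace, HasTaylor (fun z => δ z * resolvent (a + s • δ z) ζ) (e · ζ) :=
    fun ζ hζ => hasTaylor_mul_resolvent (ha ζ hζ) hδ h0 hs
  have hFd : ∀ ζ ∈ Γ.trace,
      DifferentiableOn ℂ (fun z => δ z * resolvent (a + s • δ z) ζ) (Metric.ball 0 ε) := by
    intro ζ hζ z hz
    have hdz : DifferentiableAt ℂ δ z := (hd z hz).differentiableAt (Metric.isOpen_ball.mem_nhds hz)
    have h1 : HasDerivAt (fun z => a + s • δ z) (s • deriv δ z) z :=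
      (hdz.hasDerivAt.const_smul s).const_add a
    exact (hdz.mul (hasDerivAt_resolvent_comp h1
      (hres z hz ζ hζ).1).differentiableAt).differentiableWithinAt
  have hFM : ∀ ζ ∈ Γ.trace, ∀ z ∈ Metric.ball (0 : ℂ) ε,
      ‖δ z * resolvent (a + s • δ z) ζ‖ ≤ 1 / 2 := by
    intro ζ hζ z hz
    refine (norm_mul_le _ _).trans ?_
    have h1 := (hres z hz ζ hζ).2
    have h2 := hsmall z hz
    calc ‖δ z‖ * ‖resolvent (a + s • δ z) ζ‖ ≤ ‖δ z‖ * (K / (1 - 1 / 2)) := by gcongr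
      _ = (‖δ z‖ * K) * 2 := by ring
      _ ≤ 1 / 2 := by linarith
  have hball : ∀ᶠ z in 𝓝 (0 : ℂ), z ∈ Metric.ball (0 : ℂ) (ε / 2) :=
    Metric.ball_mem_nhds 0 (by positivity)
  filter_upwards [hball] with z hz
  have hzε : z ∈ Metric.ball (0 : ℂ) ε := Metric.ball_subset_ball (by linarith) hz
  rw [mem_ball_zero_iff] at hz
  -- Cauchy's estimate at radius `ε/2` is uniform in `ζ`, which justifies integrating the series
  -- term by term for `‖z‖ < ε/2`.
  have hsum := Contour.hasSum_integral (Γ := Γ) (f := fun k ζ => z ^ k • e k ζ)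
    (g := fun ζ => δ z * resolvent (a + s • δ z) ζ)
    (b := fun k => 1 / 2 * (‖z‖ * (ε / 2)⁻¹) ^ k) (fun k => (hec k).const_smul _) ?_ ?_
    (fun ζ hζ => (hFt ζ hζ).hasSum (hFd ζ hζ) hzε)
  · have h1 := hsum.const_smul (2 * Real.pi * Complex.I : ℂ)⁻¹
    have h2 : (2 * Real.pi * Complex.I : ℂ)⁻¹ •
        Γ.integral (fun ζ => δ z * resolvent (a + s • δ z) ζ) = δ z * Γ.riesz (a + s • δ z) := by
      rw [Contour.riesz, mul_smul_comm]
      congr 1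
      exact Contour.integral_clm (ContinuousLinearMap.mul ℂ 𝔄 (δ z))
        (Contour.continuousOn_resolvent fun ζ hζ => (hres z hzε ζ hζ).1)
    rw [h2] at h1
    convert h1 using 2 with k
    rw [Contour.integral_smul]
    split_ifs with hk
    · simp [he, hk, Contour.integral, contourIntegral]
    · rw [smul_comm (z ^ k)]
      congr 2
      simp only [he, if_neg hk]
      rw [Contour.integral_finset_sum _ fun l _ => (hword l.blocks).const_smul _]
      simp only [Contour.integral_smul]
  · intro k ζ hζ
    rw [norm_smul, norm_pow, mul_pow]
    have := (hFt ζ hζ).norm_coeff_le (hFd ζ hζ) (hFM ζ hζ) (half_pos hε) (by linarith) k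
    calc ‖z‖ ^ k * ‖e k ζ‖ ≤ ‖z‖ ^ k * (1 / 2 * (ε / 2)⁻¹ ^ k) := by gcongr
      _ = _ := by ring
  · refine (summable_geometric_of_lt_one (by positivity) ?_).mul_left _
    rw [← div_eq_mul_inv, div_lt_one (by positivity)]
    exact hz

end Geometric

/-! ### Expansion of the trace by integration along the segment to the perturbed operator. -/

section TraceExpansion

variable {H : Type} [NormedAddCommGroup H] [InnerProductSpace ℂ H] [CompleteSpace H] {Γ : Contour}

/-- The rank of an analytic family of projections of finite rank on a disc is constant. -/
lemma finrank_eq_of_analyticOnNhd {P : ℂ → H →L[ℂ] H} {ε : ℝ}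
    (hP : AnalyticOnNhd ℂ P (Metric.ball 0 ε)) (hidem : ∀ z ∈ Metric.ball (0 : ℂ) ε, P z * P z = P z)
    (hfin : ∀ z ∈ Metric.ball (0 : ℂ) ε, FiniteDimensional ℂ (P z).range) {z : ℂ}
    (hz : z ∈ Metric.ball (0 : ℂ) ε) :
    Module.finrank ℂ (P z).range = Module.finrank ℂ (P 0).range := by
  have hε : 0 < ε := dist_nonneg.trans_lt (Metric.mem_ball.1 hz)
  refine (convex_ball (0 : ℂ) ε).isPreconnected.constant
    (f := fun z => Module.finrank ℂ (P z).range) ?_ hz (Metric.mem_ball_self hε)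
  intro w hw
  refine ContinuousAt.continuousWithinAt ?_
  have h1 : ∀ᶠ z in 𝓝 w, P z * P z = P z := by
    filter_upwards [Metric.isOpen_ball.mem_nhds hw] with z hz using hidem z hz
  have h2 := eventually_finrank_eq (hP w hw) h1 (hfin w hw)
  exact continuousAt_const.congr (h2.mono fun z hz => hz.symm)

/-- The coefficients in the expansion of the trace of `A(z) P(z)`. -/
noncomputable def traceCoeff (Γ : Contour) (a : H →L[ℂ] H) (c : ℕ → H →L[ℂ] H) (k : ℕ) :
    H →L[ℂ] H :=
  (2 * Real.pi * Complex.I : ℂ)⁻¹ • ∑ l : Composition k, (l.length : ℂ)⁻¹ •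
    Γ.integral fun ζ => (l.blocks.map fun i => c i * resolvent a ζ).prod

/-- The expansion of the trace of `A(z) P(z)`, where `P(z)` is the Riesz projection of the analytic
family `A(z) = a + δ(z)` of compact operators. -/
theorem hasTaylor_trace_mul_riesz {a : H →L[ℂ] H} {δ : ℂ → H →L[ℂ] H} {c : ℕ → H →L[ℂ] H}
    (ha : ∀ ζ ∈ Γ.trace, ζ ∈ resolventSet ℂ a) (hout : (0 : ℂ) ∈ Γ.outside)
    (hac : IsCompactOperator a) (hδc : ∀ᶠ z in 𝓝 (0 : ℂ), IsCompactOperator (δ z))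
    (hδ : HasTaylor δ c) (h0 : δ 0 = 0) :
    HasTaylor (fun z => finiteRankTrace ((a + δ z) * Γ.riesz (a + δ z)).toLinearMap)
      fun k => if k = 0 then finiteRankTrace (a * Γ.riesz a).toLinearMap else
        finiteRankTrace (traceCoeff Γ a c k).toLinearMap := by
  obtain ⟨K, hK0, hK⟩ := Contour.exists_norm_resolvent_le ha
  -- a disc on which the perturbation is small
  have hsm : ∀ᶠ z in 𝓝 (0 : ℂ), ‖δ z‖ * K < 1 / 4 := by
    have h1 : ContinuousAt (fun z => ‖δ z‖ * K) 0 :=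
      hδ.analyticAt.continuousAt.norm.mul continuousAt_const
    refine h1.eventually_lt_const ?_
    simp [h0]
  obtain ⟨ε, hε, hball⟩ := Metric.eventually_nhds_iff_ball.1
    (hsm.and (hδc.and hδ.analyticAt.eventually_analyticAt))
  have hsmall : ∀ z ∈ Metric.ball (0 : ℂ) ε, ‖δ z‖ * K ≤ 1 / 4 := fun z hz => (hball z hz).1.le
  have hcpt : ∀ z ∈ Metric.ball (0 : ℂ) ε, IsCompactOperator (δ z) := fun z hz => (hball z hz).2.1
  have hana : ∀ z ∈ Metric.ball (0 : ℂ) ε, AnalyticAt ℂ δ z := fun z hz => (hball z hz).2.2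
  have hd : DifferentiableOn ℂ δ (Metric.ball 0 ε) := fun z hz =>
    (hana z hz).differentiableAt.differentiableWithinAt
  have h0ε : (0 : ℂ) ∈ Metric.ball (0 : ℂ) ε := Metric.mem_ball_self hε
  -- the two-parameter family
  have hres : ∀ z ∈ Metric.ball (0 : ℂ) ε, ∀ s : ℂ, ‖s‖ ≤ 2 → ∀ ζ ∈ Γ.trace,
      ζ ∈ resolventSet ℂ (a + s • δ z) ∧ ‖resolvent (a + s • δ z) ζ‖ ≤ K / (1 - 1 / 2) := by
    intro z hz s hs ζ hζ
    refine norm_resolvent_add_le (ha ζ hζ) (hK ζ hζ) ?_ (by norm_num)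
    rw [norm_smul, mul_assoc]
    have := hsmall z hz
    have h3 : 0 ≤ ‖δ z‖ * K := by positivity
    nlinarith
  let P : ℂ → ℂ → H →L[ℂ] H := fun s z => Γ.riesz (a + s • δ z)
  have hPz : ∀ s : ℂ, ‖s‖ ≤ 2 → AnalyticOnNhd ℂ (P s) (Metric.ball 0 ε) := fun s hs z hz =>
    Contour.analyticAt_riesz (analyticAt_const.add (analyticAt_const.fun_smul (hana z hz)))
      fun ζ hζ => (hres z hz s hs ζ hζ).1
  have hPs : ∀ z ∈ Metric.ball (0 : ℂ) ε, ∀ s : ℂ, ‖s‖ ≤ 2 → AnalyticAt ℂ (fun s => P s z) s :=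
    fun z hz s hs => Contour.analyticAt_riesz (analyticAt_const.add
      (analyticAt_id.fun_smul analyticAt_const)) fun ζ hζ => (hres z hz s hs ζ hζ).1
  have hidem : ∀ s : ℂ, ‖s‖ ≤ 2 → ∀ z ∈ Metric.ball (0 : ℂ) ε, P s z * P s z = P s z :=
    fun s hs z hz => Contour.riesz_mul_self fun ζ hζ => (hres z hz s hs ζ hζ).1
  have hfin : ∀ s : ℂ, ‖s‖ ≤ 2 → ∀ z ∈ Metric.ball (0 : ℂ) ε,
      FiniteDimensional ℂ (P s z).range := fun s hs z hz =>
    Contour.finiteDimensional_range_riesz (hac.add ((hcpt z hz).smul s))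
      (fun ζ hζ => (hres z hz s hs ζ hζ).1) hout
  have hP0 : ∀ s, P s 0 = Γ.riesz a := fun s => by simp [P, h0]
  -- the `s`-derivative of the trace
  let g : ℂ → ℂ → ℂ := fun s z => finiteRankTrace (δ z * P s z).toLinearMap
  have hgz : ∀ s : ℂ, ‖s‖ ≤ 2 → DifferentiableOn ℂ (g s) (Metric.ball 0 ε) := by
    intro s hs z hz
    refine (analyticAt_trace_mul (hana z hz) (hPz s hs z hz) ?_
      (hfin s hs z hz)).differentiableAt.differentiableWithinAt
    filter_upwards [Metric.isOpen_ball.mem_nhds hz] with w hw using hidem s hs w hw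
  -- The segment `[0, 1]` is interior to the disc of radius `2`, so complex derivatives in `s` exist
  -- up to its endpoints.
  have hnear : ∀ s : ℂ, ‖s‖ < 2 → ∀ᶠ t in 𝓝 s, ‖t‖ ≤ 2 := fun s hs =>
    (continuous_norm.continuousAt.eventually_lt_const hs).mono fun _ => le_of_lt
  have hgs : ∀ z ∈ Metric.ball (0 : ℂ) ε, ∀ s : ℂ, ‖s‖ < 2 → ContinuousAt (fun s => g s z) s := by
    intro z hz s hs
    refine (analyticAt_trace_mul analyticAt_const (hPs z hz s hs.le) ?_
      (hfin s hs.le z hz)).continuousAt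
    filter_upwards [hnear s hs] with t ht using hidem t ht z hz
  have hderiv : ∀ z ∈ Metric.ball (0 : ℂ) ε, ∀ s : ℂ, ‖s‖ < 2 →
      HasDerivAt (fun s => finiteRankTrace ((a + s • δ z) * P s z).toLinearMap) (g s z) s := by
    intro z hz s hs
    refine hasDerivAt_trace_mul (A := fun s => a + s • δ z) ?_ (hPs z hz s hs.le) ?_ ?_
      (hfin s hs.le z hz)
    · simpa using ((hasDerivAt_id s).smul_const (δ z)).const_add a
    · filter_upwards [hnear s hs] with t ht using hidem t ht z hz
    · filter_upwards [hnear s hs] with t ht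
      exact Contour.commute_riesz (fun ζ hζ => (hres z hz t ht ζ hζ).1) (Commute.refl _)
  have hs1 : ∀ s ∈ Icc (0 : ℝ) 1, ‖(s : ℂ)‖ < 2 := fun s hs => by
    rw [Complex.norm_real, Real.norm_of_nonneg hs.1]
    linarith [hs.2]
  -- The Feynman–Hellmann formula integrated from `a` to `a + δ(z)`.
  have hint : ∀ z ∈ Metric.ball (0 : ℂ) ε,
      ∫ s in (0 : ℝ)..1, g s z = finiteRankTrace ((a + δ z) * Γ.riesz (a + δ z)).toLinearMap -
        finiteRankTrace (a * Γ.riesz a).toLinearMap := by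
    intro z hz
    have h1 := intervalIntegral.integral_eq_sub_of_hasDerivAt (a := 0) (b := 1)
      (f := fun s : ℝ => finiteRankTrace ((a + (s : ℂ) • δ z) * P s z).toLinearMap)
      (f' := fun s : ℝ => g s z) ?_ ?_
    · simpa [P] using h1
    · intro s hs
      rw [uIcc_of_le zero_le_one] at hs
      exact (hderiv z hz s (hs1 s hs)).comp_ofReal
    · refine ContinuousOn.intervalIntegrable fun s hs => ?_
      rw [uIcc_of_le zero_le_one] at hs
      exact ((hgs z hz s (hs1 s hs)).comp Complex.continuous_ofReal.continuousAt).continuousWithinAt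
  -- a uniform bound
  set m := Module.finrank ℂ (Γ.riesz a).range
  set C := (2 * Real.pi)⁻¹ * (Γ.speed * (K / (1 - 1 / 2)))
  have hgM : ∀ s : ℂ, ‖s‖ ≤ 2 → ∀ z ∈ Metric.ball (0 : ℂ) ε,
      ‖g s z‖ ≤ m * ((1 / 4) / K * C) := by
    intro s hs z hz
    have hfz := hfin s hs z hz
    -- The disc is connected and `P s 0` does not depend on `s`, so every `P s z` has rank `m`.
    have hle : Module.finrank ℂ (δ z * P s z).range ≤ m := by
      have h1 : Module.finrank ℂ (P s z).range = m := by
        rw [finrank_eq_of_analyticOnNhd (hPz s hs) (hidem s hs) (hfin s hs) hz, hP0]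
      rw [← h1]
      have h2 : (δ z * P s z).range = (P s z).range.map (δ z).toLinearMap :=
        LinearMap.range_comp _ _
      rw [h2]
      exact Submodule.finrank_map_le _ _
    have hmem : (δ z * P s z).toLinearMap ∈ finiteRank H := by
      have h2 : (δ z * P s z).toLinearMap.range = (P s z).range.map (δ z).toLinearMap :=
        LinearMap.range_comp _ _
      rw [mem_finiteRank, h2]
      infer_instance
    refine (norm_finiteRankTrace_le hmem).trans ?_
    have h3 : ‖δ z‖ ≤ (1 / 4) / K := (le_div_iff₀ hK0).2 (hsmall z hz)
    have h4 : ‖P s z‖ ≤ C := Contour.norm_riesz_le fun ζ hζ => (hres z hz s hs ζ hζ).2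
    have h5 : ‖δ z * P s z‖ ≤ (1 / 4) / K * C :=
      (norm_mul_le _ _).trans (mul_le_mul h3 h4 (norm_nonneg _) (by positivity))
    exact mul_le_mul (by exact_mod_cast hle) h5 (norm_nonneg _) (by positivity)
  -- the Taylor coefficients in `z`
  let D : ℕ → ℕ → H →L[ℂ] H := fun k p => (2 * Real.pi * Complex.I : ℂ)⁻¹ •
    ∑ l : Composition k with l.length = p + 1,
      Γ.integral fun ζ => (l.blocks.map fun i => c i * resolvent a ζ).prod
  -- Compositions are grouped by the power `p = length - 1` of `s` that they carry; `f p = s^p` and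
  -- `f p = 1/(p+1)` are the two uses.
  have hgroup : ∀ (k : ℕ), k ≠ 0 → ∀ f : ℕ → ℂ,
      (2 * Real.pi * Complex.I : ℂ)⁻¹ • ∑ l : Composition k, f (l.length - 1) •
        Γ.integral (fun ζ => (l.blocks.map fun i => c i * resolvent a ζ).prod)
        = ∑ p ∈ Finset.range k, f p • D k p := by
    intro k hk f
    have hmaps : ∀ l ∈ (Finset.univ : Finset (Composition k)), l.length - 1 ∈ Finset.range k := by
      intro l _
      have h1 := l.length_pos_of_pos (Nat.pos_of_ne_zero hk)
      have h2 := l.length_le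
      rw [Finset.mem_range]
      omega
    rw [← Finset.sum_fiberwise_of_maps_to (f := fun l : Composition k => f (l.length - 1) •
        Γ.integral (fun ζ => (l.blocks.map fun i => c i * resolvent a ζ).prod)) hmaps,
      Finset.smul_sum]
    refine Finset.sum_congr rfl fun p hp => ?_
    simp only [D, Finset.smul_sum]
    refine Finset.sum_congr ?_ fun l hl => ?_
    · ext l
      have := l.length_pos_of_pos (Nat.pos_of_ne_zero hk)
      simp only [Finset.mem_filter, Finset.mem_univ, true_and]
      omega
    · have : l.length - 1 = p := by
        have := (Finset.mem_filter.1 hl).2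
        omega
      rw [this, smul_comm]
  let κ : ℂ → ℕ → H →L[ℂ] H := fun s k => if k = 0 then 0 else ∑ p ∈ Finset.range k, s ^ p • D k p
  have hκ : ∀ s ∈ Ioc (0 : ℝ) 1, HasTaylor (fun z => δ z * P s z) (κ s) := by
    intro s hs
    have hs0 : (s : ℂ) ≠ 0 := Complex.ofReal_ne_zero.2 hs.1.ne'
    have h1 := hasTaylor_mul_riesz (Γ := Γ) ha hδ h0 hs0 (hs1 s (Ioc_subset_Icc_self hs)).le hε hd
      hK0 hK hsmall
    have h2 : κ s = fun k => if k = 0 then 0 else (2 * Real.pi * Complex.I : ℂ)⁻¹ •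
        ∑ l : Composition k, (s : ℂ) ^ (l.length - 1) • Γ.integral fun ζ =>
          (l.blocks.map fun i => c i * resolvent a ζ).prod := by
      funext k
      simp only [κ]
      split_ifs with hk
      · rfl
      · exact (hgroup k hk fun p => (s : ℂ) ^ p).symm
    rw [h2]
    exact h1
  have hκmem : ∀ s ∈ Ioc (0 : ℝ) 1, ∀ k, (κ s k).toLinearMap ∈ finiteRank H ∧
      HasTaylor (g s) fun k => finiteRankTrace (κ s k).toLinearMap := by
    intro s hs k
    have hs2 := (hs1 s (Ioc_subset_Icc_self hs)).le
    -- The projections factor analytically through the range of `P s 0`, so the trace may be taken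
    -- coefficient by coefficient.
    have hgerm : IsFiniteRankGerm fun z => δ z * P s z := by
      refine IsFiniteRankGerm.mul_left hδ.analyticAt (isFiniteRankGerm_of_idem (hPz s hs2 0 h0ε) ?_
        (hfin s hs2 0 h0ε))
      filter_upwards [Metric.isOpen_ball.mem_nhds h0ε] with z hz using hidem s hs2 z hz
    obtain ⟨q, hq⟩ := hgerm.analyticAt_trace
    have h1 := fun k => hgerm.coeff (hasTaylor_iff_hasFPowerSeriesAt.1 (hκ s hs)) hq k
    simp only [seriesOf_coeff] at h1
    refine ⟨(h1 k).1, ?_⟩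
    have h2 : (fun k => finiteRankTrace (κ s k).toLinearMap) = q.coeff := funext fun k => (h1 k).2
    rw [h2]
    exact HasFPowerSeriesAt.hasTaylor hq
  have hDmem : ∀ k p, p < k → (D k p).toLinearMap ∈ finiteRank H := by
    intro k p hp
    -- Only the sum over `p` is known to have finite rank, but for every `s` in `(0, 1]`, and that
    -- suffices for each term.
    refine mem_of_forall_sum_pow_smul_mem (D := fun p => (D k p).toLinearMap) (n := k) ?_ hp
    intro s hs
    have := (hκmem s hs k).1
    simp only [κ, if_neg (Nat.ne_zero_of_lt hp)] at this
    simpa using this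
  have htr : ∀ (k : ℕ) (f : ℕ → ℂ),
      finiteRankTrace (∑ p ∈ Finset.range k, f p • D k p).toLinearMap
        = ∑ p ∈ Finset.range k, f p * finiteRankTrace (D k p).toLinearMap := by
    intro k f
    have h1 : (∑ p ∈ Finset.range k, f p • D k p).toLinearMap =
        ∑ p : Fin k, f p • (D k p).toLinearMap := by
      rw [← Fin.sum_univ_eq_sum_range (fun p => f p • D k p)]
      simp
    have h2 : (∑ p : Fin k, f p • (⟨(D k p).toLinearMap, hDmem k p p.2⟩ : finiteRank H) :
        finiteRank H).1 = ∑ p : Fin k, f p • (D k p).toLinearMap := by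
      simp
    rw [h1, ← h2]
    change finiteRankTraceₗ H _ = _
    rw [map_sum, ← Fin.sum_univ_eq_sum_range (fun p => f p * finiteRankTrace (D k p).toLinearMap)]
    refine Finset.sum_congr rfl fun p _ => ?_
    rw [map_smul, smul_eq_mul]
    rfl
  -- integration in `s`
  let γ : ℕ → ℂ → ℂ := fun k s => if k = 0 then 0 else
    ∑ p ∈ Finset.range k, s ^ p * finiteRankTrace (D k p).toLinearMap
  have hγ : ∀ s ∈ Ioc (0 : ℝ) 1, HasTaylor (g s) (γ · s) := by
    intro s hs
    have h1 := (hκmem s hs 0).2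
    have h2 : (fun k => finiteRankTrace (κ s k).toLinearMap) = (γ · (s : ℂ)) := by
      funext k
      simp only [κ, γ]
      split_ifs with hk
      · have := (hκmem s hs 0).1
        have h3 := finiteRankTrace_smul (0 : ℂ) (zero_mem (finiteRank H))
        simpa using h3
      · exact htr k fun p => (s : ℂ) ^ p
    rw [← h2]
    exact h1
  have hγc : ∀ k, Continuous fun s : ℝ => γ k s := by
    intro k
    simp only [γ]
    by_cases hk : k = 0
    · simp only [if_pos hk]
      exact continuous_const
    · simp only [if_neg hk]
      fun_prop
  -- The integral of `s^p` is `1/(p+1)`, the reciprocal of the length of the composition.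
  have hγint : ∀ k, k ≠ 0 → ∫ s in (0 : ℝ)..1, γ k s
      = finiteRankTrace (traceCoeff Γ a c k).toLinearMap := by
    intro k hk
    have h1 : traceCoeff Γ a c k = ∑ p ∈ Finset.range k, ((p : ℂ) + 1)⁻¹ • D k p := by
      rw [← hgroup k hk, traceCoeff]
      congr 1
      refine Finset.sum_congr rfl fun l _ => ?_
      congr 2
      have h1 := l.length_pos_of_pos (Nat.pos_of_ne_zero hk)
      have h2 : l.length = (l.length - 1) + 1 := by omega
      exact_mod_cast h2
    rw [h1, htr]
    simp only [γ, if_neg hk]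
    rw [intervalIntegral.integral_finsetSum]
    · refine Finset.sum_congr rfl fun p _ => ?_
      rw [intervalIntegral.integral_mul_const]
      congr 1
      have h3 : ∫ s in (0 : ℝ)..1, (s : ℂ) ^ p = ((∫ s in (0 : ℝ)..1, s ^ p : ℝ) : ℂ) := by
        rw [← intervalIntegral.integral_ofReal]
        simp
      rw [h3, integral_pow]
      simp
    · intro p _
      exact Continuous.intervalIntegrable (by fun_prop) _ _
  have hball2 : ∀ᶠ z in 𝓝 (0 : ℂ), z ∈ Metric.ball (0 : ℂ) (ε / 2) :=
    Metric.ball_mem_nhds 0 (by positivity)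
  filter_upwards [hball2] with z hz
  have hzε : z ∈ Metric.ball (0 : ℂ) ε := Metric.ball_subset_ball (by linarith) hz
  rw [mem_ball_zero_iff] at hz
  set M := (m : ℝ) * ((1 / 4) / K * C)
  -- The integrand is needed only on `(0, 1]`, so the excluded value `s = 0` does no harm.
  have hsum := intervalIntegral.hasSum_integral_of_dominated_convergence (a := 0) (b := 1)
    (μ := volume) (F := fun (k : ℕ) (s : ℝ) => z ^ k • γ k s) (f := fun s : ℝ => g s z)
    (fun k _ => M * (‖z‖ * (ε / 2)⁻¹) ^ k)
    (fun k => (show Continuous fun s : ℝ => z ^ k • γ k s from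
      (hγc k).const_smul (z ^ k)).aestronglyMeasurable) ?_ ?_ ?_ ?_
  · rw [hint z hzε] at hsum
    have h1 : HasSum (fun k : ℕ => z ^ k •
        (if k = 0 then finiteRankTrace (a * Γ.riesz a).toLinearMap else 0))
        (finiteRankTrace (a * Γ.riesz a).toLinearMap) := by
      have := hasSum_single (f := fun k : ℕ => z ^ k •
        (if k = 0 then finiteRankTrace (a * Γ.riesz a).toLinearMap else 0)) 0
        (fun k hk => by simp [hk])
      simpa using this
    have h2 := hsum.add h1
    rw [sub_add_cancel] at h2
    convert h2 using 2 with k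
    rw [intervalIntegral.integral_smul, ← smul_add]
    congr 1
    split_ifs with hk
    · simp [γ, hk]
    · rw [hγint k hk, add_zero]
  · intro k
    refine Eventually.of_forall fun s hs => ?_
    rw [uIoc_of_le zero_le_one] at hs
    have hs2 := (hs1 s (Ioc_subset_Icc_self hs)).le
    rw [norm_smul, norm_pow, mul_pow]
    have := (hγ s hs).norm_coeff_le (hgz s hs2) (hgM s hs2) (half_pos hε) (by linarith) k
    calc ‖z‖ ^ k * ‖γ k s‖ ≤ ‖z‖ ^ k * (M * (ε / 2)⁻¹ ^ k) := by gcongr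
      _ = _ := by ring
  · refine Eventually.of_forall fun s _ => ?_
    refine (summable_geometric_of_lt_one (by positivity) ?_).mul_left _
    rw [← div_eq_mul_inv, div_lt_one (by positivity)]
    exact hz
  · exact intervalIntegrable_const
  · refine Eventually.of_forall fun s hs => ?_
    rw [uIoc_of_le zero_le_one] at hs
    have hs2 := (hs1 s (Ioc_subset_Icc_self hs)).le
    exact (hγ s hs).hasSum (hgz s hs2) hzε

end TraceExpansion

/-! ### The abstract perturbation theorem for compact analytic families. -/

section Assembly

variable {H : Type} [NormedAddCommGroup H] [InnerProductSpace ℂ H] [CompleteSpace H] {Γ : Contour}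

/-- On a finite-dimensional space, the trace of an operator with a single spectral point `β` is
`β` times the dimension. -/
lemma trace_eq_of_spectrum_eq_singleton {V : Type*} [AddCommGroup V] [Module ℂ V]
    [FiniteDimensional ℂ V] {f : V →ₗ[ℂ] V} {β : ℂ} (h : spectrum ℂ f = {β}) :
    LinearMap.trace ℂ V f = Module.finrank ℂ V * β := by
  have hs : f.charpoly.Splits := IsAlgClosed.splits _
  have h1 : f.charpoly.roots = Multiset.replicate (Module.finrank ℂ V) β := by
    rw [Multiset.eq_replicate]
    refine ⟨?_, fun b hb => ?_⟩
    · rw [← hs.natDegree_eq_card_roots, LinearMap.charpoly_natDegree]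
    · have : b ∈ spectrum ℂ f :=
        (Module.End.mem_spectrum_iff_isRoot_charpoly f b).2 (Polynomial.isRoot_of_mem_roots hb)
      rw [h] at this
      exact this
  have h2 := Module.End.trace_eq_sum_roots_charpoly_of_splits (f := f) hs
  rw [h1, Multiset.sum_replicate, nsmul_eq_mul] at h2
  exact h2

/-- Every operator on the zero space is invertible and has empty spectrum. This makes the
multiplicity `m`, by which the mean is divided, nonzero. -/
lemma finrank_pos_of_spectrum_nonempty {V : Type*} [AddCommGroup V] [Module ℂ V]
    [FiniteDimensional ℂ V] {f : V →ₗ[ℂ] V} (h : (spectrum ℂ f).Nonempty) :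
    Module.finrank ℂ V ≠ 0 := by
  obtain ⟨w, hw⟩ := h
  intro h0
  have := Module.finrank_zero_iff.1 h0
  exact hw (isUnit_of_subsingleton _)

omit [CompleteSpace H] in
/-- The trace of `A P`, where `P` is the spectral projection for a single point of the spectrum. -/
lemma trace_mul_of_isSpectralProjection {A P : H →L[ℂ] H} {β : ℂ}
    (h : IsSpectralProjection A P {β}) (hfin : FiniteDimensional ℂ P.range) :
    finiteRankTrace (A * P).toLinearMap = Module.finrank ℂ P.range * β ∧
      Module.finrank ℂ P.range ≠ 0 := by
  obtain ⟨hA, hs⟩ := h.range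
  refine ⟨?_, finrank_pos_of_spectrum_nonempty (hs ▸ singleton_nonempty β)⟩
  have hW : ∀ x, (A * P).toLinearMap x ∈ P.range := fun x => hA _ ⟨x, rfl⟩
  rw [finiteRankTrace_eq_of_le hW, ← trace_eq_of_spectrum_eq_singleton hs]
  congr 1
  ext ⟨x, y, rfl⟩
  have hP : P (P y) = P y := DFunLike.congr_fun h.idem y
  simp [LinearMap.restrict_apply, hP]

lemma inverse_neg_eq {R : Type*} [Ring R] (x : R) : Ring.inverse (-x) = -Ring.inverse x := by
  by_cases h : IsUnit x
  · obtain ⟨u, rfl⟩ := h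
    rw [← Units.val_neg, Ring.inverse_unit, Ring.inverse_unit, ← Units.val_neg, inv_neg]
  · rw [Ring.inverse_non_unit _ h, Ring.inverse_non_unit _ (by rwa [IsUnit.neg_iff]), neg_zero]

omit [CompleteSpace H] in
lemma inverse_sub_smul_id (A : H →L[ℂ] H) (ζ : ℂ) :
    Ring.inverse (A - ζ • ContinuousLinearMap.id ℂ H) = -resolvent A ζ := by
  rw [resolvent, ← inverse_neg_eq, neg_sub]
  rfl

lemma list_prod_map_neg {ι R : Type*} [Ring R] [Algebra ℂ R] (l : List ι) (f : ι → R) :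
    (l.map fun i => -f i).prod = (-1 : ℂ) ^ l.length • (l.map f).prod := by
  induction l with
  | nil => simp
  | cons i l ih => simp [ih, pow_succ]

lemma hasTaylor_of_analyticAt {E : Type} [NormedAddCommGroup E] [NormedSpace ℂ E] [CompleteSpace E]
    {f : ℂ → E} (h : AnalyticAt ℂ f 0) :
    HasTaylor f fun k => (k.factorial : ℂ)⁻¹ • iteratedDeriv k f 0 := by
  obtain ⟨p, hp⟩ := h
  refine (HasFPowerSeriesAt.hasTaylor hp).mono fun z hz => ?_
  convert hz using 4 with k
  obtain ⟨r, hr⟩ := hp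
  have h1 := hr.factorial_smul 1 k
  simp only
  rw [iteratedDeriv_eq_iteratedFDeriv, ← h1, ← Nat.cast_smul_eq_nsmul ℂ, smul_smul,
    inv_mul_cancel₀ (Nat.cast_ne_zero.2 k.factorial_ne_zero), one_smul]
  rfl

lemma finiteRankTrace_of_range_eq {V : Type*} [AddCommGroup V] [Module ℂ V] {B : V →ₗ[ℂ] V}
    {W : Submodule ℂ V} (h : B.range = W) (h' : ∀ x ∈ W, B x ∈ W) :
    finiteRankTrace B = LinearMap.trace ℂ W (B.restrict h') := by
  subst h
  rfl

/-- A nonzero scalar leaves the range unchanged, so finite rank need not be checked before pulling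
it out. -/
lemma finiteRankTrace_smul_of_ne_zero {V : Type*} [AddCommGroup V] [Module ℂ V] {c : ℂ}
    (hc : c ≠ 0) (B : V →ₗ[ℂ] V) : finiteRankTrace (c • B) = c * finiteRankTrace B := by
  have h : (c • B).range = B.range := LinearMap.range_smul B c hc
  rw [finiteRankTrace_of_range_eq h fun x _ => B.range.smul_mem c ⟨x, rfl⟩,
    finiteRankTrace_of_range_eq rfl fun x _ => ⟨x, rfl⟩, ← smul_eq_mul, ← map_smul]
  rfl

/-- Perturbation of an isolated point `β` of the spectrum along an analytic family of compact operators: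
as long as `‖A(z) - A(0)‖` is less than the inverse of the resolvent bound on `Γ`, the Riesz projection
is analytic with constant rank and the mean of the eigenvalue group has the expansion obtained from
the Neumann series. -/
theorem perturbation {A : ℂ → H →L[ℂ] H} {ρ K : ℝ} {β : ℂ}
    (hres : ∀ ζ ∈ Γ.trace, ζ ∈ resolventSet ℂ (A 0))
    (hK : ∀ ζ ∈ Γ.trace, ‖resolvent (A 0) ζ‖ ≤ K)
    (hA : DifferentiableOn ℂ A (Metric.ball 0 ρ))
    (hc : ∀ z ∈ Metric.ball (0 : ℂ) ρ, IsCompactOperator (A z))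
    (hsmall : ∀ z ∈ Metric.ball (0 : ℂ) ρ, ‖A z - A 0‖ * K < 1)
    (hout : (0 : ℂ) ∈ Γ.outside) (hβ : spectrum ℂ (A 0) ∩ Γ.inside = {β})
    {P : ℂ → H →L[ℂ] H} (hP : P = fun z => (-1 / (2 * Real.pi * Complex.I) : ℂ) •
      Γ.integral fun ζ => Ring.inverse (A z - ζ • ContinuousLinearMap.id ℂ H))
    {r : ℝ} (hr : r < ρ) :
    (∀ z ∈ Metric.ball (0 : ℂ) r,
      (∀ ζ ∈ Γ.trace, ζ ∈ resolventSet ℂ (A 0) ∧ ζ ∈ resolventSet ℂ (A z)) ∧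
      spectrum ℂ (A z) = (spectrum ℂ (A z) ∩ Γ.inside) ∪ (spectrum ℂ (A z) ∩ Γ.outside) ∧
      IsSpectralProjection (A z) (P z) (spectrum ℂ (A z) ∩ Γ.inside)) ∧
    DifferentiableOn ℂ P (Metric.ball 0 r) ∧
    (∀ z ∈ Metric.ball (0 : ℂ) r, FiniteDimensional ℂ (P z).range ∧
      Nonempty ((P z).range ≃L[ℂ] (P 0).range)) ∧
    TendstoUniformlyOn
      (fun (N : ℕ) (z : ℂ) => β + ∑ k ∈ Finset.Icc 1 N, z ^ k *
        ((1 / (2 * (Module.finrank ℂ (P 0).range : ℂ) * Real.pi * Complex.I)) *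
          finiteRankTrace (∑ c : Composition k, ((-1 : ℂ) ^ c.length / (c.length : ℂ)) •
            Γ.integral (fun ζ => (c.blocks.map fun i =>
              (((i.factorial : ℂ))⁻¹ • iteratedDeriv i A 0) *
                Ring.inverse (A 0 - ζ • ContinuousLinearMap.id ℂ H)).prod) :
              H →L[ℂ] H).toLinearMap))
      (fun z => (1 / (Module.finrank ℂ (P 0).range : ℂ)) *
        finiteRankTrace (A z * P z : H →L[ℂ] H).toLinearMap) atTop (Metric.ball 0 r) := by
  rcases le_or_gt r 0 with hr0 | hr0
  · rw [Metric.ball_eq_empty.2 hr0]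
    simp [tendstoUniformlyOn_empty, differentiableOn_empty]
  have hρ : 0 < ρ := hr0.trans hr
  -- `(A - ζ)⁻¹` is the negative of `resolvent A ζ`; this absorbs the sign in front of the contour
  -- integral.
  have hP' : P = fun z => Γ.riesz (A z) := by
    rw [hP]
    funext z
    simp only [inverse_sub_smul_id]
    have h1 : Γ.integral (fun ζ => -resolvent (A z) ζ) = -Γ.integral (resolvent (A z)) := by
      simp [Contour.integral, contourIntegral, smul_neg]
    rw [h1, Contour.riesz, smul_neg, ← neg_smul]
    congr 1
    ring
  have hresz : ∀ z ∈ Metric.ball (0 : ℂ) ρ, ∀ ζ ∈ Γ.trace, ζ ∈ resolventSet ℂ (A z) := by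
    intro z hz ζ hζ
    have := (norm_resolvent_add_le (hres ζ hζ) (hK ζ hζ) le_rfl (hsmall z hz)).1
    rwa [add_sub_cancel] at this
  have hana : AnalyticOnNhd ℂ A (Metric.ball 0 ρ) := hA.analyticOnNhd Metric.isOpen_ball
  have hPana : AnalyticOnNhd ℂ P (Metric.ball 0 ρ) := by
    rw [hP']
    exact fun z hz => Contour.analyticAt_riesz (hana z hz) (hresz z hz)
  have hidem : ∀ z ∈ Metric.ball (0 : ℂ) ρ, P z * P z = P z := by
    rw [hP']
    exact fun z hz => Contour.riesz_mul_self (hresz z hz)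
  have hfin : ∀ z ∈ Metric.ball (0 : ℂ) ρ, FiniteDimensional ℂ (P z).range := by
    rw [hP']
    exact fun z hz => Contour.finiteDimensional_range_riesz (hc z hz) (hresz z hz) hout
  have h0ρ : (0 : ℂ) ∈ Metric.ball (0 : ℂ) ρ := Metric.mem_ball_self hρ
  have hsub : Metric.ball (0 : ℂ) r ⊆ Metric.ball 0 ρ := Metric.ball_subset_ball hr.le
  have hspec : ∀ z ∈ Metric.ball (0 : ℂ) ρ,
      IsSpectralProjection (A z) (P z) (spectrum ℂ (A z) ∩ Γ.inside) := by
    rw [hP']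
    exact fun z hz => Contour.isSpectralProjection (hresz z hz)
  refine ⟨fun z hz => ⟨fun ζ hζ => ⟨hres ζ hζ, hresz z (hsub hz) ζ hζ⟩, ?_, hspec z (hsub hz)⟩,
    fun z hz => (hPana z (hsub hz)).differentiableAt.differentiableWithinAt,
    fun z hz => ⟨hfin z (hsub hz), ?_⟩, ?_⟩
  · rw [← inter_union_distrib_left, eq_comm, inter_eq_left]
    intro w hw
    exact Γ.mem_inside_or_outside fun h => hw (hresz z (hsub hz) w h)
  · have := hfin z (hsub hz)
    have := hfin 0 h0ρ
    exact ⟨ContinuousLinearEquiv.ofFinrankEq (finrank_eq_of_analyticOnNhd hPana hidem hfin (hsub hz))⟩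
  -- the expansion
  set m := Module.finrank ℂ (P 0).range
  have h0s := hspec 0 h0ρ
  rw [hβ] at h0s
  obtain ⟨htr, hm⟩ := trace_mul_of_isSpectralProjection h0s (hfin 0 h0ρ)
  have hm' : (m : ℂ) ≠ 0 := Nat.cast_ne_zero.2 hm
  set δ : ℂ → H →L[ℂ] H := fun z => A z - A 0
  have hAT := hasTaylor_of_analyticAt (hana 0 h0ρ)
  have hδ : HasTaylor δ fun k => if k = 0 then 0 else (k.factorial : ℂ)⁻¹ • iteratedDeriv k A 0 := by
    refine hAT.mono fun z hz => ?_
    have h1 := hasSum_single (f := fun k : ℕ => if k = 0 then A 0 else 0) 0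
      (fun k hk => by simp [hk])
    have h2 := hz.sub h1
    simp only [if_true] at h2
    convert h2 using 2 with k
    by_cases hk : k = 0
    · simp [hk]
    · simp [hk]
  have hδc : ∀ᶠ z in 𝓝 (0 : ℂ), IsCompactOperator (δ z) := by
    filter_upwards [Metric.ball_mem_nhds (0 : ℂ) hρ] with z hz
    exact (hc z hz).sub (hc 0 h0ρ)
  have hT := hasTaylor_trace_mul_riesz hres hout (hc 0 h0ρ) hδc hδ (by simp [δ])
  have hd : DifferentiableOn ℂ (fun z => finiteRankTrace (A z * P z).toLinearMap)
      (Metric.ball 0 ρ) := by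
    intro z hz
    refine (analyticAt_trace_mul (hana z hz) (hPana z hz) ?_
      (hfin z hz)).differentiableAt.differentiableWithinAt
    filter_upwards [Metric.isOpen_ball.mem_nhds hz] with w hw using hidem w hw
  have hT' : HasTaylor (fun z => finiteRankTrace (A z * P z).toLinearMap) _ :=
    hT.congr (Eventually.of_forall fun z => by simp [δ, hP'])
  have hU := hT'.tendstoUniformlyOn hd hr
  have hU2 := (uniformContinuous_const_smul (1 / (m : ℂ))).comp_tendstoUniformlyOn hU
  rw [tendstoUniformlyOn_iff_tendsto] at hU2 ⊢
  -- The partial sum over `range (N + 1)` consists of the constant term `β` and the terms `1, …, N`.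
  have hshift : Tendsto (fun q : ℕ × ℂ => (q.1 + 1, q.2)) (atTop ×ˢ 𝓟 (Metric.ball (0 : ℂ) r))
      (atTop ×ˢ 𝓟 (Metric.ball (0 : ℂ) r)) :=
    ((tendsto_add_atTop_nat 1).comp tendsto_fst).prodMk tendsto_snd
  refine (hU2.comp hshift).congr fun q => ?_
  obtain ⟨N, z⟩ := q
  simp only [Function.comp_apply, smul_eq_mul]
  congr 1
  rw [Finset.range_eq_Ico, ← Finset.sum_Ico_consecutive _ (Nat.zero_le 1) (by omega), mul_add]
  congr 1
  · have : P 0 = Γ.riesz (A 0) := by rw [hP']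
    simp only [← this, Finset.sum_Ico_succ_top le_rfl, Finset.Ico_self, Finset.sum_empty, if_true,
      pow_zero, one_mul, zero_add, htr]
    field_simp
    rfl
  have hIco : Finset.Ico 1 (N + 1) = Finset.Icc 1 N := by ext; simp
  rw [hIco, Finset.mul_sum]
  refine Finset.sum_congr rfl fun k hk => ?_
  have hk0 : k ≠ 0 := by have := (Finset.mem_Icc.1 hk).1; omega
  rw [if_neg hk0]
  -- Each of the `p` resolvents contributes a sign, which cancels `(-1)^p`. Blocks are positive, so
  -- the coefficient set to zero at index `0` never occurs.
  have hw : ∀ c : Composition k, ((-1 : ℂ) ^ c.length / (c.length : ℂ)) •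
      Γ.integral (fun ζ => (c.blocks.map fun i => (((i.factorial : ℂ))⁻¹ • iteratedDeriv i A 0) *
        Ring.inverse (A 0 - ζ • ContinuousLinearMap.id ℂ H)).prod) =
      (c.length : ℂ)⁻¹ • Γ.integral fun ζ => (c.blocks.map fun i =>
        (if i = 0 then 0 else (i.factorial : ℂ)⁻¹ • iteratedDeriv i A 0) *
          resolvent (A 0) ζ).prod := by
    intro c
    have h1 : ∀ ζ : ℂ, (c.blocks.map fun i => (((i.factorial : ℂ))⁻¹ • iteratedDeriv i A 0) *
        Ring.inverse (A 0 - ζ • ContinuousLinearMap.id ℂ H)).prod = (-1 : ℂ) ^ c.length •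
        (c.blocks.map fun i => (if i = 0 then 0 else (i.factorial : ℂ)⁻¹ • iteratedDeriv i A 0) *
          resolvent (A 0) ζ).prod := by
      intro ζ
      simp only [inverse_sub_smul_id, mul_neg]
      rw [list_prod_map_neg]
      congr 2
      refine List.map_congr_left fun i hi => ?_
      rw [if_neg (c.blocks_pos hi).ne']
    simp only [h1]
    rw [Contour.integral_smul, smul_smul, div_mul_eq_mul_div, ← mul_pow]
    simp [div_eq_mul_inv]
  rw [Finset.sum_congr rfl fun c _ => hw c, traceCoeff]
  have h2 : (2 * Real.pi * Complex.I : ℂ)⁻¹ ≠ 0 := by simp [Real.pi_ne_zero]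
  rw [ContinuousLinearMap.toLinearMap_smul, finiteRankTrace_smul_of_ne_zero h2]
  field_simp

end Assembly

/-! ### Plane waves, the sharp Poincaré inequality and compactness of the embedding. -/

section Fourier

variable {n : ℕ}

/-- The frequency `2πk + α`. -/
noncomputable def freq (α : Pt n) (k : Fin n → ℤ) : Pt n :=
  WithLp.toLp 2 fun j => 2 * Real.pi * (k j : ℝ) + α j

@[simp] lemma freq_apply (α : Pt n) (k : Fin n → ℤ) (j : Fin n) :
    freq α k j = 2 * Real.pi * (k j : ℝ) + α j := rfl

/-- Componentwise, since `α j ∈ (-π, π]` cannot be brought closer to `0` by adding a multiple of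
`2π`. -/
lemma norm_le_norm_freq (α : BlochVector n) (k : Fin n → ℤ) : ‖α.vec‖ ≤ ‖freq α.vec k‖ := by
  rw [EuclideanSpace.norm_eq, EuclideanSpace.norm_eq]
  refine Real.sqrt_le_sqrt (Finset.sum_le_sum fun j _ => ?_)
  rw [Real.norm_eq_abs, Real.norm_eq_abs, sq_abs, sq_abs, freq_apply]
  have h1 := (α.mem_Ioc j).1
  have h2 := (α.mem_Ioc j).2
  have hpi := Real.pi_pos
  rcases lt_trichotomy (k j) 0 with h | h | h
  · have : (k j : ℝ) ≤ -1 := by exact_mod_cast Int.le_sub_one_of_lt h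
    nlinarith [mul_nonneg hpi.le (by linarith : (0:ℝ) ≤ -1 - k j)]
  · simp [h]
  · have : (1 : ℝ) ≤ k j := by exact_mod_cast h
    nlinarith [mul_nonneg hpi.le (by linarith : (0:ℝ) ≤ k j - 1)]

lemma finite_norm_freq_le (α : Pt n) (R : ℝ) : {k : Fin n → ℤ | ‖freq α k‖ ≤ R}.Finite := by
  refine (Set.finite_Icc (fun j => ⌊(-R - α j) / (2 * Real.pi)⌋)
    (fun j => ⌈(R - α j) / (2 * Real.pi)⌉)).subset fun k hk => ?_
  have hj : ∀ j, |2 * Real.pi * (k j : ℝ) + α j| ≤ R := fun j =>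
    (PiLp.norm_apply_le (freq α k) j).trans hk
  have hpi := Real.pi_pos
  refine ⟨fun j => ?_, fun j => ?_⟩
  · have : (-R - α j) / (2 * Real.pi) ≤ k j := by
      rw [div_le_iff₀ (by positivity)]
      linarith [(abs_le.1 (hj j)).1]
    exact_mod_cast (Int.floor_le _).trans this
  · have : (k j : ℝ) ≤ (R - α j) / (2 * Real.pi) := by
      rw [le_div_iff₀ (by positivity)]
      linarith [(abs_le.1 (hj j)).2]
    exact_mod_cast this.trans (Int.le_ceil _)

/-- The plane wave as an element of `L²(Y)`. -/
noncomputable def waveL2 (α : Pt n) (k : Fin n → ℤ) : L2 n :=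
  (memLp_cell (contDiff_wave α k).continuous).toLp

lemma coeFn_waveL2 (α : Pt n) (k : Fin n → ℤ) : waveL2 α k =ᵐ[cellMeasure n] wave α k :=
  (memLp_cell (contDiff_wave α k).continuous).coeFn_toLp

lemma inner_waveL2 (α : Pt n) (k : Fin n → ℤ) (f : L2 n) :
    inner ℂ (waveL2 α k) f = ∫ x, f x * conj (wave α k x) ∂(cellMeasure n) := by
  rw [L2.inner_def]
  refine integral_congr_ae ?_
  filter_upwards [coeFn_waveL2 α k] with x hx
  rw [hx, RCLike.inner_apply]

lemma inner_waveL2_self (α : Pt n) (k : Fin n → ℤ) : inner ℂ (waveL2 α k) (waveL2 α k) = (1 : ℂ) := by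
  rw [inner_waveL2]
  have h1 : ∫ x, waveL2 α k x * conj (wave α k x) ∂(cellMeasure n)
      = ∫ _x, (1 : ℂ) ∂(cellMeasure n) := by
    refine integral_congr_ae ?_
    filter_upwards [coeFn_waveL2 α k] with x hx
    rw [hx, Complex.mul_conj, Complex.normSq_eq_norm_sq, norm_wave]
    simp
  rw [h1, integral_cell]
  have h2 : {x : Fin n → ℝ | ∀ i, x i ∈ Ioc (0 : ℝ) (0 + 1)} = univ.pi fun _ => Ioc (0 : ℝ) 1 := by
    ext x
    simp
  rw [h2, setIntegral_const, measureReal_def, Real.volume_pi_Ioc]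
  simp

lemma hasSum_norm_inner_waveL2 (α : Pt n) (f : L2 n) :
    HasSum (fun k => ‖inner ℂ (waveL2 α k) f‖ ^ 2) (‖f‖ ^ 2) := by
  simp only [inner_waveL2]
  exact hasSum_wave α f

lemma norm_waveL2 (α : Pt n) (k : Fin n → ℤ) : ‖waveL2 α k‖ = 1 := by
  rw [@norm_eq_sqrt_re_inner ℂ, inner_waveL2_self]
  simp

/-- Parseval's identity for a wave already has the value `1` in its own term, so all other
coefficients vanish. -/
lemma orthonormal_waveL2 (α : Pt n) : Orthonormal ℂ (waveL2 α) := by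
  refine ⟨norm_waveL2 α, fun k l hkl => ?_⟩
  have h := hasSum_norm_inner_waveL2 α (waveL2 α l)
  have h2 := sum_le_hasSum {k, l} (fun _ _ => by positivity) h
  rw [Finset.sum_pair hkl, inner_waveL2_self, norm_waveL2] at h2
  norm_num at h2
  exact h2

/-- The plane waves as a Hilbert basis of `L²(Y)`. -/
noncomputable def waveBasis (α : Pt n) : HilbertBasis (Fin n → ℤ) ℂ (L2 n) :=
  HilbertBasis.mkOfOrthogonalEqBot (orthonormal_waveL2 α) (by
    refine (Submodule.eq_bot_iff _).2 fun f hf => ?_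
    have h := hasSum_norm_inner_waveL2 α f
    have h0 : ∀ k, inner ℂ (waveL2 α k) f = 0 := fun k =>
      Submodule.inner_right_of_mem_orthogonal (Submodule.subset_span (mem_range_self k)) hf
    simp only [h0] at h
    have h1 : ‖f‖ ^ 2 = 0 := h.unique (by simp)
    exact norm_eq_zero.1 (pow_eq_zero_iff two_ne_zero |>.1 h1))

@[simp] lemma coe_waveBasis (α : Pt n) : ⇑(waveBasis α) = waveL2 α :=
  HilbertBasis.coe_mkOfOrthogonalEqBot _ _

lemma hasSum_inner_mul_inner_waveL2 (α : Pt n) (f g : L2 n) :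
    HasSum (fun k => inner ℂ f (waveL2 α k) * inner ℂ (waveL2 α k) g) (inner ℂ f g : ℂ) := by
  simpa using (waveBasis α).hasSum_inner_mul_inner f g

/-- The Fourier coefficients of a weak gradient. -/
lemma inner_waveL2_gradient {α : Pt n} {p : L2 n × VecL2 n} (hp : p ∈ h1Graph α) (k : Fin n → ℤ)
    (j : Fin n) : inner ℂ (waveL2 α k) (p.2 j) =
      Complex.I * ((freq α k j : ℝ) : ℂ) * inner ℂ (waveL2 α k) p.1 := by
  have h := hp _ (isTestFunction_wave α k) j
  rw [inner_waveL2, inner_waveL2, ← neg_eq_iff_eq_neg.2 h, ← integral_const_mul, ← integral_neg]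
  refine integral_congr_ae (Eventually.of_forall fun x => ?_)
  simp only [fderiv_wave, map_mul, Complex.conj_I, Complex.conj_ofReal, freq_apply]
  ring

/-- Integration by parts for two quasi-periodic functions. -/
lemma inner_gradient_left {α : Pt n} {p q : L2 n × VecL2 n} (hp : p ∈ h1Graph α)
    (hq : q ∈ h1Graph α) (j : Fin n) :
    inner ℂ (p.2 j) q.1 = -(inner ℂ p.1 (q.2 j) : ℂ) := by
  refine (hasSum_inner_mul_inner_waveL2 α _ _).unique ?_
  refine ((hasSum_inner_mul_inner_waveL2 α p.1 (q.2 j)).neg).congr_fun fun k => ?_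
  rw [inner_waveL2_gradient hq, ← inner_conj_symm, inner_waveL2_gradient hp,
    ← inner_conj_symm p.1]
  simp only [map_mul, Complex.conj_I, Complex.conj_ofReal]
  ring

variable (α : BlochVector n)

lemma mem_h1Graph (u : H1 α) : (H1.toL2 α u, H1.grad α u) ∈ h1Graph α.vec := u.2

lemma H1.inner_eq_sum (u v : H1 α) :
    inner ℂ u v = ∑ j, (inner ℂ (H1.grad α u j) (H1.grad α v j) : ℂ) :=
  PiLp.inner_apply _ _

lemma H1.hasSum_norm_sq (u : H1 α) :
    HasSum (fun k => ‖freq α.vec k‖ ^ 2 * ‖inner ℂ (waveL2 α.vec k) (H1.toL2 α u)‖ ^ 2)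
      (‖u‖ ^ 2) := by
  have h1 : ‖u‖ ^ 2 = ∑ j, ‖H1.grad α u j‖ ^ 2 := by
    rw [← (H1.grad α).norm_map u, PiLp.norm_sq_eq_of_L2]
  rw [h1]
  refine (hasSum_sum fun j (_ : j ∈ Finset.univ) =>
    hasSum_norm_inner_waveL2 α.vec (H1.grad α u j)).congr_fun fun k => ?_
  rw [EuclideanSpace.real_norm_sq_eq, Finset.sum_mul]
  refine Finset.sum_congr rfl fun j _ => ?_
  rw [inner_waveL2_gradient (mem_h1Graph α u) k j, norm_mul, norm_mul, Complex.norm_I,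
    Complex.norm_real, one_mul, mul_pow, Real.norm_eq_abs, sq_abs]

lemma H1.norm_toL2_le (u : H1 α) : ‖H1.toL2 α u‖ ≤ ‖α.vec‖⁻¹ * ‖u‖ := by
  have := HighContrast.poincare α _ (mem_h1Graph α u)
  rwa [(H1.grad α).norm_map] at this

/-- The embedding of `H¹_#` in `L²_#` is compact. -/
lemma isCompactOperator_toL2 : IsCompactOperator (H1.toL2 α) := by
  have hcl := isClosed_setOfPred_isCompactOperator (𝕜₁ := ℂ) (𝕜₂ := ℂ) (σ₁₂ := RingHom.id ℂ)
    (M₁ := H1 α) (M₂ := L2 n)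
  refine hcl.closure_subset_iff.2 (fun _ h => h) (Metric.mem_closure_iff.2 fun ε hε => ?_)
  obtain ⟨R, hR⟩ : ∃ R : ℝ, 0 < R ∧ R⁻¹ < ε := ⟨(ε / 2)⁻¹, by positivity, by
    rw [inv_inv]; linarith⟩
  let s := (finite_norm_freq_le α.vec R).toFinset
  -- Truncation to frequencies of norm at most `R` has finite rank and an error of at most `R⁻¹` in
  -- operator norm.
  let F : H1 α →L[ℂ] L2 n :=
    ∑ k ∈ s, (innerSL ℂ (waveL2 α.vec k) ∘L H1.toL2 α).smulRight (waveL2 α.vec k)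
  have hF : ∀ u, F u = ∑ k ∈ s, (inner ℂ (waveL2 α.vec k) (H1.toL2 α u) : ℂ) • waveL2 α.vec k := by
    intro u
    simp [F]
  refine ⟨F, ?_, ?_⟩
  · refine (Submodule.sum_mem (compactOperator (RingHom.id ℂ) (H1 α) (L2 n))
      (t := s) fun k _ => ?_)
    have h1 : IsCompactOperator (innerSL ℂ (waveL2 α.vec k) ∘L H1.toL2 α) :=
      isCompactOperator_of_locallyCompactSpace_dom _
    exact h1.clm_comp (ContinuousLinearMap.toSpanSingleton ℂ (waveL2 α.vec k))
  rw [dist_eq_norm]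
  refine (ContinuousLinearMap.opNorm_le_bound _ (inv_nonneg.2 hR.1.le) fun u => ?_).trans_lt hR.2
  set y := H1.toL2 α u
  have hcoef : ∀ k, inner ℂ (waveL2 α.vec k) ((H1.toL2 α - F) u) =
      if k ∈ s then 0 else (inner ℂ (waveL2 α.vec k) y : ℂ) := by
    intro k
    rw [sub_apply, inner_sub_right, hF, inner_sum]
    simp only [inner_smul_right, orthonormal_iff_ite.1 (orthonormal_waveL2 α.vec), mul_ite, mul_one,
      mul_zero, Finset.sum_ite_eq]
    split_ifs <;> simp [y]
  have hle : R ^ 2 * ‖(H1.toL2 α - F) u‖ ^ 2 ≤ ‖u‖ ^ 2 := by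
    refine hasSum_le (fun k => ?_) ((hasSum_norm_inner_waveL2 α.vec _).mul_left (R ^ 2))
      (H1.hasSum_norm_sq α u)
    rw [hcoef]
    split_ifs with hk
    · simp
      positivity
    · have h1 : R < ‖freq α.vec k‖ := by simpa [s] using hk
      have := hR.1
      gcongr
  rw [inv_mul_eq_div, le_div_iff₀ hR.1, mul_comm]
  refine le_of_sq_le_sq ?_ (norm_nonneg _)
  rwa [mul_pow]

end Fourier

/-! ### Restriction to the inclusions, test functions and unique continuation. -/

section Domain

variable {n : ℕ} {D : Set (Pt n)}

lemma IsBumpIn.fderiv_apply {φ : Pt n → ℂ} (h : IsBumpIn D φ) (v : Pt n) :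
    IsBumpIn D fun x => fderiv ℝ φ x v := by
  refine ⟨(h.smooth.fderiv_right (m := ∞) (by simp)).clm_apply contDiff_const,
    h.compact.fderiv_apply ℝ v, ?_⟩
  refine (closure_mono ?_).trans ((tsupport_fderiv_subset ℝ (f := φ)).trans h.support)
  intro x hx hx'
  exact hx (by simp [hx'])

lemma IsBumpIn.exists_mem_h10Graph {φ : Pt n → ℂ} (h : IsBumpIn D φ) :
    ∃ p ∈ h10Graph D, p.1 =ᵐ[cellMeasure n] φ ∧ ∀ j, p.2 j =ᵐ[cellMeasure n]
      fun x => fderiv ℝ φ x (EuclideanSpace.single j 1) := by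
  let p : L2 n × VecL2 n := ((memLp_cell h.smooth.continuous).toLp, WithLp.toLp 2 fun j =>
    (memLp_cell (h.fderiv_apply (EuclideanSpace.single j 1)).smooth.continuous).toLp)
  have h1 : p.1 =ᵐ[cellMeasure n] φ := (memLp_cell h.smooth.continuous).coeFn_toLp
  have h2 : ∀ j, p.2 j =ᵐ[cellMeasure n] fun x => fderiv ℝ φ x (EuclideanSpace.single j 1) :=
    fun j => (memLp_cell (h.fderiv_apply (EuclideanSpace.single j 1)).smooth.continuous).coeFn_toLp
  exact ⟨p, Submodule.le_topologicalClosure _ (Submodule.subset_span ⟨φ, h, h1, h2⟩), h1, h2⟩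

lemma h10Graph_le_of_bump {S : Submodule ℂ (L2 n × VecL2 n)} (hS : IsClosed (S : Set (L2 n × VecL2 n)))
    (h : ∀ p φ, IsBumpIn D φ → p.1 =ᵐ[cellMeasure n] φ → (∀ j, p.2 j =ᵐ[cellMeasure n]
      fun x => fderiv ℝ φ x (EuclideanSpace.single j 1)) → p ∈ S) : h10Graph D ≤ S :=
  Submodule.topologicalClosure_minimal _
    (Submodule.span_le.2 fun p ⟨φ, hφ, h1, h2⟩ => h p φ hφ h1 h2) hS

/-- The restriction `L²(Y) → L²(D)`. -/
noncomputable abbrev restrictTo (D : Set (Pt n)) :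
    L2 n →L[ℂ] Lp ℂ 2 ((cellMeasure n).restrict D) :=
  LpToLpRestrictCLM (Pt n) ℂ ℂ (cellMeasure n) 2 D

lemma coeFn_restrictTo (f : L2 n) : restrictTo D f =ᵐ[(cellMeasure n).restrict D] f :=
  LpToLpRestrictCLM_coeFn ℂ D f

lemma exists_extension (hD : MeasurableSet D) (g : Lp ℂ 2 ((cellMeasure n).restrict D)) :
    ∃ f : L2 n, restrictTo D f = g ∧ ∀ h : L2 n, inner ℂ f h = (inner ℂ g (restrictTo D h) : ℂ) := by
  have hm : MemLp (D.indicator g) 2 (cellMeasure n) := (memLp_indicator_iff_restrict hD).2 (Lp.memLp g)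
  have h1 : hm.toLp =ᵐ[cellMeasure n] D.indicator g := hm.coeFn_toLp
  refine ⟨hm.toLp, ?_, fun h => ?_⟩
  · refine Lp.ext ?_
    filter_upwards [coeFn_restrictTo (D := D) hm.toLp, ae_restrict_of_ae h1, ae_restrict_mem hD]
      with x hx1 hx2 hx3
    rw [hx1, hx2, indicator_of_mem hx3]
  · rw [L2.inner_def, L2.inner_def, ← integral_indicator hD]
    have h2 : ∫ x in D, inner ℂ (g x) (restrictTo D h x) ∂(cellMeasure n)
        = ∫ x in D, inner ℂ (g x) (h x) ∂(cellMeasure n) := by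
      refine integral_congr_ae ?_
      filter_upwards [coeFn_restrictTo (D := D) h] with x hx
      rw [hx]
    rw [integral_indicator hD, h2, ← integral_indicator hD]
    refine integral_congr_ae ?_
    filter_upwards [h1] with x hx
    by_cases hxD : x ∈ D
    · rw [indicator_of_mem hxD, hx, indicator_of_mem hxD]
    · rw [indicator_of_notMem hxD, hx, indicator_of_notMem hxD, inner_zero_left]

lemma restrictTo_adjoint_apply (hD : MeasurableSet D) (g : Lp ℂ 2 ((cellMeasure n).restrict D)) :
    restrictTo D (ContinuousLinearMap.adjoint (restrictTo D) g) = g := by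
  obtain ⟨f, h1, h2⟩ := exists_extension hD g
  have : ContinuousLinearMap.adjoint (restrictTo D) g = f :=
    ext_inner_right ℂ fun h => by rw [ContinuousLinearMap.adjoint_inner_left, h2]
  rw [this, h1]

lemma adjoint_restrictTo_apply {f : L2 n} (hD : MeasurableSet D)
    (hf : ∀ᵐ x ∂(cellMeasure n), x ∉ D → f x = 0) :
    ContinuousLinearMap.adjoint (restrictTo D) (restrictTo D f) = f := by
  refine ext_inner_right ℂ fun h => ?_
  rw [ContinuousLinearMap.adjoint_inner_left, L2.inner_def, L2.inner_def]
  have h2 : ∫ x in D, inner ℂ (restrictTo D f x) (restrictTo D h x) ∂(cellMeasure n)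
      = ∫ x in D, inner ℂ (f x) (h x) ∂(cellMeasure n) := by
    refine integral_congr_ae ?_
    filter_upwards [coeFn_restrictTo (D := D) h, coeFn_restrictTo (D := D) f] with x hx hx'
    rw [hx, hx']
  rw [h2, ← integral_indicator hD]
  refine integral_congr_ae ?_
  filter_upwards [hf] with x hx
  by_cases hxD : x ∈ D
  · rw [indicator_of_mem hxD]
  · rw [indicator_of_notMem hxD, hx hxD, inner_zero_left]

lemma adjoint_restrictTo_of_mem_h10Graph (hD : MeasurableSet D) {p : L2 n × VecL2 n}
    (hp : p ∈ h10Graph D) :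
    ContinuousLinearMap.adjoint (restrictTo D) (restrictTo D p.1) = p.1 := by
  let L : L2 n × VecL2 n →L[ℂ] L2 n :=
    (ContinuousLinearMap.adjoint (restrictTo D) ∘L restrictTo D - 1) ∘L
      ContinuousLinearMap.fst ℂ (L2 n) (VecL2 n)
  have h : h10Graph D ≤ L.ker := by
    refine h10Graph_le_of_bump L.isClosed_ker fun p φ hφ h1 _ => ?_
    have : ContinuousLinearMap.adjoint (restrictTo D) (restrictTo D p.1) = p.1 := by
      refine adjoint_restrictTo_apply hD ?_
      filter_upwards [h1] with x hx hxD
      rw [hx]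
      exact image_eq_zero_of_notMem_tsupport fun h => hxD (hφ.support h)
    rw [LinearMap.mem_ker]
    exact sub_eq_zero.2 this
  have h1 := LinearMap.mem_ker.1 (h hp)
  exact sub_eq_zero.1 h1

/-- A function orthogonal to `C_c^∞(D)` vanishes on `D`. -/
lemma restrictTo_eq_zero_of_bump (hD : IsOpen D) {f : L2 n}
    (h : ∀ p ∈ h10Graph D, inner ℂ f p.1 = (0 : ℂ)) : restrictTo D f = 0 := by
  have hloc : LocallyIntegrable f (cellMeasure n) := (Lp.memLp f).locallyIntegrable one_le_two
  -- The fundamental lemma of the calculus of variations; its real test functions belong to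
  -- `H¹_0(D)`.
  have h1 := hD.ae_eq_zero_of_integral_contDiff_smul_eq_zero (hloc.locallyIntegrableOn D) ?_
  · refine Lp.ext ?_
    filter_upwards [coeFn_restrictTo (D := D) f, ae_restrict_of_ae h1,
      ae_restrict_mem hD.measurableSet, Lp.coeFn_zero ℂ 2 ((cellMeasure n).restrict D)]
      with x h2 h3 h4 h5
    rw [h2, h3 h4, h5]
    rfl
  intro g hg hgc hgs
  have hb : IsBumpIn D fun x => (g x : ℂ) := by
    refine ⟨Complex.ofRealCLM.contDiff.comp hg, hgc.comp_left (g := Complex.ofReal) rfl, ?_⟩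
    refine (closure_mono ?_).trans hgs
    intro x hx h
    exact hx (by simp [h])
  obtain ⟨p, hp, hp1, -⟩ := hb.exists_mem_h10Graph
  have h2 := h p hp
  rw [L2.inner_def] at h2
  have h3 : ∫ x, g x • f x ∂(cellMeasure n)
      = conj (∫ x, inner ℂ (f x) (p.1 x) ∂(cellMeasure n)) := by
    rw [← integral_conj]
    refine integral_congr_ae ?_
    filter_upwards [hp1] with x hx
    rw [hx, RCLike.inner_apply]
    simp
  rw [h3, h2, map_zero]

lemma contDiff_omega_wave (α : Pt n) (k : Fin n → ℤ) : ContDiff ℝ ω (wave α k) := by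
  unfold wave
  have h : ContDiff ℝ ω (fun x : Pt n => (∑ j, (2 * Real.pi * (k j : ℝ) + α j) * x j : ℝ)) := by
    fun_prop
  exact (contDiff_const.mul (Complex.ofRealCLM.contDiff.comp h)).cexp

lemma coeFn_sum_waveL2 (α : Pt n) (c : (Fin n → ℤ) → ℂ) (s : Finset (Fin n → ℤ)) :
    (∑ k ∈ s, c k • waveL2 α k : L2 n) =ᵐ[cellMeasure n] fun x => ∑ k ∈ s, c k * wave α k x := by
  classical
  induction s using Finset.induction_on with
  | empty =>
    simp only [Finset.sum_empty]
    exact Lp.coeFn_zero ℂ 2 (cellMeasure n)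
  | insert k s hk ih =>
    rw [Finset.sum_insert hk]
    filter_upwards [ih, Lp.coeFn_add (c k • waveL2 α k) (∑ k ∈ s, c k • waveL2 α k),
      Lp.coeFn_smul (c k) (waveL2 α k), coeFn_waveL2 α k] with x h1 h2 h3 h4
    rw [h2, Pi.add_apply, h1, h3, Pi.smul_apply, h4, Finset.sum_insert hk, smul_eq_mul]

/-- A trigonometric polynomial vanishing on a nonempty open set is zero. -/
lemma eq_zero_of_mem_span_waveL2 (hD : IsOpen D) (hDc : D ⊆ cell n) (hne : D.Nonempty) {α : Pt n}
    {f : L2 n} (hf : f ∈ Submodule.span ℂ (range (waveL2 α))) (h0 : restrictTo D f = 0) : f = 0 := by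
  obtain ⟨c, rfl⟩ := Finsupp.mem_span_range_iff_exists_finsupp.1 hf
  set F : Pt n → ℂ := fun x => c.sum fun k a => a * wave α k x
  have hF : (c.sum fun k a => a • waveL2 α k : L2 n) =ᵐ[cellMeasure n] F :=
    coeFn_sum_waveL2 α c c.support
  have hFc : ContDiff ℝ ω F := by
    simp only [F, Finsupp.sum]
    exact ContDiff.sum fun k _ => contDiff_const.mul (contDiff_omega_wave α k)
  -- Real analyticity on the connected space `ℝⁿ` propagates the zero set from `D` to everything.
  have hFa : AnalyticOnNhd ℝ F univ := contDiff_omega_iff_analyticOnNhd.1 hFc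
  have hD0 : EqOn F 0 D := by
    have hm : (cellMeasure n).restrict D = volume.restrict D := by
      rw [Measure.restrict_restrict hD.measurableSet, inter_eq_left.2 hDc]
    refine Measure.eqOn_open_of_ae_eq (μ := volume) ?_ hD hFc.continuous.continuousOn
      continuousOn_const
    rw [← hm]
    filter_upwards [coeFn_restrictTo (D := D) _, ae_restrict_of_ae hF, h0 ▸ Lp.coeFn_zero ℂ 2 ((cellMeasure n).restrict D)]
      with x h1 h2 h3
    rw [← h2, ← h1, h3]
  obtain ⟨x, hx⟩ := hne
  have h1 : F = 0 := hFa.eq_of_eventuallyEq analyticOnNhd_const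
    (z₀ := x) (by filter_upwards [hD.mem_nhds hx] with y hy using hD0 hy)
  refine Lp.ext ?_
  filter_upwards [hF, Lp.coeFn_zero ℂ 2 (cellMeasure n)] with x h2 h3
  rw [h2, h3, h1]

end Domain

/-! ### Compressions of the form `J P J*`. -/

section Abstract

variable {E F G K : Type*} [NormedAddCommGroup E] [InnerProductSpace ℂ E] [CompleteSpace E]
  [NormedAddCommGroup F] [InnerProductSpace ℂ F] [CompleteSpace F]
  [NormedAddCommGroup G] [InnerProductSpace ℂ G] [CompleteSpace G]
  [NormedAddCommGroup K] [InnerProductSpace ℂ K] [CompleteSpace K]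

/-- Since `P = V V*`, the left side is `(J V) (J V)*`, and `r* r` fixes the range of `J V`. With `V`
the extension by zero and `r` the restriction to `D`, this identifies `A(0)`. -/
lemma comp_adjoint_comp_eq (J : E →L[ℂ] F) (V : G →L[ℂ] E) (r : F →L[ℂ] K) {P : E →L[ℂ] E}
    (hP : ∀ x, P x = V (ContinuousLinearMap.adjoint V x))
    (h : ∀ u, ContinuousLinearMap.adjoint r (r (J (V u))) = J (V u)) :
    J ∘L P ∘L ContinuousLinearMap.adjoint J = ContinuousLinearMap.adjoint r ∘L
      ((r ∘L J ∘L V) ∘L ContinuousLinearMap.adjoint (r ∘L J ∘L V)) ∘L r := by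
  have h1 : ContinuousLinearMap.adjoint r ∘L (r ∘L J ∘L V) = J ∘L V := ContinuousLinearMap.ext h
  have h2 := congrArg ContinuousLinearMap.adjoint h1
  rw [ContinuousLinearMap.adjoint_comp, ContinuousLinearMap.adjoint_adjoint] at h2
  have h3 : P = V ∘L ContinuousLinearMap.adjoint V := ContinuousLinearMap.ext hP
  calc J ∘L P ∘L ContinuousLinearMap.adjoint J
      = (J ∘L V) ∘L ContinuousLinearMap.adjoint (J ∘L V) := by
        rw [h3, ContinuousLinearMap.adjoint_comp]
        rfl
    _ = (ContinuousLinearMap.adjoint r ∘L (r ∘L J ∘L V)) ∘L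
        (ContinuousLinearMap.adjoint (r ∘L J ∘L V) ∘L r) := by rw [h1, h2]
    _ = _ := rfl

lemma isSelfAdjoint_comp_adjoint (i : G →L[ℂ] K) :
    IsSelfAdjoint (i ∘L ContinuousLinearMap.adjoint i) := by
  rw [ContinuousLinearMap.isSelfAdjoint_iff', ContinuousLinearMap.adjoint_comp,
    ContinuousLinearMap.adjoint_adjoint]

lemma isSelfAdjoint_adjoint_comp_comp (r : F →L[ℂ] K) {A : K →L[ℂ] K} (hA : IsSelfAdjoint A) :
    IsSelfAdjoint (ContinuousLinearMap.adjoint r ∘L A ∘L r) := by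
  rw [ContinuousLinearMap.isSelfAdjoint_iff'] at hA ⊢
  rw [ContinuousLinearMap.adjoint_comp, ContinuousLinearMap.adjoint_comp,
    ContinuousLinearMap.adjoint_adjoint, hA]
  rfl

/-- The orthogonal projection onto the range of an isometry. -/
lemma starProjection_eq_of_isometry {W : Submodule ℂ E} [W.HasOrthogonalProjection] (V : G →ₗᵢ[ℂ] E)
    (h1 : ∀ u, V u ∈ W) (h2 : ∀ w ∈ W, ∃ u, V u = w) (x : E) :
    W.starProjection x = V (ContinuousLinearMap.adjoint V.toContinuousLinearMap x) := by
  refine Submodule.eq_starProjection_of_mem_of_inner_eq_zero (h1 _) fun w hw => ?_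
  obtain ⟨u, rfl⟩ := h2 w hw
  rw [inner_sub_left, V.inner_map_map, ContinuousLinearMap.adjoint_inner_left]
  exact sub_self _

end Abstract

/-! ### The limit operator `A(0)`, its spectrum, and the orthogonality of `W₁` and `W₂`. -/

section Subspaces

variable {n : ℕ} (α : BlochVector n) (D : InclusionDomain n)

/-- The extension by zero `H¹_0(D) → H¹_#`. -/
noncomputable def h10Extension : D.H10 →ₗᵢ[ℂ] H1 α where
  toFun u := (⟨u.1, h10Graph_le D.subset_cell α.vec u.2⟩ : (quasiPeriodicH1 α).graph)
  map_add' _ _ := rfl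
  map_smul' _ _ := rfl
  norm_map' u := by
    rw [← EnergyGraph.norm_gradₗ, ← EnergyGraph.norm_gradₗ]
    rfl

lemma h10Extension_mem (u : D.H10) : h10Extension α D u ∈ W2 α D := u.2

lemma exists_h10Extension_eq {w : H1 α} (hw : w ∈ W2 α D) : ∃ u, h10Extension α D u = w :=
  ⟨(⟨(H1.toL2 α w, H1.grad α w), hw⟩ : D.h10.graph), rfl⟩

lemma P2_apply (x : H1 α) : P2 α D x = h10Extension α D
    (ContinuousLinearMap.adjoint (h10Extension α D).toContinuousLinearMap x) :=
  starProjection_eq_of_isometry (h10Extension α D) (h10Extension_mem α D)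
    (fun _ hw => exists_h10Extension_eq α D hw) x

lemma h10ToL2D_eq : D.h10ToL2D =
    restrictTo D.carrier ∘L H1.toL2 α ∘L (h10Extension α D).toContinuousLinearMap := rfl

lemma adjoint_restrictTo_h10ToL2D (u : D.H10) :
    ContinuousLinearMap.adjoint (restrictTo D.carrier) (D.h10ToL2D u) =
      H1.toL2 α (h10Extension α D u) :=
  adjoint_restrictTo_of_mem_h10Graph D.isOpen.measurableSet u.2

lemma solutionMultiplier_zero : solutionMultiplier α D 0 = P2 α D := by
  ext x
  unfold solutionMultiplier
  simp

/-- `A(0)` is `-Δ_D⁻¹`, extended by zero off `D`. -/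
lemma blochOp_zero : blochOp α D 0 = ContinuousLinearMap.adjoint (restrictTo D.carrier) ∘L
    D.dirichletInverse ∘L restrictTo D.carrier := by
  rw [blochOp, solutionMultiplier_zero]
  exact comp_adjoint_comp_eq (H1.toL2 α) (h10Extension α D).toContinuousLinearMap
    (restrictTo D.carrier) (P2_apply α D) (adjoint_restrictTo_h10ToL2D α D)

lemma isSelfAdjoint_dirichletInverse : IsSelfAdjoint D.dirichletInverse :=
  isSelfAdjoint_comp_adjoint D.h10ToL2D

lemma isSelfAdjoint_blochOp_zero : IsSelfAdjoint (blochOp α D 0) := by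
  rw [blochOp_zero]
  exact isSelfAdjoint_adjoint_comp_comp _ (isSelfAdjoint_dirichletInverse D)

include α in
lemma isCompactOperator_dirichletInverse : IsCompactOperator D.dirichletInverse := by
  have h : IsCompactOperator D.h10ToL2D := by
    rw [h10ToL2D_eq α D]
    exact ((isCompactOperator_toL2 α).comp_clm (h10Extension α D).toContinuousLinearMap).clm_comp
      (restrictTo D.carrier)
  exact h.comp_clm (ContinuousLinearMap.adjoint D.h10ToL2D)

lemma restrict_adjoint (g : D.L2D) : restrictTo D.carrier
    (ContinuousLinearMap.adjoint (restrictTo D.carrier) g) = g :=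
  restrictTo_adjoint_apply D.isOpen.measurableSet g

/-- The Dirichlet problem has dense range: `-Δ_D⁻¹` is injective. -/
lemma dirichletInverse_injective {f : D.L2D} (hf : D.dirichletInverse f = 0) : f = 0 := by
  -- The operator is `i i*`, so its kernel is that of `i*`, which consists of the functions
  -- orthogonal to `H¹_0(D)`.
  have h1 : ContinuousLinearMap.adjoint D.h10ToL2D f = 0 := by
    have h2 : inner ℂ (ContinuousLinearMap.adjoint D.h10ToL2D f)
        (ContinuousLinearMap.adjoint D.h10ToL2D f) = (0 : ℂ) := by
      rw [ContinuousLinearMap.adjoint_inner_right]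
      exact hf.symm ▸ inner_zero_left _
    exact inner_self_eq_zero.1 h2
  rw [← restrict_adjoint D f]
  refine restrictTo_eq_zero_of_bump D.isOpen fun p hp => ?_
  rw [ContinuousLinearMap.adjoint_inner_left]
  let u : D.H10 := (⟨p, hp⟩ : D.h10.graph)
  have h3 : inner ℂ f (D.h10ToL2D u) = (0 : ℂ) := by
    rw [← ContinuousLinearMap.adjoint_inner_left, h1, inner_zero_left]
  exact h3

lemma carrier_nonempty [Nontrivial D.L2D] : D.carrier.Nonempty := by
  by_contra h
  rw [not_nonempty_iff_eq_empty] at h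
  obtain ⟨f, hf⟩ := exists_ne (0 : D.L2D)
  refine hf (Lp.ext ?_)
  have : (cellMeasure n).restrict D.carrier = 0 := by rw [h, Measure.restrict_empty]
  have h2 : ae ((cellMeasure n).restrict D.carrier) = ⊥ := by rw [this, ae_zero]
  rw [EventuallyEq, h2]
  exact eventually_bot

include α in
-- A trigonometric polynomial vanishing on `D` is zero, so the infinitely many plane waves stay
-- independent after restriction.
lemma not_finiteDimensional_L2D [Nontrivial D.L2D] : ¬ FiniteDimensional ℂ D.L2D := by
  intro hfin
  have hli : LinearIndependent ℂ (restrictTo D.carrier ∘ waveL2 α.vec) := by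
    refine LinearIndependent.map (f := (restrictTo D.carrier).toLinearMap)
      (orthonormal_waveL2 α.vec).linearIndependent ?_
    rw [Submodule.disjoint_def]
    intro f hf h0
    exact eq_zero_of_mem_span_waveL2 D.isOpen D.subset_cell (carrier_nonempty D) hf h0
  have : Nonempty (Fin n) := ⟨⟨0, by have := D.dim_eq; omega⟩⟩
  have := hli.finite
  exact not_finite (Fin n → ℤ)

include α in
-- An invertible compact operator would make the identity compact, which is impossible in infinite
-- dimension.
lemma zero_mem_spectrum_dirichletInverse [Nontrivial D.L2D] :
    (0 : ℂ) ∈ spectrum ℂ D.dirichletInverse := by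
  rw [spectrum.zero_mem_iff]
  rintro ⟨u, hu⟩
  refine not_finiteDimensional_L2D α D ?_
  rw [← isCompactOperator_id_iff_finiteDimensional (𝕜 := ℂ)]
  have h := (isCompactOperator_dirichletInverse α D).clm_comp (↑u⁻¹ : D.L2D →L[ℂ] D.L2D)
  refine (congrArg IsCompactOperator (funext fun x => ?_)).mp h
  have := DFunLike.congr_fun (u.inv_mul) x
  rw [hu] at this
  exact this

/-- Let `T` be the Dirichlet inverse, so that `A(0) = e T r` with `r e = 1`. Applying `r` to `ζ x -
e T r x = y` gives `(ζ - T) v = r y` for `v = r x`, and then `x = ζ⁻¹ (y + e T v)`; this is where `ζ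
≠ 0` enters. -/
lemma mem_resolventSet_blochOp_zero {ζ : ℂ} (h0 : ζ ≠ 0)
    (h : ζ ∈ resolventSet ℂ D.dirichletInverse) : ζ ∈ resolventSet ℂ (blochOp α D 0) := by
  rw [mem_resolventSet_iff_bijective] at h ⊢
  set r := restrictTo D.carrier
  set e := ContinuousLinearMap.adjoint (restrictTo D.carrier)
  have hre : ∀ g, r (e g) = g := restrict_adjoint D
  have hA : ∀ x, blochOp α D 0 x = e (D.dirichletInverse (r x)) := fun x => by
    rw [blochOp_zero]; rfl
  constructor
  · refine (injective_iff_map_eq_zero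
      (ζ • LinearMap.id - (blochOp α D 0).toLinearMap : L2 n →ₗ[ℂ] L2 n)).2 fun x hx => ?_
    have hx' : ζ • x = e (D.dirichletInverse (r x)) := by rw [← hA]; exact sub_eq_zero.1 hx
    have h1 : ζ • r x = D.dirichletInverse (r x) := by
      rw [← map_smul, hx', hre]
    have h2 : r x = 0 := h.1 (by simp [h1])
    rw [h2, map_zero, map_zero] at hx'
    exact (smul_eq_zero.1 hx').resolve_left h0
  · intro y
    obtain ⟨v, hv⟩ := h.2 (r y)
    simp only at hv
    have hr : r (ζ⁻¹ • (y + e (D.dirichletInverse v))) = v := by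
      rw [map_smul, map_add, hre, ← hv, sub_add_cancel, smul_smul, inv_mul_cancel₀ h0, one_smul]
    refine ⟨ζ⁻¹ • (y + e (D.dirichletInverse v)), ?_⟩
    simp only [hA, hr, smul_smul, mul_inv_cancel₀ h0, one_smul, add_sub_cancel_right]

/-- Extension by zero can add only the point `0`, which compactness has already placed in the
Dirichlet spectrum. -/
lemma spectrum_blochOp_zero_subset [Nontrivial D.L2D] :
    spectrum ℂ (blochOp α D 0) ⊆ spectrum ℂ D.dirichletInverse := by
  intro ζ hζ h
  by_cases h0 : ζ = 0
  · exact zero_mem_spectrum_dirichletInverse α D (h0 ▸ h)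
  · exact hζ (mem_resolventSet_blochOp_zero α D h0 h)

lemma mem_spectrum_blochOp_zero {β : ℂ}
    (hβ : Module.End.HasEigenvalue (D.dirichletInverse : D.L2D →ₗ[ℂ] D.L2D) β) :
    β ∈ spectrum ℂ (blochOp α D 0) := by
  obtain ⟨f, hf⟩ := hβ.exists_hasEigenvector
  intro h
  have h1 := ((mem_resolventSet_iff_bijective _ _).1 h).1
  refine hf.2 ?_
  set e := ContinuousLinearMap.adjoint (restrictTo D.carrier)
  have h2 : blochOp α D 0 (e f) = β • e f := by
    rw [blochOp_zero, ← map_smul]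
    have := hf.apply_eq_smul
    change e (D.dirichletInverse (restrictTo D.carrier (e f))) = _
    rw [restrict_adjoint]
    exact congrArg e this
  have h3 : e f = 0 := h1 (by simp [h2])
  rw [← restrict_adjoint D f]
  change restrictTo D.carrier (e f) = 0
  rw [h3, map_zero]

/-- `W₁` and `W₂` are orthogonal. -/
lemma inner_W1_W2 {u w : H1 α} (hu : u ∈ W1 α D) (hw : w ∈ W2 α D) : inner ℂ u w = (0 : ℂ) := by
  have hle : W1 α D ≤ (W2 α D)ᗮ := by
    refine Submodule.topologicalClosure_minimal _ (Submodule.span_le.2 ?_)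
      (Submodule.isClosed_orthogonal _)
    rintro u ⟨V, hV, hDV, hu⟩ w hw
    rw [← inner_conj_symm, H1.inner_eq_sum]
    let L : L2 n × VecL2 n →L[ℂ] ℂ :=
      innerSL ℂ (H1.grad α u) ∘L ContinuousLinearMap.snd ℂ (L2 n) (VecL2 n)
    have hL : ∀ p, L p = ∑ j, (inner ℂ (H1.grad α u j) (p.2 j) : ℂ) := fun p =>
      PiLp.inner_apply (H1.grad α u) p.2
    have h : h10Graph D.carrier ≤ L.ker := by
      refine h10Graph_le_of_bump L.isClosed_ker fun p φ hφ h1 h2 => ?_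
      rw [LinearMap.mem_ker]
      change L p = 0
      rw [hL]
      refine Finset.sum_eq_zero fun j _ => ?_
      -- `∂_j φ` is again a test function in `D`, so a second integration by parts pairs `u` itself
      -- with `∂_j ∂_j φ`, and their supports do not meet.
      obtain ⟨q, hq, hq1, hq2⟩ :=
        (hφ.fderiv_apply (EuclideanSpace.single j 1)).exists_mem_h10Graph
      have hpq : p.2 j = q.1 := Lp.ext ((h2 j).trans hq1.symm)
      rw [hpq, inner_gradient_left (mem_h1Graph α u) (h10Graph_le D.subset_cell α.vec hq) j,
        neg_eq_zero, L2.inner_def]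
      refine integral_eq_zero_of_ae ?_
      filter_upwards [hu, hq2 j] with x hx1 hx2
      by_cases hxV : x ∈ V
      · rw [hx1 hxV, inner_zero_left]
        rfl
      · have hxD : fderiv ℝ (fun y => fderiv ℝ φ y (EuclideanSpace.single j 1)) x
            (EuclideanSpace.single j 1) = 0 := by
          rw [image_eq_zero_of_notMem_tsupport fun h => hxV (hDV (subset_closure
            ((hφ.fderiv_apply _).support (tsupport_fderiv_subset ℝ h)))), zero_apply]
        rw [hx2, hxD, inner_zero_right]
        rfl
    have h1 : L (H1.toL2 α w, H1.grad α w) = 0 := h hw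
    rw [hL] at h1
    rw [h1, map_zero]
  exact Submodule.inner_left_of_mem_orthogonal hw (hle hu)

end Subspaces

/-! ### Resolvent bound for self-adjoint elements. -/

section Resolvent

/-- The resolvent of a self-adjoint element is bounded by the inverse distance to the spectrum. -/
lemma norm_resolvent_le_of_isSelfAdjoint {𝔄 : Type*} [CStarAlgebra 𝔄] [Nontrivial 𝔄] {a : 𝔄}
    (ha : IsSelfAdjoint a) {ζ : ℂ} (hζ : ζ ∈ resolventSet ℂ a) {d : ℝ} (hd : 0 < d)
    (h : d ≤ Metric.infDist ζ (spectrum ℂ a)) : ‖resolvent a ζ‖ ≤ d⁻¹ := by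
  set R := resolvent a ζ
  have h1 : Commute a R := Contour.commute_resolvent (Commute.refl a) ζ
  have h2 : Commute (star R) a := by
    have := h1.star_star
    rw [ha.star_eq] at this
    exact this.symm
  have hn : IsStarNormal R := ⟨Contour.commute_resolvent h2 ζ⟩
  -- The resolvent is normal, so its norm is attained by a spectral value `w`; then `w⁻¹ = ζ - l`
  -- with `l` in the spectrum of `a`.
  obtain ⟨w, hw, hwn⟩ := spectrum.exists_nnnorm_eq_spectralRadius R
  rw [IsStarNormal.spectralRadius_eq_nnnorm] at hwn
  have hwn' : ‖w‖ = ‖R‖ := by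
    have : ‖w‖₊ = ‖R‖₊ := by exact_mod_cast hwn
    exact congrArg NNReal.toReal this
  have hR : R = ((hζ.unit⁻¹ : 𝔄ˣ) : 𝔄) := Ring.inverse_of_isUnit hζ
  have hw0 : w ≠ 0 := by
    rintro rfl
    rw [spectrum.zero_mem_iff, hR] at hw
    exact hw (Units.isUnit _)
  have h3 : w⁻¹ ∈ spectrum ℂ (algebraMap ℂ 𝔄 ζ - a) := by
    have h4 := (spectrum.inv_mem_iff (R := ℂ) (r := Units.mk0 w hw0) (a := hζ.unit⁻¹)).1 (by
      rw [← hR]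
      exact hw)
    rw [inv_inv, Units.val_inv_eq_inv_val, Units.val_mk0] at h4
    exact h4
  rw [← spectrum.singleton_sub_eq, singleton_sub, mem_image] at h3
  obtain ⟨l, hl, hlw⟩ := h3
  have h5 := Metric.infDist_le_dist_of_mem (x := ζ) hl
  have hlw' : ζ - l = w⁻¹ := hlw
  rw [dist_eq_norm, hlw', norm_inv, hwn'] at h5
  exact (le_inv_comm₀ hd (by rw [← hwn']; positivity)).1 (h.trans h5)

end Resolvent

/-! ### Extremals for a compressed compact operator. -/

section Slack

variable {E F : Type*} [NormedAddCommGroup E] [InnerProductSpace ℂ E] [CompleteSpace E]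
  [NormedAddCommGroup F] [InnerProductSpace ℂ F] [CompleteSpace F]

/-- If the norm of `Π J*` is as large as that of the compact operator `J`, it is attained. -/
lemma exists_maximizer {J : E →L[ℂ] F} (hJ : IsCompactOperator J) {c : ℝ} (hc : 0 < c)
    (hJc : ‖J‖ ≤ c) {U : Submodule ℂ E} [U.HasOrthogonalProjection]
    (h : c ≤ ‖U.starProjection ∘L ContinuousLinearMap.adjoint J‖) :
    ∃ (f : F) (w : E) (l : ℂ), f ≠ 0 ∧ f = l • J w ∧ ‖J w‖ = c * ‖w‖ ∧
      ContinuousLinearMap.adjoint J f ∈ U := by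
  set B := U.starProjection ∘L ContinuousLinearMap.adjoint J
  set S : F →L[ℂ] F := J ∘L B
  have hP : ∀ x, U.starProjection (U.starProjection x) = U.starProjection x := fun x =>
    U.starProjection_eq_self_iff.2 (U.starProjection_apply_mem x)
  have hBS : ContinuousLinearMap.adjoint B ∘L B = S := by
    refine ContinuousLinearMap.ext fun x => ext_inner_right ℂ fun y => ?_
    change inner ℂ (ContinuousLinearMap.adjoint B (B x)) y = inner ℂ (J (B x)) y
    rw [ContinuousLinearMap.adjoint_inner_left, ← ContinuousLinearMap.adjoint_inner_right J]
    change inner ℂ (B x) (U.starProjection _) = _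
    rw [← Submodule.inner_starProjection_left_eq_right]
    change inner ℂ (U.starProjection (U.starProjection _)) _ = _
    rw [hP]
    rfl
  have hSn : ‖S‖ = ‖B‖ * ‖B‖ := by rw [← hBS, ContinuousLinearMap.norm_adjoint_comp_self]
  have hSself : IsSelfAdjoint S := by
    rw [← hBS, ContinuousLinearMap.isSelfAdjoint_iff', ContinuousLinearMap.adjoint_comp,
      ContinuousLinearMap.adjoint_adjoint]
  have hB0 : 0 < ‖B‖ := hc.trans_le h
  have hS0 : 0 < ‖S‖ := by rw [hSn]; positivity
  have : Nontrivial F := by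
    by_contra hF
    rw [not_nontrivial_iff_subsingleton] at hF
    have : S = 0 := Subsingleton.elim _ _
    rw [this, norm_zero] at hS0
    exact lt_irrefl _ hS0
  obtain ⟨l, hl, hln⟩ := spectrum.exists_nnnorm_eq_spectralRadius S
  rw [hSself.spectralRadius_eq_nnnorm] at hln
  have hln' : ‖l‖ = ‖S‖ := by
    have : ‖l‖₊ = ‖S‖₊ := by exact_mod_cast hln
    exact congrArg NNReal.toReal this
  have hl0 : l ≠ 0 := norm_pos_iff.1 (hln' ▸ hS0)
  have hScpt : IsCompactOperator S := hJ.comp_clm B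
  obtain ⟨f, hf⟩ := ((hScpt.hasEigenvalue_iff_mem_spectrum hl0).2 hl).exists_hasEigenvector
  have hSf : J (B f) = l • f := hf.apply_eq_smul
  have hBf : ‖B f‖ ≤ ‖ContinuousLinearMap.adjoint J f‖ := U.norm_starProjection_apply_le _
  have h1 : ‖J (B f)‖ ≤ c * ‖B f‖ := (J.le_opNorm _).trans (by gcongr)
  have h2 : ‖ContinuousLinearMap.adjoint J f‖ ≤ c * ‖f‖ := by
    refine (ContinuousLinearMap.le_opNorm _ _).trans ?_
    rw [LinearIsometryEquiv.norm_map]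
    gcongr
  -- This closes the chain `c²‖f‖ ≤ ‖J B f‖ ≤ c‖B f‖ ≤ c‖J* f‖ ≤ c²‖f‖`. Equality throughout makes
  -- `B f` extremal for `J` and forces the projection to preserve the norm of `J* f`.
  have h3 : c * (c * ‖f‖) ≤ ‖J (B f)‖ := by
    rw [hSf, norm_smul, hln', hSn, ← mul_assoc]
    gcongr
  have h4 : c * ‖B f‖ ≤ c * (c * ‖f‖) := by gcongr; exact hBf.trans h2
  refine ⟨f, B f, l⁻¹, hf.2, ?_, le_antisymm h1 (h4.trans h3), ?_⟩
  · rw [hSf, smul_smul, inv_mul_cancel₀ hl0, one_smul]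
  · refine U.mem_iff_norm_starProjection _ |>.2 (le_antisymm hBf ?_)
    refine h2.trans ?_
    exact le_of_mul_le_mul_left (h3.trans h1) hc

end Slack

/-! ### Strictness of the Poincaré inequality off `H¹_0(D)`. -/

section Gap

variable {n : ℕ} (α : BlochVector n) (D : InclusionDomain n)

lemma norm_toL2_le : ‖H1.toL2 α‖ ≤ ‖α.vec‖⁻¹ :=
  ContinuousLinearMap.opNorm_le_bound _ (by positivity) (H1.norm_toL2_le α)

/-- The functions for which the Poincaré inequality is an equality are trigonometric polynomials. -/
lemma toL2_mem_span_of_norm_eq {w : H1 α} (h : ‖H1.toL2 α w‖ = ‖α.vec‖⁻¹ * ‖w‖) :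
    H1.toL2 α w ∈ Submodule.span ℂ (range (waveL2 α.vec)) := by
  have hα : 0 < ‖α.vec‖ := norm_pos_iff.2 α.ne_zero
  -- The deficit in the inequality is a sum of nonnegative terms `(‖2πk + α‖² - ‖α‖²) |ŵ(k)|²`. When
  -- it vanishes, only the finitely many frequencies of minimal norm remain.
  have h1 := (H1.hasSum_norm_sq α w).sub
    ((hasSum_norm_inner_waveL2 α.vec (H1.toL2 α w)).mul_left (‖α.vec‖ ^ 2))
  have h2 : ‖w‖ ^ 2 - ‖α.vec‖ ^ 2 * ‖H1.toL2 α w‖ ^ 2 = 0 := by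
    rw [h]
    field_simp
    ring
  rw [h2] at h1
  have hle : ∀ k, 0 ≤ ‖freq α.vec k‖ ^ 2 - ‖α.vec‖ ^ 2 := fun k => by
    have := norm_le_norm_freq α k
    have := norm_nonneg α.vec
    nlinarith
  simp only [← sub_mul] at h1
  have h3 := (hasSum_zero_iff_of_nonneg fun k => mul_nonneg (hle k) (by positivity)).1 h1
  let s := (finite_norm_freq_le α.vec ‖α.vec‖).toFinset
  have h4 : ∀ k ∉ s, inner ℂ (waveL2 α.vec k) (H1.toL2 α w) = (0 : ℂ) := by
    intro k hk
    have hk' : ‖α.vec‖ < ‖freq α.vec k‖ := by simpa [s] using hk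
    have h5 := congrFun h3 k
    have h6 : 0 < ‖freq α.vec k‖ ^ 2 - ‖α.vec‖ ^ 2 := by nlinarith
    have h7 := (mul_eq_zero.1 h5).resolve_left h6.ne'
    exact norm_eq_zero.1 (pow_eq_zero_iff two_ne_zero |>.1 h7)
  have h5 := (waveBasis α.vec).hasSum_repr (H1.toL2 α w)
  simp only [HilbertBasis.repr_apply_apply, coe_waveBasis] at h5
  have h6 := hasSum_sum_of_ne_finset_zero (L := SummationFilter.unconditional _)
    (f := fun k => (inner ℂ (waveL2 α.vec k) (H1.toL2 α w) : ℂ) • waveL2 α.vec k) (s := s)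
    fun k hk => by rw [h4 k hk, zero_smul]
  rw [h5.unique h6]
  exact Submodule.sum_mem _ fun k _ => Submodule.smul_mem _ _ (Submodule.subset_span ⟨k, rfl⟩)

/-- On the functions orthogonal to `H¹_0(D)` the Poincaré inequality is strict. -/
lemma norm_starProjection_comp_lt [Nontrivial D.L2D] :
    ‖(W2 α D)ᗮ.starProjection ∘L ContinuousLinearMap.adjoint (H1.toL2 α)‖ < ‖α.vec‖⁻¹ := by
  by_contra! h
  obtain ⟨f, w, l, hf0, hfw, hw, hfU⟩ := exists_maximizer (isCompactOperator_toL2 α)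
    (inv_pos.2 (norm_pos_iff.2 α.ne_zero)) (norm_toL2_le α) h
  -- The maximizer is a multiple of an extremal, hence a trigonometric polynomial, and `J* f ⊥ W₂`
  -- says that it vanishes on `D`.
  refine hf0 (eq_zero_of_mem_span_waveL2 D.isOpen D.subset_cell (carrier_nonempty D) (α := α.vec) ?_ ?_)
  · rw [hfw]
    exact Submodule.smul_mem _ _ (toL2_mem_span_of_norm_eq α hw)
  · refine restrictTo_eq_zero_of_bump D.isOpen fun p hp => ?_
    let u : D.H10 := (⟨p, hp⟩ : D.h10.graph)
    have h1 : inner ℂ (ContinuousLinearMap.adjoint (H1.toL2 α) f) (h10Extension α D u) = (0 : ℂ) :=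
      Submodule.inner_left_of_mem_orthogonal (h10Extension_mem α D u) hfU
    rw [ContinuousLinearMap.adjoint_inner_left] at h1
    exact h1

end Gap

/-- Exact second-order remainder of the inverse, applied to every coefficient of the resonance sum
at once. -/
lemma inv_taylor_two {u v : ℂ} (hu : u ≠ 0) (hv : v ≠ 0) :
    v⁻¹ - u⁻¹ + (v - u) * u⁻¹ ^ 2 = (v - u) ^ 2 * u⁻¹ ^ 2 * v⁻¹ := by
  field_simp
  ring

/-! ### Strong sums over mutually orthogonal projections. -/

section StrongSums

variable {E ι : Type*} [NormedAddCommGroup E] [InnerProductSpace ℂ E] [CompleteSpace E]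

/-- A family of mutually orthogonal projections. -/
structure IsOrthogonalProjections (p : ι → E →L[ℂ] E) : Prop where
  symm : ∀ i x y, inner ℂ (p i x) y = (inner ℂ x (p i y) : ℂ)
  idem : ∀ i x, p i (p i x) = p i x
  orth : ∀ i j, i ≠ j → ∀ x, p i (p j x) = 0

namespace IsOrthogonalProjections

variable {p : ι → E →L[ℂ] E}

omit [CompleteSpace E] in
lemma orthogonalFamily (hp : IsOrthogonalProjections p) :
    OrthogonalFamily ℂ (fun i => (p i).range) fun i => (p i).range.subtypeₗᵢ := by
  rintro i j hij ⟨_, x, rfl⟩ ⟨_, y, rfl⟩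
  change inner ℂ (p i x) (p j y) = 0
  rw [hp.symm, hp.orth i j hij, inner_zero_right]

omit [CompleteSpace E] in
lemma norm_sq_sum (hp : IsOrthogonalProjections p) (c : ι → ℂ) (s : Finset ι) (x : E) :
    ‖∑ i ∈ s, c i • p i x‖ ^ 2 = ∑ i ∈ s, ‖c i‖ ^ 2 * ‖p i x‖ ^ 2 := by
  have h := hp.orthogonalFamily.norm_sum (fun i => c i • (⟨p i x, x, rfl⟩ : (p i).range)) s
  simpa [norm_smul, mul_pow] using h

omit [CompleteSpace E] in
/-- Bessel's inequality. -/
lemma sum_norm_sq_le (hp : IsOrthogonalProjections p) (s : Finset ι) (x : E) :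
    ∑ i ∈ s, ‖p i x‖ ^ 2 ≤ ‖x‖ ^ 2 := by
  have h1 := hp.norm_sq_sum (fun _ => 1) s x
  simp only [one_smul, norm_one, one_pow, one_mul] at h1
  set y := ∑ i ∈ s, p i x
  have h2 : (inner ℂ y x : ℂ) = ((∑ i ∈ s, ‖p i x‖ ^ 2 : ℝ) : ℂ) := by
    rw [sum_inner, Complex.ofReal_sum]
    refine Finset.sum_congr rfl fun i _ => ?_
    rw [← hp.idem, hp.symm, hp.idem, inner_self_eq_norm_sq_to_K]
    norm_cast
  have h3 : ‖y‖ ^ 2 ≤ ‖y‖ * ‖x‖ := by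
    rw [h1]
    refine le_trans ?_ (norm_inner_le_norm (𝕜 := ℂ) y x)
    rw [h2, Complex.norm_real]
    exact le_abs_self _
  have h4 : ‖y‖ ≤ ‖x‖ := by
    rcases (norm_nonneg y).eq_or_lt with h | h
    · rw [← h]; exact norm_nonneg x
    · nlinarith
  rw [← h1]
  gcongr

omit [CompleteSpace E] in
lemma norm_sum_le (hp : IsOrthogonalProjections p) {c : ι → ℂ} {M : ℝ} (hM0 : 0 ≤ M)
    (hM : ∀ i, ‖c i‖ ≤ M) (s : Finset ι) (x : E) : ‖∑ i ∈ s, c i • p i x‖ ≤ M * ‖x‖ := by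
  refine le_of_sq_le_sq ?_ (by positivity)
  rw [hp.norm_sq_sum, mul_pow]
  calc ∑ i ∈ s, ‖c i‖ ^ 2 * ‖p i x‖ ^ 2 ≤ ∑ i ∈ s, M ^ 2 * ‖p i x‖ ^ 2 := by
        gcongr with i _
        exact hM i
    _ = M ^ 2 * ∑ i ∈ s, ‖p i x‖ ^ 2 := by rw [Finset.mul_sum]
    _ ≤ M ^ 2 * ‖x‖ ^ 2 := by gcongr; exact hp.sum_norm_sq_le s x

lemma summable (hp : IsOrthogonalProjections p) {c : ι → ℂ} {M : ℝ} (hM : ∀ i, ‖c i‖ ≤ M) (x : E) :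
    Summable fun i => c i • p i x := by
  have h := (hp.orthogonalFamily.summable_iff_norm_sq_summable
    (fun i => c i • (⟨p i x, x, rfl⟩ : (p i).range))).2 ?_
  · simpa using h
  have h1 : Summable fun i => ‖p i x‖ ^ 2 :=
    summable_of_sum_le (fun _ => by positivity) fun s => hp.sum_norm_sq_le s x
  refine Summable.of_nonneg_of_le (fun _ => by positivity) (fun i => ?_) (h1.mul_left (M ^ 2))
  rw [norm_smul, mul_pow]
  have := hM i
  gcongr
  rfl

/-- A bounded family of multiples of mutually orthogonal projections is strongly summable. -/
lemma exists_hasSum (hp : IsOrthogonalProjections p) {c : ι → ℂ} {M : ℝ} (hM0 : 0 ≤ M)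
    (hM : ∀ i, ‖c i‖ ≤ M) :
    ∃ S : E →L[ℂ] E, (∀ x, HasSum (fun i => c i • p i x) (S x)) ∧ ‖S‖ ≤ M := by
  have hs := hp.summable hM
  let L : E →ₗ[ℂ] E :=
    { toFun := fun x => ∑' i, c i • p i x
      map_add' := fun x y => by
        rw [← (hs x).tsum_add (hs y)]
        simp only [map_add, smul_add]
      map_smul' := fun a x => by
        rw [RingHom.id_apply, ← (hs x).tsum_const_smul]
        simp only [map_smul, smul_comm a] }
  have hb : ∀ x, ‖L x‖ ≤ M * ‖x‖ := fun x =>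
    le_of_tendsto (hs x).hasSum.norm (Eventually.of_forall fun s => hp.norm_sum_le hM0 hM s x)
  exact ⟨L.mkContinuous M hb, fun x => (hs x).hasSum, L.mkContinuous_norm_le hM0 hb⟩

/-- Adding a further orthogonal projection. -/
lemma norm_add_le (hp : IsOrthogonalProjections p) {c : ι → ℂ} {M : ℝ} (hM1 : 1 ≤ M)
    (hM : ∀ i, ‖c i‖ ≤ M) {S q : E →L[ℂ] E} (hS : ∀ x, HasSum (fun i => c i • p i x) (S x))
    (hq : ∀ x y, inner ℂ (q x) y = (inner ℂ x (q y) : ℂ)) (hqq : ∀ x, q (q x) = q x)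
    (hqp : ∀ i x, q (p i x) = 0) (hpq : ∀ i x, p i (q x) = 0) : ‖q + S‖ ≤ M := by
  have hM0 : 0 ≤ M := zero_le_one.trans hM1
  -- The extra projection takes the index `none` with coefficient `1`, which is why `M ≥ 1` is
  -- required.
  have hp' : IsOrthogonalProjections fun o : Option ι => o.elim q p := by
    refine ⟨fun o => ?_, fun o => ?_, fun o o' h x => ?_⟩
    · cases o; exacts [hq, hp.symm _]
    · cases o; exacts [hqq, hp.idem _]
    · cases o <;> cases o'
      · exact absurd rfl h
      · exact hqp _ _
      · exact hpq _ _
      · exact hp.orth _ _ (fun h' => h (congrArg some h')) _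
  obtain ⟨S', hS', hSn⟩ := hp'.exists_hasSum (c := fun o : Option ι => o.elim 1 c) hM0 (by
    rintro (_ | i)
    · simpa using hM1
    · exact hM i)
  have : q + S = S' := by
    ext x
    have h1 := (hS x)
    have h2 : HasSum (fun o : Option ι => (o.elim 1 c : ℂ) • (o.elim q p : E →L[ℂ] E) x)
        (q x + S x) := by
      have h3 := Function.Injective.hasSum_iff (f := fun o : Option ι => o.elim 0 fun i => c i • p i x)
        (Option.some_injective ι) (a := S x) (by
          rintro (_ | i) hi
          · rfl
          · exact absurd ⟨i, rfl⟩ hi)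
      have h4 := h3.1 h1
      have h5 := hasSum_single (f := fun o : Option ι => o.elim (q x) fun _ => 0) none (by
          rintro (_ | i) hi
          · exact absurd rfl hi
          · rfl)
      refine (h5.add h4).congr_fun fun o => ?_
      cases o <;> simp
    exact h2.unique (hS' x)
  rw [this]
  exact hSn

/-- Strong sums of `(a_i + z b_i)⁻¹ p_i` are holomorphic in `z`. -/
lemma differentiableAt (hp : IsOrthogonalProjections p) {a b : ι → ℂ} {U : Set ℂ} (hU : IsOpen U)
    {M : ℝ} (hM0 : 0 ≤ M) (hb : ∀ i, ‖b i‖ ≤ 1) (hne : ∀ w ∈ U, ∀ i, a i + w * b i ≠ 0)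
    (hM : ∀ w ∈ U, ∀ i, ‖(a i + w * b i)⁻¹‖ ≤ M) {S : ℂ → E →L[ℂ] E}
    (hS : ∀ w ∈ U, ∀ x, HasSum (fun i => (a i + w * b i)⁻¹ • p i x) (S w x)) {z : ℂ} (hz : z ∈ U) :
    DifferentiableAt ℂ S z := by
  -- The series is differentiated termwise. The sums converge only strongly, but the remainder is
  -- again such a sum with coefficients at most `M³`, so differentiability holds in operator norm.
  obtain ⟨D, hD, -⟩ := hp.exists_hasSum (c := fun i => -(b i * (a i + z * b i)⁻¹ ^ 2)) (M := M ^ 2)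
    (by positivity) fun i => by
      rw [norm_neg, norm_mul, norm_pow]
      have h1 := hb i
      have h2 := hM z hz i
      calc ‖b i‖ * ‖(a i + z * b i)⁻¹‖ ^ 2 ≤ 1 * M ^ 2 := by gcongr
        _ = M ^ 2 := one_mul _
  have hR : ∀ w ∈ U, ‖S w - S z - (w - z) • D‖ ≤ M ^ 3 * ‖(w - z) ^ 2‖ := by
    intro w hw
    obtain ⟨R, hR, hRn⟩ := hp.exists_hasSum
      (c := fun i => b i ^ 2 * (a i + z * b i)⁻¹ ^ 2 * (a i + w * b i)⁻¹) (M := M ^ 3)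
      (by positivity) fun i => by
        rw [norm_mul, norm_mul, norm_pow, norm_pow]
        have h1 := hb i
        have h2 := hM z hz i
        have h3 := hM w hw i
        calc ‖b i‖ ^ 2 * ‖(a i + z * b i)⁻¹‖ ^ 2 * ‖(a i + w * b i)⁻¹‖ ≤ 1 ^ 2 * M ^ 2 * M := by
              gcongr
          _ = M ^ 3 := by ring
    have h : S w - S z - (w - z) • D = (w - z) ^ 2 • R := by
      ext x
      refine (((hS w hw x).sub (hS z hz x)).sub ((hD x).const_smul (w - z))).unique ?_
      refine ((hR x).const_smul ((w - z) ^ 2)).congr_fun fun i => ?_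
      rw [smul_smul, smul_smul, ← sub_smul, ← sub_smul]
      congr 1
      have h1 := hne z hz i
      have h2 := hne w hw i
      have h3 := inv_taylor_two h1 h2
      linear_combination h3
    rw [h, norm_smul, mul_comm]
    gcongr
  have hO : (fun w => S w - S z - (w - z) • D) =O[𝓝 z] fun w => (w - z) ^ 2 :=
    Asymptotics.IsBigO.of_bound (M ^ 3) (by filter_upwards [hU.mem_nhds hz] with w hw using hR w hw)
  have ho : (fun w : ℂ => (w - z) ^ 2) =o[𝓝 z] fun w => w - z := by
    have h1 : Tendsto (fun w : ℂ => w - z) (𝓝 z) (𝓝 0) := by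
      have : ContinuousAt (fun w : ℂ => w - z) z := by fun_prop
      simpa [ContinuousAt] using this
    simpa [Function.comp_def] using
      (Asymptotics.isLittleO_pow_id (𝕜 := ℂ) (one_lt_two)).comp_tendsto h1
  exact (hasDerivAt_iff_isLittleO.2 (hO.trans_isLittleO ho)).differentiableAt

end IsOrthogonalProjections

omit [CompleteSpace E] in
lemma strong_tsum_eq {c : ι → ℂ} {p : ι → E →L[ℂ] E} {S : E →L[ℂ] E}
    (hS : ∀ x, HasSum (fun i => c i • p i x) (S x)) :
    (UniformConvergenceCLM.ofFun (RingHom.id ℂ) E {s : Set E | Finite s}).symm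
      (∑' i, c i • ContinuousLinearMap.toPointwiseConvergenceCLM ℂ (RingHom.id ℂ) E E (p i)) = S := by
  have h : HasSum (fun i => c i • ContinuousLinearMap.toPointwiseConvergenceCLM ℂ (RingHom.id ℂ) E E (p i))
      (ContinuousLinearMap.toPointwiseConvergenceCLM ℂ (RingHom.id ℂ) E E S) := by
    rw [HasSum, PointwiseConvergenceCLM.tendsto_iff_forall_tendsto]
    intro x
    have := hS x
    rw [HasSum] at this
    refine this.congr fun s => ?_
    simp
    rfl
  rw [h.tsum_eq]
  rfl

end StrongSums

/-! ### Eigenprojections of a symmetric operator on a subspace. -/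

section EigenProjections

variable {E : Type*} [NormedAddCommGroup E] [InnerProductSpace ℂ E]
  (W : Submodule ℂ E) [CompleteSpace W] (T : W →L[ℂ] W)

/-- The orthogonal projection of `E` onto the eigenspace of an operator on a subspace. -/
noncomputable def eigenProj (μ : ℝ) : E →L[ℂ] E :=
  W.subtypeL ∘L (T - (μ : ℂ) • ContinuousLinearMap.id ℂ W).ker.starProjection ∘L
    W.orthogonalProjectionOnto

lemma eigenProj_apply (μ : ℝ) (x : E) : eigenProj W T μ x =
    ((T - (μ : ℂ) • ContinuousLinearMap.id ℂ W).ker.starProjection (W.orthogonalProjectionOnto x) : W) :=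
  rfl

lemma eigenProj_mem (μ : ℝ) (x : E) : eigenProj W T μ x ∈ W := Subtype.mem _

lemma orthogonalProjectionOnto_eigenProj (μ : ℝ) (x : E) :
    W.orthogonalProjectionOnto (eigenProj W T μ x) =
      (T - (μ : ℂ) • ContinuousLinearMap.id ℂ W).ker.starProjection (W.orthogonalProjectionOnto x) := by
  rw [eigenProj_apply, Submodule.orthogonalProjectionOnto_mem_subspace_eq_self]

lemma eigenProj_of_mem_orthogonal (μ : ℝ) {x : E} (hx : x ∈ Wᗮ) : eigenProj W T μ x = 0 := by
  rw [eigenProj_apply, Submodule.orthogonalProjectionOnto_apply_of_mem_orthogonal hx, map_zero,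
    ZeroMemClass.coe_zero]

lemma inner_eigenProj (μ : ℝ) (x y : E) :
    inner ℂ (eigenProj W T μ x) y = (inner ℂ x (eigenProj W T μ y) : ℂ) := by
  rw [eigenProj_apply, eigenProj_apply,
    ← Submodule.inner_orthogonalProjectionOnto_eq_of_mem_left,
    Submodule.inner_starProjection_left_eq_right,
    Submodule.inner_orthogonalProjectionOnto_eq_of_mem_right]

lemma eigenProj_idem (μ : ℝ) (x : E) : eigenProj W T μ (eigenProj W T μ x) = eigenProj W T μ x := by
  rw [eigenProj_apply, orthogonalProjectionOnto_eigenProj, eigenProj_apply]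
  congr 1
  exact Submodule.starProjection_eq_self_iff.2 (Submodule.starProjection_apply_mem _ _)

lemma eigenProj_orth {T : W →L[ℂ] W} (hT : ∀ u v, inner ℂ (T u) v = (inner ℂ u (T v) : ℂ)) {μ ν : ℝ}
    (h : μ ≠ ν) (x : E) : eigenProj W T μ (eigenProj W T ν x) = 0 := by
  rw [eigenProj_apply, orthogonalProjectionOnto_eigenProj]
  set v := (T - (ν : ℂ) • ContinuousLinearMap.id ℂ W).ker.starProjection (W.orthogonalProjectionOnto x)
    with hv
  have hvm : T v = (ν : ℂ) • v := by
    have : v ∈ (T - (ν : ℂ) • ContinuousLinearMap.id ℂ W).ker :=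
      Submodule.starProjection_apply_mem _ _
    simpa [sub_eq_zero] using this
  have h0 : (T - (μ : ℂ) • ContinuousLinearMap.id ℂ W).ker.starProjection v = 0 := by
    rw [Submodule.starProjection_apply_eq_zero_iff]
    intro u hu
    have hum : T u = (μ : ℂ) • u := by simpa [sub_eq_zero] using hu
    have h1 := hT u v
    rw [hum, hvm, inner_smul_left, inner_smul_right, Complex.conj_ofReal] at h1
    have h2 : ((μ : ℂ) - ν) * inner ℂ u v = 0 := by linear_combination h1
    exact (mul_eq_zero.1 h2).resolve_left (sub_ne_zero.2 (by exact_mod_cast h))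
  rw [h0, ZeroMemClass.coe_zero]

end EigenProjections

section Symmetric

variable {E F : Type*} [NormedAddCommGroup E] [InnerProductSpace ℂ E] [CompleteSpace E]
  [NormedAddCommGroup F] [InnerProductSpace ℂ F] [CompleteSpace F]

lemma inner_sum_adjoint_comp {ι : Type*} [Fintype ι] (p : ι → E →L[ℂ] F) (u v : E) :
    inner ℂ ((∑ j, ContinuousLinearMap.adjoint (p j) ∘L p j) u) v =
      (inner ℂ u ((∑ j, ContinuousLinearMap.adjoint (p j) ∘L p j) v) : ℂ) := by
  simp only [sum_apply, ContinuousLinearMap.comp_apply, sum_inner, inner_sum,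
    ContinuousLinearMap.adjoint_inner_left, ContinuousLinearMap.adjoint_inner_right]

omit [CompleteSpace E] in
lemma inner_compression (W : Submodule ℂ E) [CompleteSpace W] {B C : E →L[ℂ] E}
    (hB : ∀ u v, inner ℂ (B u) v = (inner ℂ u (B v) : ℂ))
    (hC : ∀ u v, inner ℂ (C u) v = (inner ℂ u (C v) : ℂ)) {a : ℂ} (ha : conj a = a) (u v : W) :
    inner ℂ ((W.orthogonalProjectionOnto ∘L (a • B - a • C) ∘L W.subtypeL) u) v =
      (inner ℂ u ((W.orthogonalProjectionOnto ∘L (a • B - a • C) ∘L W.subtypeL) v) : ℂ) := by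
  simp only [ContinuousLinearMap.comp_apply]
  rw [Submodule.inner_orthogonalProjectionOnto_eq_of_mem_right,
    Submodule.inner_orthogonalProjectionOnto_eq_of_mem_left]
  simp [inner_sub_left, inner_sub_right, inner_smul_left, inner_smul_right, hB, hC, ha]

end Symmetric

/-! ### Norm of an operator sandwiched between `J` and `J*`. -/

section Compression

variable {E F : Type*} [NormedAddCommGroup E] [InnerProductSpace ℂ E] [CompleteSpace E]
  [NormedAddCommGroup F] [InnerProductSpace ℂ F] [CompleteSpace F]

/-- The norm of `J C J†` when `C` lives on the orthogonal complement of `V`. -/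
lemma norm_comp_comp_adjoint_le (J : E →L[ℂ] F) (V : Submodule ℂ E) [CompleteSpace V] {C : E →L[ℂ] E}
    (hl : ∀ x, V.starProjection (C x) = 0) (hr : ∀ x, C (V.starProjection x) = 0) :
    ‖J ∘L C ∘L ContinuousLinearMap.adjoint J‖ ≤
      ‖C‖ * ‖Vᗮ.starProjection ∘L ContinuousLinearMap.adjoint J‖ ^ 2 := by
  have hl' : ∀ x, Vᗮ.starProjection (C x) = C x := fun x => by
    have := Submodule.starProjection_add_starProjection_orthogonal (K := V) (C x)
    rwa [hl, zero_add] at this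
  have hr' : ∀ x, C (Vᗮ.starProjection x) = C x := fun x => by
    conv_rhs => rw [← Submodule.starProjection_add_starProjection_orthogonal (K := V) x]
    rw [map_add, hr, zero_add]
  set B := Vᗮ.starProjection ∘L ContinuousLinearMap.adjoint J with hB
  have h : J ∘L C ∘L ContinuousLinearMap.adjoint J = ContinuousLinearMap.adjoint B ∘L C ∘L B := by
    ext x
    refine ext_inner_right ℂ fun y => ?_
    simp only [ContinuousLinearMap.comp_apply, ContinuousLinearMap.adjoint_inner_left, hB]
    rw [← Submodule.inner_starProjection_left_eq_right, hl', hr',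
      ContinuousLinearMap.adjoint_inner_right]
  rw [h]
  calc ‖ContinuousLinearMap.adjoint B ∘L C ∘L B‖ ≤ ‖ContinuousLinearMap.adjoint B‖ * (‖C‖ * ‖B‖) :=
        (ContinuousLinearMap.opNorm_comp_le _ _).trans
          (mul_le_mul_of_nonneg_left (ContinuousLinearMap.opNorm_comp_le _ _) (norm_nonneg _))
    _ = ‖C‖ * ‖B‖ ^ 2 := by
        rw [LinearIsometryEquiv.norm_map]; ring

end Compression

/-! ### Bounds for the resonance coefficients. -/

section Coefficients

/-- The coefficient of the resonance `μ` in the multiplier. -/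
noncomputable def resonanceCoeff (μ : ℝ) (w : ℂ) : ℂ := ((1 / 2 + μ : ℝ) : ℂ) + w * ((1 / 2 - μ : ℝ) : ℂ)

/-- The reverse triangle inequality gives `(1/2 + μ) - ‖w‖ (1/2 - μ)`, which increases with `μ`, so
the lowest resonance is the worst. The quotient is `|z*|`, the modulus of the pole belonging to it.
-/
lemma le_norm_resonanceCoeff {μm μ : ℝ} (hm : μm < 1 / 2) (h1 : μm ≤ μ) (h2 : μ < 1 / 2) (h3 : -1 / 2 < μm) (w : ℂ) :
    (1 / 2 - μm) * ((μm + 1 / 2) / (1 / 2 - μm) - ‖w‖) ≤ ‖resonanceCoeff μ w‖ := by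
  have h4 : ‖((1 / 2 + μ : ℝ) : ℂ)‖ = 1 / 2 + μ := by
    rw [Complex.norm_real, Real.norm_of_nonneg (by linarith)]
  have h5 : ‖w * ((1 / 2 - μ : ℝ) : ℂ)‖ = ‖w‖ * (1 / 2 - μ) := by
    rw [norm_mul, Complex.norm_real, Real.norm_of_nonneg (by linarith)]
  have h6 := norm_sub_le_norm_add ((1 / 2 + μ : ℝ) : ℂ) (w * ((1 / 2 - μ : ℝ) : ℂ))
  rw [h4, h5] at h6
  refine le_trans ?_ h6
  rw [mul_sub, mul_div_cancel₀ _ (by linarith : (1 / 2 - μm) ≠ 0)]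
  nlinarith [norm_nonneg w]

lemma norm_resonanceCoeff_inv_le {μm μ : ℝ} (hm : μm < 1 / 2) (h1 : μm ≤ μ) (h2 : μ < 1 / 2)
    (h3 : -1 / 2 < μm) {w : ℂ} {Z : ℝ} (hw : ‖w‖ ≤ Z) (hZ : Z < (μm + 1 / 2) / (1 / 2 - μm)) :
    ‖(resonanceCoeff μ w)⁻¹‖ ≤ (1 / (1 / 2 - μm)) / ((μm + 1 / 2) / (1 / 2 - μm) - Z) := by
  have h4 := le_norm_resonanceCoeff hm h1 h2 h3 w
  have h5 : 0 < (1 / 2 - μm) * ((μm + 1 / 2) / (1 / 2 - μm) - Z) :=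
    mul_pos (by linarith) (by linarith)
  rw [norm_inv, div_div, one_div]
  refine inv_anti₀ h5 (le_trans ?_ h4)
  have : 0 < 1 / 2 - μm := by linarith
  gcongr

end Coefficients

/-! ### Mutual orthogonality of the projections in the multiplier. -/

section Multiplier

variable {n : ℕ} (α : BlochVector n) (D : InclusionDomain n)

lemma inner_resonanceOp (u v : W3 α D) :
    inner ℂ (resonanceOp α D u) v = (inner ℂ u (resonanceOp α D v) : ℂ) := by
  exact inner_compression (W3 α D) (inner_sum_adjoint_comp _) (inner_sum_adjoint_comp _)
    (Complex.conj_eq_iff_im.2 (by norm_num)) u v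

lemma isOrthogonalProjections_resonanceProj {q : ℝ → Prop} :
    IsOrthogonalProjections fun μ : {μ : ℝ // q μ} => resonanceProj α D μ :=
  ⟨fun _ => inner_eigenProj _ _ _, fun _ => eigenProj_idem _ _ _,
    fun _ _ h => eigenProj_orth _ (inner_resonanceOp α D) fun h' => h (Subtype.ext h')⟩

lemma starProjection_W1_resonanceProj (μ : ℝ) (x : H1 α) :
    (W1 α D).starProjection (resonanceProj α D μ x) = 0 := by
  rw [Submodule.starProjection_apply_eq_zero_iff]
  exact Submodule.orthogonal_le le_sup_left (eigenProj_mem (W3 α D) (resonanceOp α D) μ x)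

lemma P2_resonanceProj (μ : ℝ) (x : H1 α) : P2 α D (resonanceProj α D μ x) = 0 := by
  rw [P2, Submodule.starProjection_apply_eq_zero_iff]
  exact Submodule.orthogonal_le le_sup_right (eigenProj_mem (W3 α D) (resonanceOp α D) μ x)

lemma resonanceProj_starProjection_W1 (μ : ℝ) (x : H1 α) :
    resonanceProj α D μ ((W1 α D).starProjection x) = 0 :=
  eigenProj_of_mem_orthogonal _ _ _ (Submodule.le_orthogonal_orthogonal _
    (Submodule.mem_sup_left (Submodule.starProjection_apply_mem _ _)))

lemma resonanceProj_P2 (μ : ℝ) (x : H1 α) : resonanceProj α D μ (P2 α D x) = 0 :=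
  eigenProj_of_mem_orthogonal _ _ _ (Submodule.le_orthogonal_orthogonal _
    (Submodule.mem_sup_right (Submodule.starProjection_apply_mem _ _)))

lemma P1_apply (x : H1 α) :
    P1 α D x = (W1 α D).starProjection x + resonanceProj α D (1 / 2) x := rfl

lemma inner_P1 (x y : H1 α) : inner ℂ (P1 α D x) y = (inner ℂ x (P1 α D y) : ℂ) := by
  rw [P1_apply, P1_apply, inner_add_left, inner_add_right,
    Submodule.inner_starProjection_left_eq_right]
  congr 1
  exact inner_eigenProj _ _ _ _ _

lemma P1_idem (x : H1 α) : P1 α D (P1 α D x) = P1 α D x := by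
  rw [P1_apply, P1_apply, map_add, map_add, starProjection_W1_resonanceProj,
    resonanceProj_starProjection_W1, add_zero, zero_add]
  congr 1
  · exact Submodule.starProjection_eq_self_iff.2 (Submodule.starProjection_apply_mem _ _)
  · exact eigenProj_idem _ _ _ _

lemma P1_resonanceProj {μ : ℝ} (h : μ < 1 / 2) (x : H1 α) : P1 α D (resonanceProj α D μ x) = 0 := by
  rw [P1_apply, starProjection_W1_resonanceProj, zero_add]
  exact eigenProj_orth _ (inner_resonanceOp α D) h.ne' x

lemma resonanceProj_P1 {μ : ℝ} (h : μ < 1 / 2) (x : H1 α) : resonanceProj α D μ (P1 α D x) = 0 := by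
  rw [P1_apply, map_add, resonanceProj_starProjection_W1, zero_add]
  exact eigenProj_orth _ (inner_resonanceOp α D) h.ne x

lemma P1_P2 (x : H1 α) : P1 α D (P2 α D x) = 0 := by
  rw [P1_apply, resonanceProj_P2, add_zero, Submodule.starProjection_apply_eq_zero_iff]
  exact fun u hu => inner_W1_W2 α D hu (Submodule.starProjection_apply_mem _ _)

lemma P2_P1 (x : H1 α) : P2 α D (P1 α D x) = 0 := by
  rw [P1_apply, map_add, P2_resonanceProj, add_zero, P2, Submodule.starProjection_apply_eq_zero_iff]
  exact fun u hu => inner_eq_zero_symm.1 (inner_W1_W2 α D (Submodule.starProjection_apply_mem _ _) hu)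

end Multiplier

/-! ### The family `A(z)`: difference from `A(0)`, norm bound and holomorphy. -/

section OperatorPencil

variable {E F : Type*} [NormedAddCommGroup E] [NormedSpace ℂ E] [NormedAddCommGroup F] [NormedSpace ℂ F]

lemma pencil_eq (P Q S : E →L[ℂ] E) (z : ℂ) : z • P + Q + z • S = z • (P + S) + Q := by
  rw [smul_add, add_right_comm]

/-- `C'` is the value at `z = 0`; multiplied by zero, it drops out. -/
lemma comp_pencil_comp_sub (J : E →L[ℂ] F) (K : F →L[ℂ] E) (C C' Q : E →L[ℂ] E) (z : ℂ) :
    J ∘L (z • C + Q) ∘L K - J ∘L ((0 : ℂ) • C' + Q) ∘L K = z • (J ∘L C ∘L K) := by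
  ext x
  simp

lemma differentiableAt_comp_pencil_comp (J : E →L[ℂ] F) (K : F →L[ℂ] E) (P Q : E →L[ℂ] E)
    {S : ℂ → E →L[ℂ] E} {z : ℂ} (hS : DifferentiableAt ℂ S z) :
    DifferentiableAt ℂ (fun z : ℂ => J ∘L (z • (P + S z) + Q) ∘L K) z :=
  (differentiableAt_const _).clm_comp
    (((differentiableAt_id.smul (hS.const_add _)).add_const _).clm_comp (differentiableAt_const _))

end OperatorPencil

section BlochFamily

variable {n : ℕ} (α : BlochVector n) (D : InclusionDomain n)

/-- The strong sum over the resonances, as a bounded operator. -/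
noncomputable def resonanceSumCLM (z : ℂ) : H1 α →L[ℂ] H1 α :=
  (UniformConvergenceCLM.ofFun (RingHom.id ℂ) (H1 α) {s : Set (H1 α) | Finite s}).symm
    (resonanceSum α D z)

lemma blochOp_eq (z : ℂ) : blochOp α D z = H1.toL2 α ∘L
    (z • (P1 α D + resonanceSumCLM α D z) + P2 α D) ∘L ContinuousLinearMap.adjoint (H1.toL2 α) := by
  have h : solutionMultiplier α D z = z • (P1 α D + resonanceSumCLM α D z) + P2 α D :=
    pencil_eq _ _ _ _
  rw [blochOp, h]
  rfl

lemma blochOp_sub_blochOp_zero (z : ℂ) : blochOp α D z - blochOp α D 0 = z • (H1.toL2 α ∘L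
    (P1 α D + resonanceSumCLM α D z) ∘L ContinuousLinearMap.adjoint (H1.toL2 α)) := by
  rw [blochOp_eq, blochOp_eq]
  exact comp_pencil_comp_sub _ _ _ _ _ _

lemma isCompactOperator_blochOp (z : ℂ) : IsCompactOperator (blochOp α D z) :=
  (isCompactOperator_toL2 α).comp_clm _

variable {α D} {μm : ℝ}

/-- The defining `∑'` would default to zero without summability. Below the first pole the
coefficients are bounded, and it is a true strong sum. -/
lemma hasSum_resonanceSumCLM (hμ : ∀ μ ∈ resonances α D, μm ≤ μ) (h1 : -1 / 2 < μm) (h2 : μm < 1 / 2)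
    {z : ℂ} (hz : ‖z‖ < (μm + 1 / 2) / (1 / 2 - μm)) (x : H1 α) :
    HasSum (fun μ : {μ : ℝ // μ ∈ resonances α D ∧ -1 / 2 < μ ∧ μ < 1 / 2} =>
      (resonanceCoeff μ z)⁻¹ • resonanceProj α D μ x) (resonanceSumCLM α D z x) := by
  obtain ⟨S, hS, -⟩ := (isOrthogonalProjections_resonanceProj α D
    (q := fun μ => μ ∈ resonances α D ∧ -1 / 2 < μ ∧ μ < 1 / 2)).exists_hasSum
    (c := fun μ => (resonanceCoeff μ z)⁻¹)
    (div_nonneg (one_div_nonneg.2 (by linarith)) (by linarith)) fun μ =>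
      norm_resonanceCoeff_inv_le h2 (hμ _ μ.2.1) μ.2.2.2 h1 le_rfl hz
  have h : resonanceSumCLM α D z = S := strong_tsum_eq hS
  rw [h]
  exact hS x

lemma norm_P1_add_resonanceSumCLM_le (hμ : ∀ μ ∈ resonances α D, μm ≤ μ) (h1 : -1 / 2 < μm)
    (h2 : μm < 1 / 2) {z : ℂ} (hz : ‖z‖ < (μm + 1 / 2) / (1 / 2 - μm)) :
    ‖P1 α D + resonanceSumCLM α D z‖ ≤
      (1 / (1 / 2 - μm)) / ((μm + 1 / 2) / (1 / 2 - μm) - ‖z‖) := by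
  refine (isOrthogonalProjections_resonanceProj α D
    (q := fun μ => μ ∈ resonances α D ∧ -1 / 2 < μ ∧ μ < 1 / 2)).norm_add_le
    (c := fun μ => (resonanceCoeff μ z)⁻¹) ?_
    (fun μ => norm_resonanceCoeff_inv_le h2 (hμ _ μ.2.1) μ.2.2.2 h1 le_rfl hz)
    (hasSum_resonanceSumCLM hμ h1 h2 hz) (inner_P1 α D) (P1_idem α D)
    (fun μ => P1_resonanceProj α D μ.2.2.2) (fun μ => resonanceProj_P1 α D μ.2.2.2)
  -- `P₁` carries the coefficient `1`, and the bound is at least `1` because `μm + 1/2 ≤ 1`.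
  rw [one_le_div (by linarith)]
  have : (μm + 1 / 2) / (1 / 2 - μm) ≤ 1 / (1 / 2 - μm) := by
    gcongr
    linarith
  linarith [norm_nonneg z]

/-- The quantitative continuity of the family at zero contrast parameter. -/
lemma norm_blochOp_sub_le (hμ : ∀ μ ∈ resonances α D, μm ≤ μ) (h1 : -1 / 2 < μm)
    (h2 : μm < 1 / 2) {z : ℂ} (hz : ‖z‖ < (μm + 1 / 2) / (1 / 2 - μm)) :
    ‖blochOp α D z - blochOp α D 0‖ ≤ ‖z‖ * ((1 / (1 / 2 - μm)) / ((μm + 1 / 2) / (1 / 2 - μm) - ‖z‖) *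
      ‖(W2 α D)ᗮ.starProjection ∘L ContinuousLinearMap.adjoint (H1.toL2 α)‖ ^ 2) := by
  have hS := hasSum_resonanceSumCLM hμ h1 h2 hz
  rw [blochOp_sub_blochOp_zero, norm_smul]
  -- `P₁` and the resonance sum annihilate `W₂` and map into its complement, so `J*` enters only
  -- through its part in `W₂ᗮ`.
  refine mul_le_mul_of_nonneg_left (le_trans (norm_comp_comp_adjoint_le _ (W2 α D) ?_ ?_)
    (mul_le_mul_of_nonneg_right (norm_P1_add_resonanceSumCLM_le hμ h1 h2 hz) (by positivity)))
    (norm_nonneg z)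
  · intro x
    have h3 := (P2 α D).hasSum (hS x)
    have h4 : HasSum (fun _ : {μ : ℝ // μ ∈ resonances α D ∧ -1 / 2 < μ ∧ μ < 1 / 2} => (0 : H1 α)) 
        (P2 α D (resonanceSumCLM α D z x)) := by
      refine h3.congr_fun fun μ => ?_
      rw [map_smul, P2_resonanceProj, smul_zero]
    have h5 := h4.unique hasSum_zero
    change P2 α D (P1 α D x + resonanceSumCLM α D z x) = 0
    rw [map_add, P2_P1, h5, add_zero]
  · intro x
    have h3 := hS (P2 α D x)
    simp only [resonanceProj_P2, smul_zero] at h3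
    change P1 α D (P2 α D x) + resonanceSumCLM α D z (P2 α D x) = 0
    rw [h3.unique hasSum_zero, P1_P2, add_zero]

lemma differentiableAt_resonanceSumCLM (hμ : ∀ μ ∈ resonances α D, μm ≤ μ) (h1 : -1 / 2 < μm)
    (h2 : μm < 1 / 2) (h3 : μm < 0) {z : ℂ} (hz : ‖z‖ < (μm + 1 / 2) / (1 / 2 - μm)) :
    DifferentiableAt ℂ (resonanceSumCLM α D) z := by
  -- An intermediate radius makes the coefficient bound uniform on a neighbourhood of `z`.
  obtain ⟨Z, hzZ, hZ⟩ := exists_between hz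
  have hin : ∀ w ∈ Metric.ball (0 : ℂ) Z, ‖w‖ < Z := fun w hw => by simpa using hw
  refine (isOrthogonalProjections_resonanceProj α D
    (q := fun μ => μ ∈ resonances α D ∧ -1 / 2 < μ ∧ μ < 1 / 2)).differentiableAt
    (a := fun μ => ((1 / 2 + (μ : ℝ) : ℝ) : ℂ)) (b := fun μ => ((1 / 2 - (μ : ℝ) : ℝ) : ℂ))
    (M := (1 / (1 / 2 - μm)) / ((μm + 1 / 2) / (1 / 2 - μm) - Z))
    (Metric.isOpen_ball (x := (0 : ℂ)) (ε := Z))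
    (div_nonneg (one_div_nonneg.2 (by linarith)) (by linarith)) (fun μ => ?_) (fun w hw μ => ?_)
    (fun w hw μ => norm_resonanceCoeff_inv_le h2 (hμ _ μ.2.1) μ.2.2.2 h1 (hin w hw).le hZ)
    (fun w hw => hasSum_resonanceSumCLM hμ h1 h2 ((hin w hw).trans hZ)) (by simpa using hzZ)
  · rw [Complex.norm_real, Real.norm_of_nonneg (by linarith [μ.2.2.2])]
    linarith [μ.2.2.1]
  · have h4 := le_norm_resonanceCoeff h2 (hμ _ μ.2.1) μ.2.2.2 h1 w
    refine norm_pos_iff.1 (lt_of_lt_of_le (mul_pos (by linarith) ?_) h4)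
    linarith [hin w hw]

lemma differentiableOn_blochOp (hμ : ∀ μ ∈ resonances α D, μm ≤ μ) (h1 : -1 / 2 < μm)
    (h2 : μm < 1 / 2) (h3 : μm < 0) :
    DifferentiableOn ℂ (blochOp α D) (Metric.ball 0 ((μm + 1 / 2) / (1 / 2 - μm))) := by
  intro z hz
  have h4 := differentiableAt_resonanceSumCLM hμ h1 h2 h3 (z := z) (by simpa using hz)
  have h5 : blochOp α D = _ := funext (blochOp_eq α D)
  rw [h5]
  exact (differentiableAt_comp_pencil_comp _ _ _ _ h4).differentiableWithinAt

end BlochFamily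

/-! ### Positivity of the distance from the contour to the spectrum. -/

section Gap

lemma gap_le_infDist (Γ : Contour) (σ : Set ℂ) {ζ : ℂ} (hζ : ζ ∈ Γ.trace) :
    Γ.gap σ ≤ Metric.infDist ζ σ :=
  csInf_le ⟨0, by rintro _ ⟨w, -, rfl⟩; exact Metric.infDist_nonneg⟩ ⟨ζ, hζ, rfl⟩

lemma gap_pos {Γ : Contour} {σ : Set ℂ} (hσ : IsClosed σ) (hne : σ.Nonempty)
    (h : ∀ ζ ∈ Γ.trace, ζ ∉ σ) : 0 < Γ.gap σ := by
  obtain ⟨ζ, hζ, hmin⟩ := Γ.isCompact_trace.exists_isMinOn Γ.trace_nonempty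
    (Metric.continuous_infDist_pt σ).continuousOn
  refine lt_of_lt_of_le ((hσ.notMem_iff_infDist_pos hne).1 (h ζ hζ))
    (le_csInf (Γ.trace_nonempty.image _) ?_)
  rintro _ ⟨w, hw, rfl⟩
  exact hmin hw

end Gap

end HighContrast

/-! ### The theorem: the constants are fitted to the abstract perturbation theorem. -/

theorem theorem6p1 {n : ℕ} (D : InclusionDomain n) (α : BlochVector n)
    (μm : ℝ) (hμm : IsLeast (resonances α D) μm) (hlow : -1 / 2 < μm) (hneg : μm < 0)
    (β : ℂ) (hβ : Module.End.HasEigenvalue (D.dirichletInverse : D.L2D →ₗ[ℂ] D.L2D) β)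
    (Γ : Contour) (hβΓ : β ∈ Γ.inside)
    (hΓ : ∀ w ∈ spectrum ℂ D.dirichletInverse, w ≠ β → w ∈ Γ.outside)
    (zs d rs : ℝ) (hzs : zs = (μm + 1 / 2) / (μm - 1 / 2))
    (hd : d = Γ.gap (spectrum ℂ D.dirichletInverse))
    (hrs : rs = ‖α.vec‖ ^ 2 * d * |zs| / (1 / (1 / 2 - μm) + ‖α.vec‖ ^ 2 * d)) :
    (∀ z ∈ Metric.ball (0 : ℂ) rs,
      (∀ ζ ∈ Γ.trace, ζ ∈ resolventSet ℂ (blochOp α D 0) ∧ ζ ∈ resolventSet ℂ (blochOp α D z)) ∧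
      spectrum ℂ (blochOp α D z) =
        (spectrum ℂ (blochOp α D z) ∩ Γ.inside) ∪ (spectrum ℂ (blochOp α D z) ∩ Γ.outside) ∧
      IsSpectralProjection (blochOp α D z) (rieszProj α D Γ z)
        (spectrum ℂ (blochOp α D z) ∩ Γ.inside)) ∧
    DifferentiableOn ℂ (rieszProj α D Γ) (Metric.ball 0 rs) ∧
    (∀ z ∈ Metric.ball (0 : ℂ) rs,
      FiniteDimensional ℂ (rieszProj α D Γ z).range ∧
      Nonempty ((rieszProj α D Γ z).range ≃L[ℂ] (rieszProj α D Γ 0).range)) ∧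
    TendstoUniformlyOn
      (fun (N : ℕ) (z : ℂ) => β + ∑ k ∈ Finset.Icc 1 N, z ^ k * meanCoeff α D Γ k)
      (meanEigenvalue α D Γ) atTop (Metric.ball 0 rs) := by
  obtain ⟨f, hf⟩ := hβ.exists_hasEigenvector
  have hnt : Nontrivial D.L2D := ⟨f, 0, hf.2⟩
  have hfβ : D.dirichletInverse f = β • f := hf.apply_eq_smul
  have hβ0 : β ≠ 0 := by
    rintro rfl
    exact hf.2 (dirichletInverse_injective D (by rw [hfβ, zero_smul]))
  -- `0` is a point of the Dirichlet spectrum other than `β`; finite rank of the Riesz projections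
  -- depends on its lying outside.
  have h0out : (0 : ℂ) ∈ Γ.outside := hΓ 0 (zero_mem_spectrum_dirichletInverse α D) hβ0.symm
  have hdisj : ∀ ζ ∈ Γ.trace, ζ ∉ spectrum ℂ D.dirichletInverse := by
    intro ζ hζ hσ
    by_cases h : ζ = β
    · exact hβΓ.1 (h ▸ hζ)
    · exact (hΓ ζ hσ h).1 hζ
  have hsub := spectrum_blochOp_zero_subset α D
  have hβσ : β ∈ spectrum ℂ (blochOp α D 0) := mem_spectrum_blochOp_zero α D hβ
  have hd0 : 0 < d := hd ▸ gap_pos (spectrum.isClosed _) ⟨β, hsub hβσ⟩ hdisj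
  have hres : ∀ ζ ∈ Γ.trace, ζ ∈ resolventSet ℂ (blochOp α D 0) := fun ζ hζ => by
    by_contra h
    exact hdisj ζ hζ (hsub h)
  have hntL2 : Nontrivial (L2 n) := by
    by_contra h
    rw [not_nontrivial_iff_subsingleton] at h
    have : Subsingleton (L2 n →L[ℂ] L2 n) := inferInstance
    exact (spectrum.of_subsingleton (R := ℂ) (blochOp α D 0) ▸ hβσ : β ∈ (∅ : Set ℂ))
  -- Passing to a smaller spectrum increases `infDist` only if that spectrum is nonempty, since the
  -- distance to `∅` is `0` by convention; `β` is the witness.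
  have hK : ∀ ζ ∈ Γ.trace, ‖resolvent (blochOp α D 0) ζ‖ ≤ d⁻¹ := fun ζ hζ =>
    norm_resolvent_le_of_isSelfAdjoint (isSelfAdjoint_blochOp_zero α D) (hres ζ hζ) hd0
      (hd ▸ (gap_le_infDist Γ _ hζ).trans (Metric.infDist_le_infDist_of_subset hsub ⟨β, hβσ⟩))
  have hinside : spectrum ℂ (blochOp α D 0) ∩ Γ.inside = {β} := by
    refine Set.Subset.antisymm (fun w hw => ?_) (Set.singleton_subset_iff.2 ⟨hβσ, hβΓ⟩)
    by_contra h
    exact Set.disjoint_left.1 Γ.disjoint_inside_outside hw.2 (hΓ w (hsub hw.1) h)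
  have hμ : ∀ μ ∈ resonances α D, μm ≤ μ := fun μ h => hμm.2 h
  have h2 : μm < 1 / 2 := by linarith
  set s : ℝ := 1 / (1 / 2 - μm) with hs
  set Z : ℝ := (μm + 1 / 2) / (1 / 2 - μm) with hZ
  have hs0 : 0 < s := one_div_pos.2 (by linarith)
  have hZ0 : 0 < Z := div_pos (by linarith) (by linarith)
  have hzsZ : |zs| = Z := by
    have : zs = -Z := by
      rw [hzs, hZ, ← neg_sub (1 / 2) μm, div_neg]
    rw [this, abs_neg, abs_of_pos hZ0]
  set Q : ℝ := ‖(W2 α D)ᗮ.starProjection ∘L ContinuousLinearMap.adjoint (H1.toL2 α)‖ with hQ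
  have hα : 0 < ‖α.vec‖ := norm_pos_iff.2 α.ne_zero
  have hQ0 : 0 ≤ Q := norm_nonneg _
  have hQα : Q ^ 2 * ‖α.vec‖ ^ 2 < 1 := by
    have h3 : Q * ‖α.vec‖ < 1 := by
      have := mul_lt_mul_of_pos_right (norm_starProjection_comp_lt α D) hα
      rwa [inv_mul_cancel₀ hα.ne'] at this
    rw [← mul_pow]
    exact pow_lt_one₀ (by positivity) h3 two_ne_zero
  -- The enlarged radius is where `‖z‖ s Q² / (Z - ‖z‖)` reaches `d`; it stays within the disc where
  -- the resonance sum is holomorphic.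
  have hρZ : d * Z / (s * Q ^ 2 + d) ≤ Z := by
    rw [div_le_iff₀ (by positivity)]
    nlinarith [mul_nonneg (mul_nonneg hs0.le (sq_nonneg Q)) hZ0.le]
  -- `rs` is the same expression with `Q` replaced by `‖α‖⁻¹`, so strictness comes from `Q ‖α‖ < 1`.
  have hrρ : rs < d * Z / (s * Q ^ 2 + d) := by
    rw [hrs, hzsZ, div_lt_div_iff₀ (by positivity) (by positivity)]
    have h3 : 0 < d * Z * s := by positivity
    nlinarith
  refine perturbation (A := blochOp α D) hres hK
    ((differentiableOn_blochOp hμ hlow h2 hneg).mono (Metric.ball_subset_ball hρZ))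
    (fun z _ => isCompactOperator_blochOp α D z) (fun z hz => ?_) h0out hinside
    (P := rieszProj α D Γ) rfl hrρ
  have hz1 : ‖z‖ * (s * Q ^ 2 + d) < d * Z := by
    rw [← lt_div_iff₀ (by positivity)]
    simpa using hz
  have hz2 : ‖z‖ < Z := lt_of_lt_of_le (by simpa using hz) hρZ
  have h3 := norm_blochOp_sub_le hμ hlow h2 hz2
  have h4 : 0 < Z - ‖z‖ := sub_pos.2 hz2
  rw [← div_eq_mul_inv, div_lt_one hd0]
  refine h3.trans_lt ?_
  have h5 : ‖z‖ * (s / (Z - ‖z‖) * Q ^ 2) = ‖z‖ * s * Q ^ 2 / (Z - ‖z‖) := by ring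
  rw [← hQ, h5, div_lt_iff₀ h4]
  linarith
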